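/- Let $p$ be a prime, $d\ge 2$ an integer, $F$ a field of characteristic $p$, and let $X$ and $Y$ be connected finite $d$-dimensional CW-complexes. Write $b_n(Z;F)=\dim_F H_n(Z;F)$ and $$\beta^{\inf,p}_n(Y;F)=\inf_{Y'\to Y}\frac{b_n(Y';F)}{|Y'\to Y|},$$ where the infimum runs over all connected regular coverings $Y'\to Y$ whose number of sheets $|Y'\to Y|$ is a (finite) power of $p$. A group is residually (finite $p$-group) if every nontrivial element has nontrivial image in some quotient that is a finite $p$-group; let $\mathcal{RF}_p$ be the class of these groups. An $\mathcal{RF}_p$-tower from $X$ to $Y$ is a sequence of maps $$X=Y_n\xrightarrow{i_n}\overline{Y_n}\xrightarrow{q_n}Y_{n-1}\xrightarrow{i_{n-1}}\overline{Y_{n-1}}\xrightarrow{q_{n-1}}\cdots\xrightarrow{i_1}\overline{Y_1}\xrightarrow{q_1}Y_0=Y,\qquad n\ge 1,$$ in which each $q_k$ is a regular covering, i.e. a principal $G_k$-bundle for a discrete group $G_k\in\mathcal{RF}_p$ (with $\overline{Y_k}$ carrying the lifted CW-structure; it need be neither connected nor finite), and each $i_k$ is the inclusion of a finite subcomplex.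 Suppose that there is an $\mathcal{RF}_p$-tower from $X$ to $Y$ and that $\beta^{\inf,p}_d(Y;F)=0$. Then: 1. $\beta^{\inf,p}_d(X;F)=0$. 2. If $d=2$, then either $\chi(X)\le 0$, or $b_1(X;F)=b_2(X;F)=0$ (and hence $\chi(X)=1$). -/

import Mathlib

universe u v

/-- The `n`-th singular homology of the space `X` with coefficients in the field `F`. -/
noncomputable abbrev singularHomologyOver (F : Type v) [Field F] (n : ℕ)
    (X : Type u) [TopologicalSpace X] : ModuleCat.{max u v} F :=
  ((AlgebraicTopology.singularHomologyFunctor (ModuleCat.{max u v} F) n).obj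
    (ModuleCat.of F (ULift.{u} F))).obj (TopCat.of X)

/-- The `n`-th Betti number `b_n(X; F) = dim_F H_n(X; F)`. -/
noncomputable def bettiNumber (F : Type v) [Field F] (n : ℕ)
    (X : Type u) [TopologicalSpace X] : ℕ :=
  Module.finrank F (singularHomologyOver.{u, v} F n X)

/-- A CW-complex: a Hausdorff space with a CW-structure on the whole space. -/
structure CWSpace : Type (u + 1) where
  carrier : Type u
  [topologicalSpace : TopologicalSpace carrier]
  [t2Space : T2Space carrier]
  [cwComplex : Topology.CWComplex (Set.univ : Set carrier)]

namespace CWSpace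

instance : CoeSort CWSpace.{u} (Type u) := ⟨CWSpace.carrier⟩

attribute [instance] topologicalSpace t2Space cwComplex

/-- The (indexing type of the) `n`-cells. -/
def Cell (X : CWSpace.{u}) (n : ℕ) : Type u :=
  Topology.RelCWComplex.cell (Set.univ : Set X) n

/-- The open cell with index `e`. -/
def openCell (X : CWSpace.{u}) {n : ℕ} (e : X.Cell n) : Set X :=
  Topology.RelCWComplex.openCell (C := (Set.univ : Set X)) n e

/-- `X` has only finitely many cells. -/
def IsFinite (X : CWSpace.{u}) : Prop :=
  Topology.RelCWComplex.Finite (Set.univ : Set X)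

/-- `X` is `d`-dimensional: there is a `d`-cell and there are no cells of higher dimension. -/
def HasDimension (X : CWSpace.{u}) (d : ℕ) : Prop :=
  Nonempty (X.Cell d) ∧ ∀ n, d < n → IsEmpty (X.Cell n)

/-- The Euler characteristic `∑ (-1)^n · #{n-cells}` of a finite CW-complex. -/
noncomputable def eulerCharacteristic (X : CWSpace.{u}) : ℤ :=
  ∑ᶠ n : ℕ, (-1 : ℤ) ^ n * (Nat.card (X.Cell n) : ℤ)

/-- `f` maps every open `n`-cell of `X` bijectively onto an open `n`-cell of `Y`. -/
def MapsCellsBijectively {X Y : CWSpace.{u}} (f : X → Y) : Prop :=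
  ∀ (n : ℕ) (e : X.Cell n), ∃ e' : Y.Cell n, Set.BijOn f (X.openCell e) (Y.openCell e')

/-- `i` is the inclusion of a subcomplex, i.e. an isomorphism of CW-complexes from `X` onto a
subcomplex of `Y` (a closed subspace that is a union of open cells of `Y`). -/
structure IsSubcomplexInclusion {X Y : CWSpace.{u}} (i : X → Y) : Prop where
  isClosedEmbedding : Topology.IsClosedEmbedding i
  mapsCells : MapsCellsBijectively i

/-- `q : Z → Y` is a regular covering of CW-complexes with group `G`: it is a principal `G`-bundle
for the discrete group `G`, and `Z` carries the CW-structure lifted from `Y`, i.e. the open cells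
of `Z` are the sheets of `q` over the open cells of `Y`. If `Z` is connected, then `G` is the
group of deck transformations of `q`. The total space `Z` need be neither connected nor finite. -/
structure IsRegularCovering (G : Type u) [Group G] {Z Y : CWSpace.{u}} [MulAction G Z]
    (q : Z → Y) : Prop where
  isQuotientCoveringMap : IsQuotientCoveringMap q G
  mapsCells : MapsCellsBijectively q

/-- `f : X → Y` is an elementary `𝓕`-tower: it factors as the inclusion of a finite subcomplex `X`
into a regular covering of `Y` whose covering group belongs to the family of groups `𝓕`. -/
def IsElementaryTower (𝓕 : (G : Type u) → [Group G] → Prop) (X Y : CWSpace.{u})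
    (f : X → Y) : Prop :=
  X.IsFinite ∧ ∃ (Z : CWSpace.{u}) (G : Type u) (_ : Group G) (_ : MulAction G Z)
    (i : X → Z) (q : Z → Y),
    𝓕 G ∧ IsSubcomplexInclusion i ∧ IsRegularCovering G q ∧ f = q ∘ i

/-- `IsTower 𝓕 X Y f`: the map `f : X → Y` is the underlying map of an `𝓕`-tower (of some length
`n ≥ 1`) with source `X` and target `Y`. -/
inductive IsTower (𝓕 : (G : Type u) → [Group G] → Prop) (Y : CWSpace.{u}) :
    (X : CWSpace.{u}) → (X → Y) → Prop where
  | elementary (X : CWSpace.{u}) (f : X → Y) : IsElementaryTower 𝓕 X Y f → IsTower 𝓕 Y X f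
  | step (X Y' : CWSpace.{u}) (f : X → Y') (g : Y' → Y) :
      IsTower 𝓕 Y Y' g → IsElementaryTower 𝓕 X Y' f → IsTower 𝓕 Y X (g ∘ f)

end CWSpace

/-- The class of residually (finite `p`-) groups: every nontrivial element survives in some
quotient that is a finite `p`-group. -/
def ResiduallyFiniteP (p : ℕ) (G : Type u) [Group G] : Prop :=
  ∀ g : G, g ≠ 1 → ∃ (N : Subgroup G) (_ : N.Normal), Finite (G ⧸ N) ∧ IsPGroup p (G ⧸ N) ∧ g ∉ N

/-- `β^{inf,p}_n(Y; F)`: the infimum of `b_n(Y'; F) / |Y' → Y|` over all regular coverings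
`Y' → Y` with connected total space whose number of sheets is a power of `p`. As `Y'` is connected,
`G` is the group of deck transformations, and its order is the number of sheets; so these are the
coverings belonging to the normal subgroups of `p`-power index of the fundamental group. -/
noncomputable def betaInfP (p : ℕ) (F : Type v) [Field F] (n : ℕ)
    (Y : Type u) [TopologicalSpace Y] : ℝ :=
  sInf {r : ℝ | ∃ (Y' : Type u) (_ : TopologicalSpace Y') (_ : ConnectedSpace Y')
    (G : Type u) (_ : Group G) (_ : MulAction G Y') (q : Y' → Y) (m : ℕ),
    IsQuotientCoveringMap q G ∧ Nat.card G = p ^ m ∧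
      r = (bettiNumber.{u, v} F n Y' : ℝ) / (Nat.card G : ℝ)}

/-!
Let `E → B` be a covering whose group is cyclic of order `p` with generator `t`. Over a field of
characteristic `p`, the endomorphism `t - 1` of the singular chains of `E` satisfies
`(t - 1) ^ p = t ^ p - 1 = 0`, and `ker (t - 1) = im (t - 1) ^ (p - 1)` is the image of the norm,
which is a copy of the singular chains of `B`. Filtering by the images of the powers of `t - 1`
gives `b_n(E) ≤ p b_n(B)`, hence `b_n(E) ≤ |G| b_n(B)` for coverings with any finite `p`-group `G`.
Moreover, in top dimension `d` a subcomplex `A` of `B` satisfies `b_d(A) ≤ b_d(B)`, as attaching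
cells of dimension at most `d` can only increase `b_d`.

For the inclusion `i : X → Z` of a finite subcomplex into a regular covering `Z → Y` whose group is
residually a finite `p`-group, a normal subgroup of `p`-power index separates the finitely many
cells of `X`, so that `X` embeds into a finite `p`-covering `W → Y`. Given a `p`-covering `E → Y`,
the pullback `X ×_Y E` is a covering of `X` of the same degree, and a subcomplex of `E ×_Y W`, which
is a `p`-covering of `E` of degree `|W → Y|`. Hence `b_d(X ×_Y E) ≤ |W → Y| b_d(E)`, where the
factor does not depend on `E`, and the normalized Betti numbers of `X` become arbitrarily small
along with those of `Y`. Restricting to path components gives connected coverings.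

If `d = 2` and `χ(X) > 0`, take a connected covering `E → X` with `b_2(E) < |G| / 2`. By
multiplicativity of the Euler characteristic, `1 - b_1(E) + b_2(E) = |G| χ(X) ≥ |G|`, which forces
`|G| = 1`, `b_1 = b_2 = 0` and `χ(X) = 1`.
-/

universe w

section ModuleSubcomplex

open CategoryTheory Limits

variable {R : Type v} [Ring R] {ι : Type*} {c : ComplexShape ι}

lemma exactAt_of_forall_exists {K : HomologicalComplex (ModuleCat.{w} R) c} {i : ι}
    (h : ∀ x : K.X i, (∀ j, K.d i j x = 0) → ∃ k, ∃ y : K.X k, K.d k i y = x) :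
    K.ExactAt i := by
  rw [HomologicalComplex.exactAt_iff, ShortComplex.moduleCat_exact_iff]
  intro x hx
  obtain ⟨k, y, rfl⟩ := h x fun j => by
    by_cases hij : c.Rel i j
    · obtain rfl := c.next_eq' hij
      exact hx
    · rw [K.shape i j hij]
      rfl
  by_cases hk : c.Rel k i
  · obtain rfl := c.prev_eq' hk
    exact ⟨y, rfl⟩
  · exact ⟨0, (map_zero _).trans (ConcreteCategory.congr_hom (K.shape k i hk) y).symm⟩

lemma isIso_homologyMap_of_acyclic_X₃ {C : Type*} [Category C] [Abelian C]
    {S : ShortComplex (HomologicalComplex C c)} (hS : S.ShortExact) (h : S.X₃.Acyclic) (i : ι) :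
    IsIso (HomologicalComplex.homologyMap S.f i) := by
  have := hS.mono_f
  have : Mono (HomologicalComplex.homologyMap S.f i) := by
    by_cases hi : ∃ j, c.Rel j i
    · obtain ⟨j, hj⟩ := hi
      exact (hS.homology_exact₁ j i hj).mono_g (((h j).isZero_homology).eq_of_src _ _)
    · exact HomologicalComplex.mono_homologyMap_of_mono_of_not_rel _ _ (by simpa using hi)
  have : Epi (HomologicalComplex.homologyMap S.f i) :=
    (hS.homology_exact₂ i).epi_f ((h i).isZero_homology.eq_of_tgt _ _)
  exact isIso_of_mono_of_epi _

lemma biprodX_ext {A B : HomologicalComplex (ModuleCat.{w} R) c} {i : ι} {x y : (A ⊞ B).X i}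
    (h₁ : (biprod.fst : A ⊞ B ⟶ A).f i x = (biprod.fst : A ⊞ B ⟶ A).f i y)
    (h₂ : (biprod.snd : A ⊞ B ⟶ B).f i x = (biprod.snd : A ⊞ B ⟶ B).f i y) : x = y := by
  have total (z : (A ⊞ B).X i) := ConcreteCategory.congr_hom (A.biprod_total_f B i) z
  rw [← ConcreteCategory.id_apply (X := (A ⊞ B).X i) x, ← total x]
  refine Eq.trans ?_ (total y)
  exact congrArg₂ (fun u v : (A ⊞ B).X i => u + v)
    (congrArg ((biprod.inl : A ⟶ A ⊞ B).f i) h₁) (congrArg ((biprod.inr : B ⟶ A ⊞ B).f i) h₂)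

lemma exists_biprodX {A B : HomologicalComplex (ModuleCat.{w} R) c} {i : ι} (a : A.X i)
    (b : B.X i) : ∃ x : (A ⊞ B).X i, (biprod.fst : A ⊞ B ⟶ A).f i x = a ∧
      (biprod.snd : A ⊞ B ⟶ B).f i x = b := by
  refine ⟨(biprod.inl : A ⟶ A ⊞ B).f i a + (biprod.inr : B ⟶ A ⊞ B).f i b, ?_, ?_⟩ <;>
    simp [← ConcreteCategory.comp_apply]

lemma nonempty_homology_biprod_equiv (A B : HomologicalComplex (ModuleCat.{w} R) c) (i : ι) :
    Nonempty ((A ⊞ B).homology i ≃ₗ[R] A.homology i × B.homology i) :=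
  have := preservesBinaryBiproducts_of_preservesBiproducts
    (HomologicalComplex.homologyFunctor (ModuleCat.{w} R) c i)
  ⟨(((HomologicalComplex.homologyFunctor (ModuleCat.{w} R) c i).mapBiprod A B) ≪≫
    ModuleCat.biprodIsoProd _ _).toLinearEquiv⟩

/-- A subcomplex of a complex of modules: submodules that are stable under the differentials. -/
@[ext]
structure ModuleSubcomplex (K : HomologicalComplex (ModuleCat.{w} R) c) where
  submodule : ∀ i, Submodule R (K.X i)
  d_mem : ∀ i j, ∀ x ∈ submodule i, K.d i j x ∈ submodule j

namespace ModuleSubcomplex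

variable {K L : HomologicalComplex (ModuleCat.{w} R) c}

instance : PartialOrder (ModuleSubcomplex K) :=
  PartialOrder.lift submodule fun _ _ => ModuleSubcomplex.ext

instance : Min (ModuleSubcomplex K) :=
  ⟨fun S T => ⟨fun i => S.submodule i ⊓ T.submodule i,
    fun i j x hx => ⟨S.d_mem i j x hx.1, T.d_mem i j x hx.2⟩⟩⟩

instance : Max (ModuleSubcomplex K) :=
  ⟨fun S T => ⟨fun i => S.submodule i ⊔ T.submodule i, fun i j x hx => by
    obtain ⟨y, hy, z, hz, rfl⟩ := Submodule.mem_sup.1 hx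
    rw [map_add]
    exact Submodule.add_mem_sup (S.d_mem i j y hy) (T.d_mem i j z hz)⟩⟩

instance : Lattice (ModuleSubcomplex K) :=
  Function.Injective.lattice submodule (fun _ _ => ModuleSubcomplex.ext) .rfl .rfl
    (fun _ _ => rfl) (fun _ _ => rfl)

/-- The subcomplex as a complex in its own right. -/
def toComplex (S : ModuleSubcomplex K) : HomologicalComplex (ModuleCat.{w} R) c where
  X i := ModuleCat.of R (S.submodule i)
  d i j := ModuleCat.ofHom ((K.d i j).hom.restrict (S.d_mem i j))
  shape i j hij := by
    ext x
    simp [LinearMap.restrict_apply, K.shape i j hij]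
  d_comp_d' i j k _ _ := by
    ext x
    exact ConcreteCategory.congr_hom (K.d_comp_d i j k) x.1

/-- The inclusion of a subcomplex into the ambient complex. -/
def incl (S : ModuleSubcomplex K) : S.toComplex ⟶ K where
  f i := ModuleCat.ofHom (S.submodule i).subtype
  comm' _ _ _ := rfl

/-- The inclusion of a subcomplex into a larger one. -/
def inclOfLE {S T : ModuleSubcomplex K} (h : S ≤ T) : S.toComplex ⟶ T.toComplex where
  f i := ModuleCat.ofHom (Submodule.inclusion (h i))
  comm' _ _ _ := rfl

/-- The quotient of a complex of modules by a subcomplex. -/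
def quotient (S : ModuleSubcomplex K) : HomologicalComplex (ModuleCat.{w} R) c where
  X i := ModuleCat.of R (K.X i ⧸ S.submodule i)
  d i j := ModuleCat.ofHom ((S.submodule i).mapQ (S.submodule j) (K.d i j).hom (S.d_mem i j))
  shape i j hij := by
    ext x
    simp [K.shape i j hij]
  d_comp_d' i j k _ _ := by
    ext x
    exact congrArg (S.submodule k).mkQ (ConcreteCategory.congr_hom (K.d_comp_d i j k) x)

/-- The projection of a complex of modules onto its quotient by a subcomplex. -/
def mkQ (S : ModuleSubcomplex K) : K ⟶ S.quotient where
  f i := ModuleCat.ofHom (S.submodule i).mkQ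
  comm' _ _ _ := rfl

/-- The short complex formed by a subcomplex, the ambient complex and the quotient. -/
def quotientShortComplex (S : ModuleSubcomplex K) :
    ShortComplex (HomologicalComplex (ModuleCat.{w} R) c) where
  f := S.incl
  g := S.mkQ
  zero := by
    ext i x
    exact (Submodule.Quotient.mk_eq_zero _).2 x.2

lemma shortExact_quotientShortComplex (S : ModuleSubcomplex K) :
    S.quotientShortComplex.ShortExact :=
  HomologicalComplex.shortExact_of_degreewise_shortExact _ fun i =>
    ModuleCat.shortComplex_shortExact _ (LinearMap.exact_subtype_mkQ (S.submodule i))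
      (S.submodule i).injective_subtype (S.submodule i).mkQ_surjective

lemma isIso_homologyMap_incl (S : ModuleSubcomplex K)
    (h : ∀ i, ∀ x : K.X i, (∀ j, K.d i j x ∈ S.submodule j) →
      ∃ k, ∃ y : K.X k, x - K.d k i y ∈ S.submodule i) (i : ι) :
    IsIso (HomologicalComplex.homologyMap S.incl i) := by
  refine isIso_homologyMap_of_acyclic_X₃ S.shortExact_quotientShortComplex (fun i => ?_) i
  refine exactAt_of_forall_exists fun x hx => ?_
  obtain ⟨x, rfl⟩ := (S.submodule i).mkQ_surjective x
  obtain ⟨k, y, hy⟩ := h i x fun j => (Submodule.Quotient.mk_eq_zero _).1 (hx j)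
  exact ⟨k, (S.submodule k).mkQ y, ((Submodule.Quotient.eq _).2 hy).symm⟩

/-- The image of a morphism of complexes of modules. -/
def range (φ : K ⟶ L) : ModuleSubcomplex L where
  submodule i := LinearMap.range (φ.f i).hom
  d_mem i j := by
    rintro _ ⟨x, rfl⟩
    exact ⟨K.d i j x, ConcreteCategory.congr_hom (φ.comm i j) x |>.symm⟩

/-- The kernel of a morphism of complexes of modules. -/
def ker (φ : K ⟶ L) : ModuleSubcomplex K where
  submodule i := LinearMap.ker (φ.f i).hom
  d_mem i j x hx := by
    have hx : φ.f i x = 0 := hx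
    change φ.f j (K.d i j x) = 0
    rw [← ConcreteCategory.comp_apply, ← φ.comm i j, ConcreteCategory.comp_apply, hx, map_zero]

/-- A surjection `ψ` with the same kernel as `φ` identifies its target with the image of `φ`. -/
noncomputable def isoRange {M : HomologicalComplex (ModuleCat.{w} R) c} (φ : K ⟶ L) (ψ : K ⟶ M)
    (hψ : ∀ i, Function.Surjective (ψ.f i)) (hker : ∀ i x, ψ.f i x = 0 ↔ φ.f i x = 0) :
    M ≅ (range φ).toComplex :=
  let e (i : ι) : M.X i ≃ₗ[R] LinearMap.range (φ.f i).hom :=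
    ((ψ.f i).hom.quotKerEquivOfSurjective (hψ i)).symm ≪≫ₗ
      Submodule.quotEquivOfEq _ (LinearMap.ker (φ.f i).hom) (Submodule.ext (hker i)) ≪≫ₗ
        (φ.f i).hom.quotKerEquivRange
  have coe_e (i : ι) (x : K.X i) : (e i (ψ.f i x)).1 = φ.f i x := by
    have : (ψ.f i).hom.quotKerEquivOfSurjective (hψ i) (Submodule.Quotient.mk x) = ψ.f i x := rfl
    rw [← this]
    simp only [e, LinearEquiv.trans_apply, LinearEquiv.symm_apply_apply,
      Submodule.quotEquivOfEq_mk, LinearMap.quotKerEquivRange_apply_mk]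
  HomologicalComplex.Hom.isoOfComponents (fun i => (e i).toModuleIso) fun i j _ => by
    ext y
    obtain ⟨x, rfl⟩ := hψ i y
    refine Subtype.ext ?_
    change L.d i j (e i (ψ.f i x)).1 = (e j (M.d i j (ψ.f i x))).1
    rw [coe_e, ← ConcreteCategory.comp_apply, φ.comm, ← ConcreteCategory.comp_apply (ψ.f i), ψ.comm,
      ConcreteCategory.comp_apply, ConcreteCategory.comp_apply, coe_e]

/-- The image of a subcomplex under a morphism of complexes of modules. -/
def map (φ : K ⟶ L) (S : ModuleSubcomplex K) : ModuleSubcomplex L where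
  submodule i := (S.submodule i).map (φ.f i).hom
  d_mem i j := by
    rintro _ ⟨x, hx, rfl⟩
    exact ⟨K.d i j x, S.d_mem i j x hx, (ConcreteCategory.congr_hom (φ.comm i j) x).symm⟩

/-- A morphism of complexes restricted to a subcomplex and its image. -/
def toMap (φ : K ⟶ L) (S : ModuleSubcomplex K) : S.toComplex ⟶ (map φ S).toComplex where
  f i := ModuleCat.ofHom ((φ.f i).hom.restrict fun _ => Submodule.mem_map_of_mem)
  comm' i j _ := by
    ext x
    refine Subtype.ext ?_
    exact ConcreteCategory.congr_hom (φ.comm i j) (x : S.submodule i).1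

/-- The short complex `ker φ ⟶ S ⟶ φ(S)` for a subcomplex `S` containing the kernel of `φ`. -/
def kerShortComplex (φ : K ⟶ L) {S : ModuleSubcomplex K} (hS : ker φ ≤ S) :
    ShortComplex (HomologicalComplex (ModuleCat.{w} R) c) where
  f := inclOfLE hS
  g := toMap φ S
  zero := by
    ext i x
    refine Subtype.ext ?_
    exact (x : (ker φ).submodule i).2

lemma shortExact_kerShortComplex (φ : K ⟶ L) {S : ModuleSubcomplex K} (hS : ker φ ≤ S) :
    (kerShortComplex φ hS).ShortExact := by
  refine HomologicalComplex.shortExact_of_degreewise_shortExact _ fun i =>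
    ModuleCat.shortComplex_shortExact _ (fun x => ⟨fun hx => ?_, ?_⟩)
      (Submodule.inclusion_injective (hS i)) ?_
  · exact ⟨⟨(x : S.submodule i).1, congrArg Subtype.val hx⟩, rfl⟩
  · rintro ⟨y, rfl⟩
    exact Subtype.ext (y : (ker φ).submodule i).2
  · rintro ⟨_, x, hx, h⟩
    exact ⟨⟨x, hx⟩, Subtype.ext h⟩

/-- The Mayer-Vietoris short complex `S ⊓ T ⟶ S ⊞ T ⟶ S ⊔ T` of two subcomplexes. -/
noncomputable def mayerVietoris (S T : ModuleSubcomplex K) :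
    ShortComplex (HomologicalComplex (ModuleCat.{w} R) c) where
  f := biprod.lift (inclOfLE (inf_le_left : S ⊓ T ≤ S)) (inclOfLE (inf_le_right : S ⊓ T ≤ T))
  g := biprod.desc (inclOfLE (le_sup_left : S ≤ S ⊔ T)) (-inclOfLE (le_sup_right : T ≤ S ⊔ T))
  zero := by
    rw [biprod.lift_desc, Preadditive.comp_neg]
    exact add_neg_cancel _

lemma shortExact_mayerVietoris (S T : ModuleSubcomplex K) : (mayerVietoris S T).ShortExact := by
  let p : S.toComplex ⊞ T.toComplex ⟶ S.toComplex := biprod.fst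
  let q : S.toComplex ⊞ T.toComplex ⟶ T.toComplex := biprod.snd
  have p_f (i) (x : (S ⊓ T).toComplex.X i) : p.f i ((mayerVietoris S T).f.f i x) = ⟨x.1, x.2.1⟩ :=
    ConcreteCategory.congr_hom (HomologicalComplex.biprod_lift_fst_f
      (inclOfLE (inf_le_left : S ⊓ T ≤ S)) (inclOfLE (inf_le_right : S ⊓ T ≤ T)) i) x
  have q_f (i) (x : (S ⊓ T).toComplex.X i) : q.f i ((mayerVietoris S T).f.f i x) = ⟨x.1, x.2.2⟩ :=
    ConcreteCategory.congr_hom (HomologicalComplex.biprod_lift_snd_f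
      (inclOfLE (inf_le_left : S ⊓ T ≤ S)) (inclOfLE (inf_le_right : S ⊓ T ≤ T)) i) x
  have coe_g (i) (b : (S.toComplex ⊞ T.toComplex).X i) :
      ((mayerVietoris S T).g.f i b).1 = (p.f i b).1 - (q.f i b).1 := by
    have := congrArg (fun φ => (φ.f i b).1) (biprod.desc_eq (f := inclOfLE
      (le_sup_left : S ≤ S ⊔ T)) (g := -inclOfLE (le_sup_right : T ≤ S ⊔ T)))
    exact this.trans (sub_eq_add_neg _ _).symm
  refine HomologicalComplex.shortExact_of_degreewise_shortExact _ fun i =>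
    ModuleCat.shortComplex_shortExact _ (fun b => ⟨fun hb => ?_, ?_⟩) ?_ ?_
  · have hpq : (p.f i b).1 = (q.f i b).1 :=
      sub_eq_zero.1 ((coe_g i b).symm.trans (congrArg Subtype.val hb))
    refine ⟨⟨(p.f i b).1, (p.f i b).2, hpq ▸ (q.f i b).2⟩, biprodX_ext (p_f i _) ?_⟩
    exact (q_f i _).trans (Subtype.ext hpq)
  · rintro ⟨x, rfl⟩
    exact ConcreteCategory.congr_hom (HomologicalComplex.congr_hom (mayerVietoris S T).zero i) x
  · intro x y hxy
    have := (p_f i x).symm.trans ((congrArg (p.f i) hxy).trans (p_f i y))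
    exact Subtype.ext (congrArg (fun z : S.submodule i => z.1) this)
  · rintro ⟨x, hx⟩
    obtain ⟨y, hy, z, hz, rfl⟩ := Submodule.mem_sup.1 hx
    obtain ⟨b, hb₁, hb₂⟩ := exists_biprodX (A := S.toComplex) (B := T.toComplex) (i := i)
      ⟨y, hy⟩ ⟨-z, neg_mem hz⟩
    refine ⟨b, Subtype.ext ((coe_g i b).trans ?_)⟩
    rw [hb₁, hb₂]
    exact sub_neg_eq_add y z

end ModuleSubcomplex

end ModuleSubcomplex

section EulerCharacteristic

open CategoryTheory Limits Module

variable {F : Type v} [Field F]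

lemma finite_of_function_exact {A B C : Type*} [AddCommGroup A] [AddCommGroup B]
    [AddCommGroup C] [Module F A] [Module F B] [Module F C] {f : A →ₗ[F] B} {g : B →ₗ[F] C}
    (h : Function.Exact f g) [Module.Finite F A] [Module.Finite F C] : Module.Finite F B := by
  have : Module.Finite F (LinearMap.ker g) := by
    rw [h.linearMap_ker_eq]
    infer_instance
  have : Module.Finite F (B ⧸ LinearMap.ker g) := Module.Finite.equiv g.quotKerEquivRange.symm
  exact Module.Finite.of_submodule_quotient (LinearMap.ker g)

lemma finrank_eq_of_function_exact {A B C : Type*} [AddCommGroup A] [AddCommGroup B]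
    [AddCommGroup C] [Module F A] [Module F B] [Module F C] {f : A →ₗ[F] B} {g : B →ₗ[F] C}
    (h : Function.Exact f g) [Module.Finite F B] :
    finrank F B = finrank F (LinearMap.range f) + finrank F (LinearMap.range g) := by
  rw [← g.finrank_range_add_finrank_ker, h.linearMap_ker_eq, add_comm]

lemma finrank_le_of_function_exact {A B C : Type*} [AddCommGroup A] [AddCommGroup B]
    [AddCommGroup C] [Module F A] [Module F B] [Module F C] {f : A →ₗ[F] B} {g : B →ₗ[F] C}
    (h : Function.Exact f g) [Module.Finite F A] [Module.Finite F C] :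
    finrank F B ≤ finrank F A + finrank F C := by
  have := finite_of_function_exact h
  rw [finrank_eq_of_function_exact h]
  exact add_le_add (LinearMap.finrank_range_le f) (Submodule.finrank_le _)

/-- `V` is finite-dimensional in every degree, vanishes in degrees `≥ N`, and has Euler
characteristic `c`. -/
structure HasEulerChar (F : Type v) [Field F] (V : ℕ → ModuleCat.{w} F) (N : ℕ) (c : ℤ) :
    Prop where
  finite : ∀ n, Module.Finite F (V n)
  subsingleton : ∀ n, N ≤ n → Subsingleton (V n)
  sum_eq : ∑ n ∈ Finset.range N, (-1 : ℤ) ^ n * (finrank F (V n) : ℤ) = c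

namespace HasEulerChar

variable {V W : ℕ → ModuleCat.{w} F} {N : ℕ} {c c' : ℤ}

lemma congr {W : ℕ → ModuleCat.{u} F} (h : HasEulerChar F V N c)
    (e : ∀ n, Nonempty (V n ≃ₗ[F] W n)) : HasEulerChar F W N c where
  finite n := by
    have := h.finite n
    exact Module.Finite.equiv (e n).some
  subsingleton n hn := by
    have := h.subsingleton n hn
    exact (e n).some.symm.toEquiv.subsingleton
  sum_eq := by
    rw [← h.sum_eq]
    exact Finset.sum_congr rfl fun n _ => by rw [(e n).some.finrank_eq]

lemma mono {N' : ℕ} (h : HasEulerChar F V N c) (hN : N ≤ N') : HasEulerChar F V N' c where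
  finite := h.finite
  subsingleton n hn := h.subsingleton n (hN.trans hn)
  sum_eq := by
    rw [← h.sum_eq]
    refine (Finset.sum_subset (Finset.range_mono hN) fun n _ hn => ?_).symm
    have := h.subsingleton n (by simpa using hn)
    rw [finrank_zero_of_subsingleton, Nat.cast_zero, mul_zero]

lemma prod (h : HasEulerChar F V N c) (h' : HasEulerChar F W N c') :
    HasEulerChar F (fun n => ModuleCat.of F (V n × W n)) N (c + c') where
  finite n := by
    have := h.finite n
    have := h'.finite n
    infer_instance
  subsingleton n hn := by
    have := h.subsingleton n hn
    have := h'.subsingleton n hn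
    infer_instance
  sum_eq := by
    rw [← h.sum_eq, ← h'.sum_eq, ← Finset.sum_add_distrib]
    refine Finset.sum_congr rfl fun n _ => ?_
    have := h.finite n
    have := h'.finite n
    rw [finrank_prod]
    push_cast
    ring

end HasEulerChar

section ShortExact

variable {S : ShortComplex (ChainComplex (ModuleCat.{w} F) ℕ)}

open HomologicalComplex

lemma function_exact_homologyMap (hS : S.ShortExact) (n : ℕ) :
    Function.Exact (homologyMap S.f n).hom (homologyMap S.g n).hom :=
  (ShortComplex.ShortExact.moduleCat_exact_iff_function_exact _).1 (hS.homology_exact₂ n)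

lemma function_exact_homologyMap_δ (hS : S.ShortExact) (n : ℕ) :
    Function.Exact (homologyMap S.g (n + 1)).hom (hS.δ (n + 1) n rfl).hom :=
  (ShortComplex.ShortExact.moduleCat_exact_iff_function_exact _).1
    (hS.homology_exact₃ (n + 1) n rfl)

lemma function_exact_δ_homologyMap (hS : S.ShortExact) (n : ℕ) :
    Function.Exact (hS.δ (n + 1) n rfl).hom (homologyMap S.f n).hom :=
  (ShortComplex.ShortExact.moduleCat_exact_iff_function_exact _).1
    (hS.homology_exact₁ (n + 1) n rfl)

lemma surjective_homologyMap_zero (hS : S.ShortExact) :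
    Function.Surjective (homologyMap S.g 0).hom := by
  have := hS.epi_g
  rw [← ModuleCat.epi_iff_surjective]
  exact epi_homologyMap_of_epi_of_not_rel _ _ (by simp)

lemma finrank_homology_zero_X₃ [∀ n, Module.Finite F (S.X₂.homology n)]
    (hS : S.ShortExact) :
    finrank F (S.X₃.homology 0) + finrank F (LinearMap.range (homologyMap S.f 0).hom) =
      finrank F (S.X₂.homology 0) := by
  rw [finrank_eq_of_function_exact (function_exact_homologyMap hS 0),
    LinearMap.range_eq_top.2 (surjective_homologyMap_zero hS), finrank_top, add_comm]

variable [∀ n, Module.Finite F (S.X₁.homology n)] [∀ n, Module.Finite F (S.X₂.homology n)]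

lemma finite_homology_X₃ (hS : S.ShortExact) : ∀ n, Module.Finite F (S.X₃.homology n)
  | 0 => Module.Finite.of_surjective _ (surjective_homologyMap_zero hS)
  | n + 1 => finite_of_function_exact (function_exact_homologyMap_δ hS n)

lemma finrank_homology_succ_X₃ (hS : S.ShortExact) (n : ℕ) :
    finrank F (S.X₃.homology (n + 1)) + finrank F (LinearMap.range (homologyMap S.f (n + 1)).hom) +
        finrank F (LinearMap.range (homologyMap S.f n).hom) =
      finrank F (S.X₂.homology (n + 1)) + finrank F (S.X₁.homology n) := by
  have := finite_homology_X₃ hS (n + 1)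
  rw [finrank_eq_of_function_exact (function_exact_homologyMap_δ hS n),
    finrank_eq_of_function_exact (function_exact_homologyMap hS (n + 1)),
    finrank_eq_of_function_exact (function_exact_δ_homologyMap hS n)]
  ring

lemma sum_finrank_homology_X₃ (hS : S.ShortExact) (n : ℕ) :
    ∑ i ∈ Finset.range (n + 1), (-1 : ℤ) ^ i * (finrank F (S.X₃.homology i) : ℤ) =
      ∑ i ∈ Finset.range (n + 1), (-1 : ℤ) ^ i * (finrank F (S.X₂.homology i) : ℤ) -
        ∑ i ∈ Finset.range n, (-1 : ℤ) ^ i * (finrank F (S.X₁.homology i) : ℤ) -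
        (-1 : ℤ) ^ n * finrank F (LinearMap.range (homologyMap S.f n).hom) := by
  induction n with
  | zero =>
    have h : (_ : ℤ) = _ := congrArg Nat.cast (finrank_homology_zero_X₃ hS)
    push_cast at h
    simp only [zero_add, Finset.sum_range_one, Finset.range_zero, Finset.sum_empty, pow_zero]
    linear_combination h
  | succ n ih =>
    have h : (_ : ℤ) = _ := congrArg Nat.cast (finrank_homology_succ_X₃ hS n)
    rw [Finset.sum_range_succ, ih, Finset.sum_range_succ _ (n + 1),
      Finset.sum_range_succ (fun i => (-1 : ℤ) ^ i * (finrank F (S.X₁.homology i) : ℤ))]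
    push_cast at h
    linear_combination (-1 : ℤ) ^ (n + 1) * h

end ShortExact

lemma HasEulerChar.of_shortExact {S : ShortComplex (ChainComplex (ModuleCat.{w} F) ℕ)}
    (hS : S.ShortExact) {N : ℕ} {a b : ℤ} (h₁ : HasEulerChar F (fun n => S.X₁.homology n) N a)
    (h₂ : HasEulerChar F (fun n => S.X₂.homology n) (N + 1) b) :
    HasEulerChar F (fun n => S.X₃.homology n) (N + 1) (b - a) := by
  have := h₁.finite
  have := h₂.finite
  refine ⟨finite_homology_X₃ hS, fun n hn => ?_, ?_⟩
  · obtain ⟨n, rfl⟩ : ∃ m, n = m + 1 := ⟨n - 1, by omega⟩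
    have := h₁.subsingleton n (by omega)
    have := h₂.subsingleton (n + 1) (by omega)
    have := finite_homology_X₃ hS (n + 1)
    rw [← Module.finrank_zero_iff (R := F), ← Nat.le_zero]
    calc finrank F (S.X₃.homology (n + 1))
        ≤ finrank F (S.X₂.homology (n + 1)) + finrank F (S.X₁.homology n) :=
          finrank_le_of_function_exact (function_exact_homologyMap_δ hS n)
      _ = 0 := by simp only [finrank_zero_of_subsingleton, add_zero]
  · have := h₁.subsingleton N le_rfl
    have hN : finrank F (LinearMap.range (HomologicalComplex.homologyMap S.f N).hom) = 0 := by
      have : Subsingleton (LinearMap.range (HomologicalComplex.homologyMap S.f N).hom) :=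
        (LinearMap.surjective_rangeRestrict _).subsingleton
      exact finrank_zero_of_subsingleton
    rw [sum_finrank_homology_X₃ hS, h₂.sum_eq, h₁.sum_eq, hN, Nat.cast_zero, mul_zero, sub_zero]

namespace ModuleSubcomplex

variable {K : ChainComplex (ModuleCat.{w} F) ℕ} {S T : ModuleSubcomplex K}

lemma hasEulerChar_sup {N : ℕ} {a b c : ℤ}
    (hS : HasEulerChar F (fun n => S.toComplex.homology n) (N + 1) a)
    (hT : HasEulerChar F (fun n => T.toComplex.homology n) (N + 1) b)
    (hST : HasEulerChar F (fun n => (S ⊓ T).toComplex.homology n) N c) :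
    HasEulerChar F (fun n => (S ⊔ T).toComplex.homology n) (N + 1) (a + b - c) :=
  hST.of_shortExact (shortExact_mayerVietoris S T) ((hS.prod hT).congr fun n =>
    (nonempty_homology_biprod_equiv S.toComplex T.toComplex n).map LinearEquiv.symm)

lemma exists_injective_homology_sup (n : ℕ) [Subsingleton ((S ⊓ T).toComplex.homology n)] :
    ∃ φ : (S.toComplex.homology n × T.toComplex.homology n) →ₗ[F] (S ⊔ T).toComplex.homology n,
      Function.Injective φ := by
  obtain ⟨e⟩ := nonempty_homology_biprod_equiv S.toComplex T.toComplex n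
  have exact := function_exact_homologyMap (shortExact_mayerVietoris S T) n
  have : Subsingleton ((mayerVietoris S T).X₁.homology n) := ‹_›
  let g := (HomologicalComplex.homologyMap (mayerVietoris S T).g n).hom
  have injective : Function.Injective g := by
    rw [injective_iff_map_eq_zero]
    intro x hx
    obtain ⟨y, rfl⟩ := (exact x).1 hx
    rw [Subsingleton.elim y 0, map_zero]
  exact ⟨g ∘ₗ e.symm.toLinearMap, injective.comp e.symm.injective⟩

lemma subsingleton_homology_toComplex (n : ℕ) (hS : ∀ x ∈ S.submodule n, x = 0) :
    Subsingleton (S.toComplex.homology n) := by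
  have : Subsingleton (S.toComplex.X n) :=
    ⟨fun (x y : S.submodule n) => Subtype.ext ((hS x x.2).trans (hS y y.2).symm)⟩
  exact ModuleCat.subsingleton_of_isZero (ShortComplex.isZero_homology_of_isZero_X₂
    (S.toComplex.sc n) (ModuleCat.isZero_of_subsingleton (S.toComplex.X n)))

lemma finite_and_finrank_homology_le_of_iterate_map (φ : K ⟶ K) (n : ℕ)
    [Module.Finite F ((ker φ).toComplex.homology n)] (l : ℕ) (S : ModuleSubcomplex K)
    (ker_le : ∀ k < l, ker φ ≤ (map φ)^[k] S)
    (eq_zero : ∀ x ∈ ((map φ)^[l] S).submodule n, x = 0) :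
    Module.Finite F (S.toComplex.homology n) ∧
      finrank F (S.toComplex.homology n) ≤ l * finrank F ((ker φ).toComplex.homology n) := by
  induction l generalizing S with
  | zero =>
    have : Subsingleton (S.toComplex.homology n) := subsingleton_homology_toComplex n eq_zero
    exact ⟨inferInstance, finrank_zero_of_subsingleton.trans_le (Nat.zero_le _)⟩
  | succ l ih =>
    obtain ⟨finite_map, finrank_map⟩ := ih (map φ S) (fun k hk => ker_le (k + 1) (by lia)) eq_zero
    have exact_homology := function_exact_homologyMap
      (shortExact_kerShortComplex φ (ker_le 0 l.succ_pos)) n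
    have : Module.Finite F ((kerShortComplex φ (ker_le 0 l.succ_pos)).X₁.homology n) := ‹_›
    have : Module.Finite F ((kerShortComplex φ (ker_le 0 l.succ_pos)).X₃.homology n) := finite_map
    refine ⟨finite_of_function_exact exact_homology,
      (finrank_le_of_function_exact exact_homology).trans ?_⟩
    rw [add_mul, one_mul, add_comm]
    exact Nat.add_le_add_right finrank_map _

lemma mem_iterate_map_range_id (φ : K ⟶ K) (k i : ℕ) (x : K.X i) :
    x ∈ ((map φ)^[k] (range (𝟙 K))).submodule i ↔ ∃ y, (φ.f i)^[k] y = x := by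
  induction k generalizing x with
  | zero => rfl
  | succ k ih =>
    rw [Function.iterate_succ_apply']
    constructor
    · rintro ⟨y, hy, rfl⟩
      obtain ⟨z, rfl⟩ := (ih y).1 hy
      exact ⟨z, Function.iterate_succ_apply' _ _ _⟩
    · rintro ⟨z, rfl⟩
      exact ⟨(φ.f i)^[k] z, (ih _).2 ⟨z, rfl⟩, (Function.iterate_succ_apply' (φ.f i) k z).symm⟩

lemma finite_and_finrank_homology_le_of_nilpotent (φ : K ⟶ K) (m : ℕ)
    (exists_iterate_eq : ∀ i x, φ.f i x = 0 → ∃ y, (φ.f i)^[m] y = x)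
    (iterate_eq_zero : ∀ i x, (φ.f i)^[m + 1] x = 0) (n : ℕ)
    [Module.Finite F ((ker φ).toComplex.homology n)] :
    Module.Finite F (K.homology n) ∧
      finrank F (K.homology n) ≤ (m + 1) * finrank F ((ker φ).toComplex.homology n) := by
  have e : K.homology n ≃ₗ[F] (range (𝟙 K)).toComplex.homology n :=
    ((HomologicalComplex.homologyFunctor _ _ n).mapIso
      (isoRange (𝟙 K) (𝟙 K) (fun _ => Function.surjective_id) fun _ _ => .rfl)).toLinearEquiv
  have ker_le (k) (hk : k < m + 1) : ker φ ≤ (map φ)^[k] (range (𝟙 K)) := fun i x hx => by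
    obtain ⟨y, rfl⟩ := exists_iterate_eq i x hx
    refine (mem_iterate_map_range_id φ k i _).2 ⟨(φ.f i)^[m - k] y, ?_⟩
    rw [← Function.iterate_add_apply, Nat.add_sub_cancel' (Nat.le_of_lt_succ hk)]
  obtain ⟨finite_range, finrank_range⟩ := finite_and_finrank_homology_le_of_iterate_map φ n (m + 1)
    (range (𝟙 K)) ker_le fun x hx => by
      obtain ⟨y, rfl⟩ := (mem_iterate_map_range_id φ (m + 1) n x).1 hx
      exact iterate_eq_zero n y
  exact ⟨Module.Finite.equiv e.symm, e.finrank_eq.trans_le finrank_range⟩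

end ModuleSubcomplex

end EulerCharacteristic

section TupleChain

variable {R : Type v} [Ring R] {P Q : Type*} {m : ℕ}

/-- Formal `R`-linear combinations of `m`-tuples of points of `P`; when `P` is convex they are
the affine chains of dimension `m - 1` in `P`. -/
abbrev TupleChain (R : Type v) [Ring R] (P : Type*) (m : ℕ) := (Fin m → P) →₀ R

namespace TupleChain

lemma hom_ext {M : Type*} [AddCommGroup M] [Module R M] {f g : TupleChain R P m →ₗ[R] M}
    (h : ∀ v, f (Finsupp.single v 1) = g (Finsupp.single v 1)) : f = g :=
  Finsupp.lhom_ext' fun v => LinearMap.ext_ring (h v)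

/-- The alternating sum of the faces of a tuple. -/
noncomputable def boundary : TupleChain R P (m + 1) →ₗ[R] TupleChain R P m :=
  Finsupp.linearCombination R
    fun v => ∑ i : Fin (m + 1), (-1 : R) ^ (i : ℕ) • Finsupp.single (v ∘ i.succAbove) 1

/-- The map of tuple chains induced by a map of points. -/
noncomputable def map (f : P → Q) : TupleChain R P m →ₗ[R] TupleChain R Q m :=
  Finsupp.lmapDomain R R (f ∘ ·)

/-- The cone on a tuple chain: the apex `b` is added in front of each tuple. -/
noncomputable def cone (b : P) : TupleChain R P m →ₗ[R] TupleChain R P (m + 1) :=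
  Finsupp.lmapDomain R R fun v => (Fin.cons b v : Fin (m + 1) → P)

lemma boundary_single (v : Fin (m + 1) → P) :
    boundary (Finsupp.single v (1 : R)) =
      ∑ i : Fin (m + 1), (-1 : R) ^ (i : ℕ) • Finsupp.single (v ∘ i.succAbove) 1 := by
  rw [boundary, Finsupp.linearCombination_single, one_smul]

lemma map_single (f : P → Q) (v : Fin m → P) (c : R) :
    map f (Finsupp.single v c) = Finsupp.single (f ∘ v) c := by
  simp [map]

lemma cone_single (b : P) (v : Fin m → P) (c : R) :
    cone b (Finsupp.single v c) = Finsupp.single (Fin.cons b v : Fin (m + 1) → P) c := by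
  simp [cone]

lemma boundary_map (f : P → Q) (x : TupleChain R P (m + 1)) :
    boundary (map f x) = map f (boundary x) := by
  refine LinearMap.congr_fun (f := boundary ∘ₗ map f) (g := map f ∘ₗ boundary)
    (hom_ext fun v => ?_) x
  simp only [LinearMap.comp_apply, map_single, boundary_single, map_sum, map_smul,
    Function.comp_assoc]

lemma map_cone (f : P → Q) (b : P) (x : TupleChain R P m) :
    map f (cone b x) = cone (f b) (map f x) := by
  refine LinearMap.congr_fun (f := map f ∘ₗ cone b) (g := cone (f b) ∘ₗ map f)
    (hom_ext fun v => ?_) x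
  simp only [LinearMap.comp_apply, cone_single, map_single, Fin.comp_cons]

lemma boundary_cone_zero (b : P) (x : TupleChain R P 0) : boundary (cone b x) = x := by
  refine LinearMap.congr_fun (f := boundary ∘ₗ cone b) (g := LinearMap.id)
    (hom_ext fun v => ?_) x
  simp only [LinearMap.comp_apply, cone_single, boundary_single, Fin.sum_univ_succ,
    Finset.univ_eq_empty, Finset.sum_empty]
  simp [Subsingleton.elim (_ : Fin 0 → P) v]

lemma boundary_cone_succ (b : P) (x : TupleChain R P (m + 1)) :
    boundary (cone b x) = x - cone b (boundary x) := by
  refine LinearMap.congr_fun (f := boundary ∘ₗ cone b)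
    (g := LinearMap.id - cone b ∘ₗ boundary) (hom_ext fun v => ?_) x
  have face_zero : (Fin.cons b v : Fin (m + 2) → P) ∘ Fin.succAbove 0 = v := by
    ext i; simp
  have face_succ (i : Fin (m + 1)) : (Fin.cons b v : Fin (m + 2) → P) ∘ i.succ.succAbove =
      Fin.cons b (v ∘ i.succAbove) := by
    ext j
    refine Fin.cases ?_ (fun j => ?_) j <;> simp
  simp only [LinearMap.comp_apply, LinearMap.sub_apply, LinearMap.id_apply, cone_single,
    boundary_single, map_sum, map_smul]
  rw [Fin.sum_univ_succ, face_zero, sub_eq_add_neg, ← Finset.sum_neg_distrib]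
  simp only [face_succ, Fin.val_zero, pow_zero, one_smul, Fin.val_succ, pow_succ, mul_neg,
    mul_one, neg_smul]

lemma boundary_boundary (x : TupleChain R P (m + 2)) : boundary (boundary x) = 0 := by
  induction m with
  | zero =>
    refine LinearMap.congr_fun (f := boundary ∘ₗ boundary) (g := 0) (hom_ext fun v => ?_) x
    rw [LinearMap.comp_apply, ← Fin.cons_self_tail v, ← cone_single, boundary_cone_succ, map_sub,
      boundary_cone_zero, sub_self, LinearMap.zero_apply]
  | succ m ih =>
    refine LinearMap.congr_fun (f := boundary ∘ₗ boundary) (g := 0) (hom_ext fun v => ?_) x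
    rw [LinearMap.comp_apply, ← Fin.cons_self_tail v, ← cone_single, boundary_cone_succ, map_sub,
      boundary_cone_succ, ih, map_zero, sub_zero, sub_self, LinearMap.zero_apply]

/-- Barycentric subdivision of tuple chains, where `β` chooses the barycentre of each nonempty
tuple. -/
noncomputable def subdivision (β : ∀ m, (Fin (m + 1) → P) → P) :
    ∀ {m}, TupleChain R P m →ₗ[R] TupleChain R P m
  | 0 => LinearMap.id
  | m + 1 => Finsupp.linearCombination R
      fun v => cone (β m v) (subdivision β (boundary (Finsupp.single v 1)))

/-- The chain homotopy between the identity and barycentric subdivision. -/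
noncomputable def subdivisionHomotopy (β : ∀ m, (Fin (m + 1) → P) → P) :
    ∀ {m}, TupleChain R P m →ₗ[R] TupleChain R P (m + 1)
  | 0 => 0
  | m + 1 => Finsupp.linearCombination R
      fun v => cone (β m v) (Finsupp.single v 1 - subdivision β (Finsupp.single v 1) -
        subdivisionHomotopy β (boundary (Finsupp.single v 1)))

variable (β : ∀ m, (Fin (m + 1) → P) → P)

lemma subdivision_zero (x : TupleChain R P 0) : subdivision β x = x := by
  rw [subdivision, LinearMap.id_apply]

lemma subdivision_succ_single (v : Fin (m + 1) → P) :
    subdivision β (Finsupp.single v (1 : R)) =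
      cone (β m v) (subdivision β (boundary (Finsupp.single v 1))) := by
  rw [subdivision, Finsupp.linearCombination_single, one_smul]

lemma subdivisionHomotopy_zero (x : TupleChain R P 0) : subdivisionHomotopy β x = 0 := by
  rw [subdivisionHomotopy, LinearMap.zero_apply]

lemma subdivisionHomotopy_succ_single (v : Fin (m + 1) → P) :
    subdivisionHomotopy β (Finsupp.single v (1 : R)) =
      cone (β m v) (Finsupp.single v 1 - subdivision β (Finsupp.single v 1) -
        subdivisionHomotopy β (boundary (Finsupp.single v 1))) := by
  rw [subdivisionHomotopy, Finsupp.linearCombination_single, one_smul]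

lemma boundary_subdivision (x : TupleChain R P (m + 1)) :
    boundary (subdivision β x) = subdivision β (boundary x) := by
  induction m with
  | zero =>
    refine LinearMap.congr_fun (f := boundary ∘ₗ subdivision β)
      (g := subdivision β ∘ₗ boundary) (hom_ext fun v => ?_) x
    simp only [LinearMap.comp_apply, subdivision_succ_single, boundary_cone_zero]
  | succ m ih =>
    refine LinearMap.congr_fun (f := boundary ∘ₗ subdivision β)
      (g := subdivision β ∘ₗ boundary) (hom_ext fun v => ?_) x
    simp only [LinearMap.comp_apply]
    rw [subdivision_succ_single, boundary_cone_succ, ih, boundary_boundary, map_zero, map_zero,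
      sub_zero]

lemma boundary_subdivisionHomotopy {m : ℕ} (x : TupleChain R P (m + 1)) :
    boundary (subdivisionHomotopy β x) =
      x - subdivision β x - subdivisionHomotopy β (boundary x) := by
  have boundary_eq_zero (v : Fin (m + 1) → P) :
      boundary (Finsupp.single v (1 : R) - subdivision β (Finsupp.single v 1) -
        subdivisionHomotopy β (boundary (Finsupp.single v 1))) = 0 := by
    rw [map_sub, map_sub, boundary_subdivision]
    match m with
    | 0 => rw [subdivision_zero, subdivisionHomotopy_zero, map_zero, sub_self, sub_zero]
    | m + 1 =>
      rw [boundary_subdivisionHomotopy, boundary_boundary, map_zero, sub_zero, sub_self]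
  refine LinearMap.congr_fun (f := boundary ∘ₗ subdivisionHomotopy β)
    (g := LinearMap.id - subdivision β - subdivisionHomotopy β ∘ₗ boundary)
    (hom_ext fun v => ?_) x
  rw [LinearMap.comp_apply, subdivisionHomotopy_succ_single, boundary_cone_succ,
    boundary_eq_zero, map_zero, sub_zero]
  rfl

variable {β} {β' : ∀ m, (Fin (m + 1) → Q) → Q} {f : P → Q}

lemma map_subdivision (hβ : ∀ m v, f (β m v) = β' m (f ∘ v)) (x : TupleChain R P m) :
    map f (subdivision β x) = subdivision β' (map f x) := by
  induction m with
  | zero => simp only [subdivision_zero]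
  | succ m ih =>
    refine LinearMap.congr_fun (f := map f ∘ₗ subdivision β)
      (g := subdivision β' ∘ₗ map f) (hom_ext fun v => ?_) x
    simp only [LinearMap.comp_apply]
    rw [subdivision_succ_single, map_cone, ih, ← boundary_map, map_single,
      subdivision_succ_single, hβ]

lemma map_subdivisionHomotopy (hβ : ∀ m v, f (β m v) = β' m (f ∘ v)) (x : TupleChain R P m) :
    map f (subdivisionHomotopy β x) = subdivisionHomotopy β' (map f x) := by
  induction m with
  | zero => simp only [subdivisionHomotopy_zero, map_zero]
  | succ m ih =>
    refine LinearMap.congr_fun (f := map f ∘ₗ subdivisionHomotopy β)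
      (g := subdivisionHomotopy β' ∘ₗ map f) (hom_ext fun v => ?_) x
    simp only [LinearMap.comp_apply]
    rw [subdivisionHomotopy_succ_single, map_cone, map_sub (map (R := R) f),
      map_sub (map (R := R) f), ih,
      ← boundary_map, map_subdivision hβ, map_single, subdivisionHomotopy_succ_single, hβ]

lemma exists_cons_of_mem_support_subdivision (v w : Fin (m + 1) → P)
    (hw : w ∈ (subdivision β (Finsupp.single v (1 : R))).support) :
    ∃ (i : Fin (m + 1)) (w' : Fin m → P), w = Fin.cons (β m v) w' ∧
      w' ∈ (subdivision β (Finsupp.single (v ∘ i.succAbove) (1 : R))).support := by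
  classical
  rw [subdivision_succ_single] at hw
  obtain ⟨w', hw', rfl⟩ := Finset.mem_image.1 (Finsupp.mapDomain_support hw)
  rw [boundary_single, map_sum] at hw'
  obtain ⟨i, -, hi⟩ := Finset.mem_biUnion.1 (Finsupp.support_finsetSum hw')
  rw [map_smul] at hi
  exact ⟨i, w', rfl, Finsupp.support_smul hi⟩

end TupleChain

end TupleChain

section SingularChain

open CategoryTheory

/-- The standard topological `n`-simplex. -/
abbrev TopSimplex (n : ℕ) := stdSimplex ℝ (Fin (n + 1))

section AffineSimplex

variable {k l n : ℕ}

/-- The affine map of standard simplices with prescribed images of the vertices. -/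
noncomputable def affineSimplex (w : Fin (n + 1) → TopSimplex k) :
    C(TopSimplex n, TopSimplex k) where
  toFun t := ⟨fun j => ∑ i, t i * w i j,
    fun j => Finset.sum_nonneg fun i _ => mul_nonneg (t.2.1 i) ((w i).2.1 j), by
      rw [Finset.sum_comm]
      simp_rw [← Finset.mul_sum]
      have sum_coords (i) : ∑ j, w i j = 1 := (w i).2.2
      simp_rw [sum_coords, mul_one]
      exact t.2.2⟩
  continuous_toFun :=
    (continuous_pi fun j => continuous_finsetSum _ fun i _ =>
      ((continuous_apply i).comp continuous_subtype_val).mul continuous_const).subtype_mk _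

lemma affineSimplex_apply (w : Fin (n + 1) → TopSimplex k) (t : TopSimplex n) (j : Fin (k + 1)) :
    affineSimplex w t j = ∑ i, t i * w i j := rfl

lemma affineSimplex_comp_vertex (w : Fin (n + 1) → TopSimplex k) :
    affineSimplex w ∘ stdSimplex.vertex = w := by
  ext i j
  rw [Function.comp_apply, affineSimplex_apply, Finset.sum_eq_single i]
  · simp
  · intro k _ hk
    simp [hk]
  · simp

lemma affineSimplex_vertex (n : ℕ) :
    affineSimplex (stdSimplex.vertex : Fin (n + 1) → TopSimplex n) = ContinuousMap.id _ := by
  ext t j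
  rw [affineSimplex_apply, Finset.sum_eq_single j]
  · simp
  · intro k _ hk
    simp [hk.symm]
  · simp

lemma affineSimplex_affineSimplex (w : Fin (k + 1) → TopSimplex l)
    (v : Fin (n + 1) → TopSimplex k) (t : TopSimplex n) :
    affineSimplex w (affineSimplex v t) = affineSimplex (affineSimplex w ∘ v) t := by
  ext j
  simp only [affineSimplex_apply, Function.comp_apply, Finset.sum_mul, Finset.mul_sum]
  rw [Finset.sum_comm]
  simp_rw [mul_assoc]

/-- The barycentre of a tuple of points in a standard simplex. -/
noncomputable def tupleBarycenter (l n : ℕ) (v : Fin (n + 1) → TopSimplex l) : TopSimplex l :=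
  affineSimplex v stdSimplex.barycenter

lemma affineSimplex_tupleBarycenter (w : Fin (l + 1) → TopSimplex k) (n : ℕ)
    (v : Fin (n + 1) → TopSimplex l) :
    affineSimplex w (tupleBarycenter l n v) = tupleBarycenter k n (affineSimplex w ∘ v) :=
  affineSimplex_affineSimplex _ _ _

end AffineSimplex

/-- Singular `n`-chains of `X` with coefficients in `R`. -/
abbrev SingularChain (R : Type v) [Ring R] (X : Type u) [TopologicalSpace X] (n : ℕ) :=
  C(TopSimplex n, X) →₀ R

namespace SingularChain

variable {R : Type v} [Ring R] {X : Type u} [TopologicalSpace X] {k l m n : ℕ}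

/-- The singular chain of `X` obtained from an affine chain in a standard simplex by composing
with a singular simplex of `X`. -/
noncomputable def ofTuple (σ : C(TopSimplex m, X)) :
    TupleChain R (TopSimplex m) (n + 1) →ₗ[R] SingularChain R X n :=
  Finsupp.lmapDomain R R fun w => σ.comp (affineSimplex w)

lemma ofTuple_single (σ : C(TopSimplex m, X)) (w : Fin (n + 1) → TopSimplex m) (c : R) :
    ofTuple σ (Finsupp.single w c) = Finsupp.single (σ.comp (affineSimplex w)) c := by
  simp [ofTuple]

lemma ofTuple_vertex (σ : C(TopSimplex m, X)) (c : R) :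
    ofTuple σ (Finsupp.single stdSimplex.vertex c) = Finsupp.single σ c := by
  rw [ofTuple_single, affineSimplex_vertex, ContinuousMap.comp_id]

lemma ofTuple_comp_affineSimplex (σ : C(TopSimplex m, X)) (w : Fin (l + 1) → TopSimplex m)
    (x : TupleChain R (TopSimplex l) (n + 1)) :
    ofTuple (σ.comp (affineSimplex w)) x = ofTuple σ (TupleChain.map (affineSimplex w) x) := by
  refine LinearMap.congr_fun (f := ofTuple (σ.comp (affineSimplex w)))
    (g := ofTuple σ ∘ₗ TupleChain.map (affineSimplex w)) (TupleChain.hom_ext fun v => ?_) x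
  simp only [LinearMap.comp_apply, ofTuple_single, TupleChain.map_single]
  congr 1
  ext t
  simp only [ContinuousMap.comp_apply, affineSimplex_affineSimplex]

/-- The natural operator on singular chains determined by an operator on affine chains in the
standard simplex, by applying the latter to the universal simplex. -/
noncomputable def naturalOperator
    (θ : TupleChain R (TopSimplex n) (n + 1) →ₗ[R] TupleChain R (TopSimplex n) (k + 1)) :
    SingularChain R X n →ₗ[R] SingularChain R X k :=
  Finsupp.linearCombination R fun σ => ofTuple σ (θ (Finsupp.single stdSimplex.vertex 1))

lemma naturalOperator_ofTuple
    (θ : ∀ m, TupleChain R (TopSimplex m) (n + 1) →ₗ[R] TupleChain R (TopSimplex m) (k + 1))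
    (hθ : ∀ l m (w : Fin (l + 1) → TopSimplex m) x, TupleChain.map (affineSimplex w) (θ l x) =
      θ m (TupleChain.map (affineSimplex w) x))
    (σ : C(TopSimplex m, X)) (x : TupleChain R (TopSimplex m) (n + 1)) :
    naturalOperator (θ n) (ofTuple σ x) = ofTuple σ (θ m x) := by
  refine LinearMap.congr_fun (f := naturalOperator (θ n) ∘ₗ ofTuple σ)
    (g := ofTuple σ ∘ₗ θ m) (TupleChain.hom_ext fun w => ?_) x
  rw [LinearMap.comp_apply, LinearMap.comp_apply, ofTuple_single, naturalOperator,
    Finsupp.linearCombination_single, one_smul, ofTuple_comp_affineSimplex, hθ,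
    TupleChain.map_single, affineSimplex_comp_vertex]

lemma hom_ext {M : Type*} [AddCommGroup M] [Module R M] {f g : SingularChain R X n →ₗ[R] M}
    (h : ∀ σ : C(TopSimplex n, X), f (ofTuple σ (Finsupp.single stdSimplex.vertex 1)) =
      g (ofTuple σ (Finsupp.single stdSimplex.vertex 1))) : f = g :=
  Finsupp.lhom_ext' fun σ => LinearMap.ext_ring <| by
    have hσ := h σ
    rwa [ofTuple_vertex] at hσ

/-- The singular chains all of whose simplices lie in `U`. -/
def supportedIn (R : Type v) [Ring R] (U : Set X) (n : ℕ) : Submodule R (SingularChain R X n) :=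
  Finsupp.supported R R {σ | ∀ t, σ t ∈ U}

lemma single_mem_supportedIn {U : Set X} {σ : C(TopSimplex n, X)} (hσ : ∀ t, σ t ∈ U) (c : R) :
    Finsupp.single σ c ∈ supportedIn R U n :=
  Finsupp.single_mem_supported R c hσ

lemma naturalOperator_mem_supportedIn
    (θ : TupleChain R (TopSimplex n) (n + 1) →ₗ[R] TupleChain R (TopSimplex n) (k + 1))
    {U : Set X} {x : SingularChain R X n} (hx : x ∈ supportedIn R U n) :
    naturalOperator θ x ∈ supportedIn R U k := by
  rw [naturalOperator, Finsupp.linearCombination_apply]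
  refine Submodule.sum_mem _ fun σ hσ => Submodule.smul_mem _ _ ?_
  have mem_U (t) : σ t ∈ U := (Finsupp.mem_supported _ _).1 hx hσ t
  induction θ (Finsupp.single stdSimplex.vertex 1) using Finsupp.induction_linear with
  | zero => simp only [map_zero, Submodule.zero_mem]
  | add y z hy hz =>
    rw [map_add]
    exact Submodule.add_mem _ hy hz
  | single v c =>
    rw [ofTuple_single]
    exact single_mem_supportedIn (σ := σ.comp (affineSimplex v))
      (fun t => mem_U (affineSimplex v t)) c

lemma naturalOperator_mem_supportedIn_sup
    (θ : TupleChain R (TopSimplex n) (n + 1) →ₗ[R] TupleChain R (TopSimplex n) (k + 1))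
    {U V : Set X} {x : SingularChain R X n} (hx : x ∈ supportedIn R U n ⊔ supportedIn R V n) :
    naturalOperator θ x ∈ supportedIn R U k ⊔ supportedIn R V k := by
  obtain ⟨y, hy, z, hz, rfl⟩ := Submodule.mem_sup.1 hx
  rw [map_add]
  exact Submodule.add_mem_sup (naturalOperator_mem_supportedIn θ hy)
    (naturalOperator_mem_supportedIn θ hz)

/-- The singular boundary operator. -/
noncomputable def boundary : SingularChain R X (n + 1) →ₗ[R] SingularChain R X n :=
  naturalOperator TupleChain.boundary

/-- Barycentric subdivision of singular chains. -/
noncomputable def subdivision : SingularChain R X n →ₗ[R] SingularChain R X n :=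
  naturalOperator (TupleChain.subdivision (tupleBarycenter _))

/-- The chain homotopy between the identity and barycentric subdivision. -/
noncomputable def subdivisionHomotopy : SingularChain R X n →ₗ[R] SingularChain R X (n + 1) :=
  naturalOperator (TupleChain.subdivisionHomotopy (tupleBarycenter _))

lemma boundary_ofTuple (σ : C(TopSimplex m, X)) (x : TupleChain R (TopSimplex m) (n + 2)) :
    boundary (ofTuple σ x) = ofTuple σ (TupleChain.boundary x) :=
  naturalOperator_ofTuple (fun _ => TupleChain.boundary)
    (fun _ _ _ _ => (TupleChain.boundary_map _ _).symm) σ x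

lemma subdivision_ofTuple (σ : C(TopSimplex m, X)) (x : TupleChain R (TopSimplex m) (n + 1)) :
    subdivision (ofTuple σ x) = ofTuple σ (TupleChain.subdivision (tupleBarycenter _) x) :=
  naturalOperator_ofTuple (fun _ => TupleChain.subdivision (tupleBarycenter _))
    (fun _ _ w _ => TupleChain.map_subdivision (affineSimplex_tupleBarycenter w) _) σ x

lemma subdivisionHomotopy_ofTuple (σ : C(TopSimplex m, X))
    (x : TupleChain R (TopSimplex m) (n + 1)) :
    subdivisionHomotopy (ofTuple σ x) =
      ofTuple σ (TupleChain.subdivisionHomotopy (tupleBarycenter _) x) :=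
  naturalOperator_ofTuple (fun _ => TupleChain.subdivisionHomotopy (tupleBarycenter _))
    (fun _ _ w _ => TupleChain.map_subdivisionHomotopy (affineSimplex_tupleBarycenter w) _) σ x

lemma boundary_single (σ : C(TopSimplex (n + 1), X)) :
    boundary (Finsupp.single σ (1 : R)) = ∑ i : Fin (n + 2), (-1 : R) ^ (i : ℕ) •
      Finsupp.single (σ.comp (affineSimplex (stdSimplex.vertex ∘ i.succAbove))) 1 := by
  rw [← ofTuple_vertex, boundary_ofTuple, TupleChain.boundary_single, map_sum]
  simp_rw [map_smul, ofTuple_single]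

lemma boundary_boundary (x : SingularChain R X (n + 2)) : boundary (boundary x) = 0 := by
  refine LinearMap.congr_fun (f := boundary ∘ₗ boundary) (g := 0) (hom_ext fun σ => ?_) x
  rw [LinearMap.comp_apply, boundary_ofTuple, boundary_ofTuple, TupleChain.boundary_boundary,
    map_zero, LinearMap.zero_apply]

lemma boundary_subdivision (x : SingularChain R X (n + 1)) :
    boundary (subdivision x) = subdivision (boundary x) := by
  refine LinearMap.congr_fun (f := boundary ∘ₗ subdivision) (g := subdivision ∘ₗ boundary)
    (hom_ext fun σ => ?_) x
  simp only [LinearMap.comp_apply, subdivision_ofTuple, boundary_ofTuple,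
    TupleChain.boundary_subdivision]

lemma boundary_subdivisionHomotopy_zero (x : SingularChain R X 0) :
    boundary (subdivisionHomotopy x) = x - subdivision x := by
  refine LinearMap.congr_fun (f := boundary ∘ₗ subdivisionHomotopy)
    (g := LinearMap.id - subdivision) (hom_ext fun σ => ?_) x
  simp only [LinearMap.comp_apply, LinearMap.sub_apply, LinearMap.id_apply,
    subdivisionHomotopy_ofTuple, subdivision_ofTuple, boundary_ofTuple,
    TupleChain.boundary_subdivisionHomotopy, TupleChain.subdivisionHomotopy_zero, map_sub, sub_zero]

lemma boundary_subdivisionHomotopy_succ (x : SingularChain R X (n + 1)) :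
    boundary (subdivisionHomotopy x) = x - subdivision x - subdivisionHomotopy (boundary x) := by
  refine LinearMap.congr_fun (f := boundary ∘ₗ subdivisionHomotopy)
    (g := LinearMap.id - subdivision - subdivisionHomotopy ∘ₗ boundary) (hom_ext fun σ => ?_) x
  simp only [LinearMap.comp_apply, LinearMap.sub_apply, LinearMap.id_apply,
    subdivisionHomotopy_ofTuple, subdivision_ofTuple, boundary_ofTuple,
    TupleChain.boundary_subdivisionHomotopy, map_sub]

end SingularChain

variable (R : Type v) [Ring R] (X : Type u) [TopologicalSpace X]

/-- The singular chain complex of `X`, with chains modelled as finitely supported functions. -/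
noncomputable def singularComplex : ChainComplex (ModuleCat.{max u v} R) ℕ :=
  ChainComplex.of (fun n => ModuleCat.of R (SingularChain R X n))
    (fun _ => ModuleCat.ofHom SingularChain.boundary)
    fun _ => ModuleCat.hom_ext <| LinearMap.ext SingularChain.boundary_boundary

lemma singularComplex_d (n : ℕ) :
    (singularComplex R X).d (n + 1) n = ModuleCat.ofHom SingularChain.boundary :=
  ChainComplex.of_d (fun n => ModuleCat.of R (SingularChain R X n))
    (fun _ => ModuleCat.ofHom SingularChain.boundary) n

/-- Barycentric subdivision as an endomorphism of the singular chain complex. -/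
noncomputable def subdivisionHom : singularComplex R X ⟶ singularComplex R X :=
  ChainComplex.ofHom (fun _ => ModuleCat.ofHom SingularChain.subdivision) fun n => by
    rw [singularComplex_d]
    exact ModuleCat.hom_ext (LinearMap.ext SingularChain.boundary_subdivision)

variable {X}

/-- The subcomplex of the singular chains all of whose simplices lie in `U`. -/
noncomputable def chainsIn (U : Set X) : ModuleSubcomplex (singularComplex R X) where
  submodule := SingularChain.supportedIn R U
  d_mem i j x hx := by
    by_cases hij : j + 1 = i
    · subst hij
      rw [singularComplex_d]
      exact SingularChain.naturalOperator_mem_supportedIn _ hx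
    · rw [(singularComplex R X).shape i j hij]
      exact Submodule.zero_mem _

end SingularChain

section SmallSimplices

open CategoryTheory Filter Topology

lemma dist_average_le {E : Type*} [SeminormedAddCommGroup E] [NormedSpace ℝ E] {m : ℕ}
    (v : Fin (m + 1) → E) {D : ℝ} (hD : ∀ i j, dist (v i) (v j) ≤ D) (k : Fin (m + 1)) :
    dist (∑ i, (m + 1 : ℝ)⁻¹ • v i) (v k) ≤ m / (m + 1) * D := by
  have hm : (0 : ℝ) < m + 1 := by positivity
  have average_sub : ∑ i, (m + 1 : ℝ)⁻¹ • v i - v k =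
      (m + 1 : ℝ)⁻¹ • ∑ i ∈ Finset.univ.erase k, (v i - v k) := by
    rw [Finset.sum_erase Finset.univ (f := fun i => v i - v k) (sub_self (v k)),
      Finset.sum_sub_distrib, smul_sub, Finset.smul_sum,
      Finset.sum_const, Finset.card_univ, Fintype.card_fin, ← Nat.cast_smul_eq_nsmul ℝ, smul_smul,
      Nat.cast_succ, inv_mul_cancel₀ hm.ne', one_smul]
  rw [dist_eq_norm, average_sub, norm_smul, Real.norm_of_nonneg (inv_nonneg.2 hm.le)]
  calc (m + 1 : ℝ)⁻¹ * ‖∑ i ∈ Finset.univ.erase k, (v i - v k)‖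
      ≤ (m + 1 : ℝ)⁻¹ * ∑ _i ∈ Finset.univ.erase k, D := by
        gcongr
        exact norm_sum_le_of_le _ fun i _ => dist_eq_norm (v i) (v k) ▸ hD i k
    _ = m / (m + 1) * D := by
        rw [Finset.sum_const, Finset.card_erase_of_mem (Finset.mem_univ _), Finset.card_univ,
          Fintype.card_fin, Nat.add_sub_cancel, nsmul_eq_mul]
        ring

lemma dist_affineSimplex_le {l n : ℕ} (w : Fin (n + 1) → TopSimplex l) (t : TopSimplex n)
    (x : TopSimplex l) {r : ℝ} (hr : ∀ i, dist (w i) x ≤ r) : dist (affineSimplex w t) x ≤ r := by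
  have sum_mem := (convex_closedBall x.1 r).sum_mem (t := Finset.univ) (w := t)
    (z := fun i => (w i).1) (fun i _ => t.2.1 i) t.2.2 fun i _ => hr i
  convert Metric.mem_closedBall.1 sum_mem using 1
  rw [Subtype.dist_eq]
  congr 1
  ext j
  simp [affineSimplex]
  rfl

lemma dist_tupleBarycenter_le {l m : ℕ} (v : Fin (m + 1) → TopSimplex l) {D : ℝ}
    (hD : ∀ i j, dist (v i) (v j) ≤ D) (k : Fin (m + 1)) :
    dist (tupleBarycenter l m v) (v k) ≤ m / (m + 1) * D := by
  convert dist_average_le (fun i => (v i).1) hD k using 1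
  rw [Subtype.dist_eq]
  congr 1
  ext j
  change (affineSimplex v stdSimplex.barycenter : TopSimplex l) j = _
  have barycenter_apply (i : Fin (m + 1)) :
      (stdSimplex.barycenter : TopSimplex m) i = (m + 1 : ℝ)⁻¹ := by
    change ((Fintype.card (Fin (m + 1)) : ℕ) : ℝ)⁻¹ = _
    rw [Fintype.card_fin, Nat.cast_succ]
  simp only [affineSimplex_apply, barycenter_apply, Finset.sum_apply, Pi.smul_apply, smul_eq_mul]
  rfl

variable {R : Type v} [Ring R]

lemma dist_le_of_mem_support_subdivision {l m : ℕ} {v w : Fin m → TopSimplex l}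
    (hw : w ∈ (TupleChain.subdivision (tupleBarycenter l) (Finsupp.single v (1 : R))).support)
    {x : TopSimplex l} {r : ℝ} (hr : ∀ i, dist (v i) x ≤ r) (i : Fin m) : dist (w i) x ≤ r := by
  induction m with
  | zero => exact i.elim0
  | succ m ih =>
    obtain ⟨k, w', rfl, hw'⟩ := TupleChain.exists_cons_of_mem_support_subdivision v w hw
    refine Fin.cases ?_ (fun i => ?_) i
    · exact dist_affineSimplex_le v _ x hr
    · exact ih hw' (fun i => hr _) i

lemma dist_le_mul_of_mem_support_subdivision {l m : ℕ} {v w : Fin m → TopSimplex l}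
    (hw : w ∈ (TupleChain.subdivision (tupleBarycenter l) (Finsupp.single v (1 : R))).support)
    {D : ℝ} (hD : ∀ i j, dist (v i) (v j) ≤ D) (i j : Fin m) :
    dist (w i) (w j) ≤ (m - 1) / m * D := by
  induction m with
  | zero => exact i.elim0
  | succ m ih =>
    have hD0 : 0 ≤ D := dist_nonneg.trans (hD 0 0)
    obtain ⟨k, w', rfl, hw'⟩ := TupleChain.exists_cons_of_mem_support_subdivision v w hw
    rw [Nat.cast_succ, add_sub_cancel_right]
    have dist_apex (i) : dist (w' i) (tupleBarycenter l m v) ≤ m / (m + 1) * D :=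
      dist_le_of_mem_support_subdivision hw'
        (fun i => dist_comm (v _) _ ▸ dist_tupleBarycenter_le v hD _) i
    have dist_face (i j) : dist (w' i) (w' j) ≤ m / (m + 1) * D := by
      refine (ih hw' (fun i j => hD _ _) i j).trans ?_
      have hm : (0 : ℝ) < m := by exact_mod_cast i.pos
      gcongr ?_ * D
      rw [div_le_div_iff₀ hm (by positivity)]
      nlinarith
    refine Fin.cases (Fin.cases ?_ (fun j => ?_) j) (fun i => Fin.cases ?_ (fun j => ?_) j) i
    · rw [dist_self]
      positivity
    · exact dist_comm (w' j) (tupleBarycenter l m v) ▸ dist_apex j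
    · exact dist_apex i
    · exact dist_face i j

lemma dist_le_of_mem_support_iterate_subdivision {l m : ℕ} {v w : Fin (m + 1) → TopSimplex l}
    {D : ℝ} (hD : ∀ i j, dist (v i) (v j) ≤ D) {k : ℕ}
    (hw : w ∈ ((TupleChain.subdivision (tupleBarycenter l))^[k]
      (Finsupp.single v (1 : R))).support) (i j) :
    dist (w i) (w j) ≤ (m / (m + 1)) ^ k * D := by
  classical
  induction k generalizing w i j with
  | zero =>
    obtain rfl := Finset.mem_singleton.1 (Finsupp.support_single_subset hw)
    simpa using hD i j
  | succ k ih =>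
    rw [Function.iterate_succ_apply'] at hw
    generalize (TupleChain.subdivision (tupleBarycenter l))^[k] (Finsupp.single v (1 : R)) = y
      at ih hw
    rw [← Finsupp.sum_single y, map_finsuppSum] at hw
    obtain ⟨z, hz, hwz⟩ := Finset.mem_biUnion.1 (Finsupp.support_sum hw)
    rw [← mul_one (y z), ← smul_eq_mul, ← Finsupp.smul_single, map_smul] at hwz
    refine (dist_le_mul_of_mem_support_subdivision (Finsupp.support_smul hwz)
      (fun i j => ih hz i j) i j).trans_eq ?_
    push_cast
    ring

lemma dist_vertex_le_one {n : ℕ} (i j : Fin (n + 1)) :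
    dist (stdSimplex.vertex i : TopSimplex n) (stdSimplex.vertex j) ≤ 1 := by
  refine (dist_pi_le_iff zero_le_one).2 fun t => ?_
  rw [Real.dist_eq, abs_sub_le_iff]
  have nonneg (i : Fin (n + 1)) : 0 ≤ (stdSimplex.vertex i : TopSimplex n).1 t :=
    (stdSimplex.vertex i).2.1 t
  have le_one (i : Fin (n + 1)) : (stdSimplex.vertex i : TopSimplex n).1 t ≤ 1 :=
    stdSimplex.le_one (stdSimplex.vertex i) t
  constructor <;> linarith [nonneg i, nonneg j, le_one i, le_one j]

variable {X : Type u} [TopologicalSpace X]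

namespace SingularChain

lemma iterate_subdivision_single {n : ℕ} (σ : C(TopSimplex n, X)) (k : ℕ) :
    subdivision^[k] (Finsupp.single σ (1 : R)) =
      ofTuple σ ((TupleChain.subdivision (tupleBarycenter _))^[k]
        (Finsupp.single stdSimplex.vertex 1)) := by
  rw [← ofTuple_vertex]
  exact ((Function.Semiconj.iterate_right (fun x => (subdivision_ofTuple σ x).symm) k) _).symm

lemma eventually_iterate_subdivision_single_mem_sup {U V : Set X} (hU : IsOpen U) (hV : IsOpen V)
    (hUV : U ∪ V = Set.univ) {n : ℕ} (σ : C(TopSimplex n, X)) :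
    ∀ᶠ k in atTop, subdivision^[k] (Finsupp.single σ (1 : R)) ∈
      supportedIn R U n ⊔ supportedIn R V n := by
  obtain ⟨δ, hδ, small⟩ := lebesgue_number_lemma_of_metric (ι := Bool)
    (c := fun b => σ ⁻¹' (if b then U else V)) isCompact_univ
    (Bool.forall_bool.2 ⟨hV.preimage σ.continuous, hU.preimage σ.continuous⟩) fun t _ => by
      have mem_union : σ t ∈ U ∪ V := hUV ▸ Set.mem_univ _
      exact Set.mem_iUnion.2 (mem_union.elim (fun h => ⟨true, h⟩) fun h => ⟨false, h⟩)
  have mesh_lt : ∀ᶠ k : ℕ in atTop, ((n : ℝ) / (n + 1)) ^ k * 1 < δ := by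
    simp_rw [mul_one]
    refine (tendsto_pow_atTop_nhds_zero_of_lt_one (by positivity) ?_).eventually_lt_const hδ
    rw [div_lt_one (by positivity)]
    exact lt_add_one _
  filter_upwards [mesh_lt] with k hk
  rw [iterate_subdivision_single]
  generalize hx : (TupleChain.subdivision (tupleBarycenter n))^[k]
    (Finsupp.single stdSimplex.vertex (1 : R)) = x
  rw [← Finsupp.sum_single x, map_finsuppSum]
  refine Submodule.sum_mem _ fun w hw => ?_
  have mem_ball (t) : affineSimplex w t ∈ Metric.ball (w 0) δ :=
    (dist_affineSimplex_le w t (w 0) fun i => dist_le_of_mem_support_iterate_subdivision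
      dist_vertex_le_one (hx ▸ hw) i 0).trans_lt hk
  obtain ⟨b, hb⟩ := small (w 0) (Set.mem_univ _)
  simp only [ofTuple_single]
  cases b
  · exact Submodule.mem_sup_right
      (single_mem_supportedIn (σ := σ.comp (affineSimplex w)) (fun t => hb (mem_ball t)) _)
  · exact Submodule.mem_sup_left
      (single_mem_supportedIn (σ := σ.comp (affineSimplex w)) (fun t => hb (mem_ball t)) _)

lemma eventually_iterate_subdivision_mem_sup {U V : Set X} (hU : IsOpen U) (hV : IsOpen V)
    (hUV : U ∪ V = Set.univ) {n : ℕ} (x : SingularChain R X n) :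
    ∀ᶠ k in atTop, subdivision^[k] x ∈ supportedIn R U n ⊔ supportedIn R V n := by
  simp_rw [← Module.End.coe_pow (subdivision (R := R) (X := X) (n := n))]
  induction x using Finsupp.induction_linear with
  | zero => simp only [map_zero, Submodule.zero_mem, eventually_true]
  | add x y hx hy =>
    filter_upwards [hx, hy] with k hxk hyk
    rw [map_add]
    exact Submodule.add_mem _ hxk hyk
  | single σ c =>
    filter_upwards [eventually_iterate_subdivision_single_mem_sup (R := R) hU hV hUV σ] with k hk
    rw [← mul_one c, ← smul_eq_mul, ← Finsupp.smul_single, map_smul, Module.End.coe_pow]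
    exact Submodule.smul_mem _ _ hk

end SingularChain

lemma ModuleSubcomplex.isIso_homologyMap_incl_of_iterate_mem
    {K : ChainComplex (ModuleCat.{w} R) ℕ} (S : ModuleSubcomplex K) (φ : K ⟶ K)
    (map_mem : ∀ n, ∀ x ∈ S.submodule n, φ.f n x ∈ S.submodule n)
    (exists_homotopy : ∀ n x, (∀ j, K.d n j x ∈ S.submodule j) →
      ∃ y, x - φ.f n x - K.d (n + 1) n y ∈ S.submodule n)
    (exists_iterate_mem : ∀ n x, ∃ k : ℕ, (φ.f n)^[k] x ∈ S.submodule n) (n : ℕ) :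
    IsIso (HomologicalComplex.homologyMap S.incl n) := by
  refine S.isIso_homologyMap_incl (fun n x hx => ?_) n
  have exists_homotopy_iterate (k : ℕ) :
      ∃ y, x - (φ.f n)^[k] x - K.d (n + 1) n y ∈ S.submodule n := by
    induction k with
    | zero => exact ⟨0, by simp⟩
    | succ k ih =>
      obtain ⟨y, hy⟩ := ih
      have d_iterate (j) : K.d n j ((φ.f n)^[k] x) = (φ.f j)^[k] (K.d n j x) :=
        Function.Semiconj.iterate_right
          (fun z => ConcreteCategory.congr_hom (φ.comm n j) z) k x
      obtain ⟨z, hz⟩ := exists_homotopy n ((φ.f n)^[k] x) fun j => by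
        rw [d_iterate]
        exact Set.MapsTo.iterate (f := φ.f j) (s := S.submodule j) (map_mem j) k (hx j)
      refine ⟨y + z, ?_⟩
      convert Submodule.add_mem _ hy hz using 1
      rw [Function.iterate_succ_apply', map_add]
      abel
  obtain ⟨k, hk⟩ := exists_iterate_mem n x
  obtain ⟨y, hy⟩ := exists_homotopy_iterate k
  refine ⟨n + 1, y, ?_⟩
  convert Submodule.add_mem _ hy hk using 1
  abel

lemma exists_sub_subdivision_sub_d_mem {U V : Set X} {n : ℕ} (x : SingularChain R X n)
    (hx : ∀ j, (singularComplex R X).d n j x ∈ (chainsIn R U ⊔ chainsIn R V).submodule j) :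
    ∃ y, (show (singularComplex R X).X n from x) - (subdivisionHom R X).f n x -
      (singularComplex R X).d (n + 1) n y ∈ (chainsIn R U ⊔ chainsIn R V).submodule n := by
  refine ⟨SingularChain.subdivisionHomotopy x, ?_⟩
  rw [singularComplex_d]
  change x - SingularChain.subdivision x -
    SingularChain.boundary (SingularChain.subdivisionHomotopy x) ∈ _
  rcases n with _ | n
  · rw [SingularChain.boundary_subdivisionHomotopy_zero, sub_self]
    exact Submodule.zero_mem _
  · rw [SingularChain.boundary_subdivisionHomotopy_succ, sub_sub_cancel]
    have d_mem := hx n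
    rw [singularComplex_d] at d_mem
    exact SingularChain.naturalOperator_mem_supportedIn_sup _ d_mem

lemma isIso_homologyMap_incl_chainsIn_sup {U V : Set X} (hU : IsOpen U) (hV : IsOpen V)
    (hUV : U ∪ V = Set.univ) (n : ℕ) :
    IsIso (HomologicalComplex.homologyMap (chainsIn R U ⊔ chainsIn R V).incl n) :=
  ModuleSubcomplex.isIso_homologyMap_incl_of_iterate_mem _ (subdivisionHom R X)
    (fun _ _ => SingularChain.naturalOperator_mem_supportedIn_sup _)
    (fun _ => exists_sub_subdivision_sub_d_mem)
    (fun _ x => (SingularChain.eventually_iterate_subdivision_mem_sup hU hV hUV x).exists) n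

end SmallSimplices

section Comparison

open CategoryTheory Limits Simplicial

variable (R : Type v) [Ring R] {X : Type u} [TopologicalSpace X] {n : ℕ}

lemma stdSimplex_map_succAbove (i : Fin (n + 2)) (t : TopSimplex n) :
    stdSimplex.map i.succAbove t = affineSimplex (stdSimplex.vertex ∘ i.succAbove) t := by
  ext j
  rw [affineSimplex_apply, stdSimplex.map_coe, FunOnFinite.linearMap_apply_apply,
    Finset.sum_filter]
  exact Finset.sum_congr rfl fun k _ => by simp [Pi.single_apply, eq_comm]

/-- The simplices of the singular simplicial set as continuous maps. -/
noncomputable def simplexEquiv :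
    (TopCat.toSSet.obj (TopCat.of X)) _⦋n⦌ ≃ C(TopSimplex n, X) :=
  TopCat.toSSetObjEquiv (TopCat.of X) (Opposite.op ⦋n⦌)

lemma simplexEquiv_δ (i : Fin (n + 2)) (x : (TopCat.toSSet.obj (TopCat.of X)) _⦋n + 1⦌) :
    simplexEquiv ((TopCat.toSSet.obj (TopCat.of X)).δ i x) =
      (simplexEquiv x).comp (affineSimplex (stdSimplex.vertex ∘ i.succAbove)) := by
  ext t
  rw [ContinuousMap.comp_apply, ← stdSimplex_map_succAbove]
  rfl

/-- The coefficient ring as an object of the category used to define singular homology. -/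
abbrev coeffModule : ModuleCat.{max u v} R := ModuleCat.of R (ULift.{u} R)

variable {R} in
lemma coeffModule_hom_ext {M : ModuleCat.{max u v} R} {f g : coeffModule.{u} R ⟶ M}
    (h : f ⟨1⟩ = g ⟨1⟩) : f = g :=
  ModuleCat.hom_ext <| LinearMap.ext fun ⟨c⟩ => by
    have smul_one : (⟨c⟩ : ULift.{u} R) = c • ⟨1⟩ := ULift.ext _ _ (mul_one c).symm
    rw [smul_one, map_smul, map_smul]
    exact congrArg _ h

/-- The map out of a free module determined by maps out of the coefficient module. -/
noncomputable def finsuppDesc {R : Type v} [Ring R] {S : Type u} {M : ModuleCat.{max u v} R}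
    (φ : S → (coeffModule.{u} R ⟶ M)) : ModuleCat.of R (S →₀ R) ⟶ M :=
  ModuleCat.ofHom <| Finsupp.lsum ℕ fun s => (φ s).hom ∘ₗ ULift.moduleEquiv.symm.toLinearMap

lemma finsuppDesc_single {R : Type v} [Ring R] {S : Type u} {M : ModuleCat.{max u v} R}
    (φ : S → (coeffModule.{u} R ⟶ M)) (s : S) (c : R) :
    finsuppDesc φ (Finsupp.single s c) = φ s ⟨c⟩ :=
  Finsupp.lsum_single ..

variable (X) in
/-- The chain complex whose homology is Mathlib's singular homology. -/
noncomputable abbrev categoricalSingularComplex : ChainComplex (ModuleCat.{max u v} R) ℕ :=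
  (TopCat.toSSet.obj (TopCat.of X)).chainComplex (coeffModule.{u} R)

/-- The inclusion of the summand of a singular simplex. -/
noncomputable abbrev ιSimplex (x : (TopCat.toSSet.obj (TopCat.of X)) _⦋n⦌) :
    coeffModule.{u} R ⟶ (categoricalSingularComplex R X).X n :=
  (TopCat.toSSet.obj (TopCat.of X)).ιChainComplex x

/-- The comparison map from categorical to concrete singular chains. -/
noncomputable def comparisonHom :
    (categoricalSingularComplex R X).X n ⟶ (singularComplex R X).X n :=
  Sigma.desc fun x => ModuleCat.ofHom
    (Finsupp.lsingle (simplexEquiv x) ∘ₗ ULift.moduleEquiv.toLinearMap)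

/-- The comparison map from concrete to categorical singular chains. -/
noncomputable def comparisonInv :
    (singularComplex R X).X n ⟶ (categoricalSingularComplex R X).X n :=
  finsuppDesc fun σ => ιSimplex R (simplexEquiv.symm σ)

lemma comparisonHom_ιSimplex (x : (TopCat.toSSet.obj (TopCat.of X)) _⦋n⦌) (c : R) :
    comparisonHom R (ιSimplex R x ⟨c⟩) = Finsupp.single (simplexEquiv x) c := by
  have ι_desc : ιSimplex R x ≫ comparisonHom R = ModuleCat.ofHom
    (Finsupp.lsingle (simplexEquiv x) ∘ₗ ULift.moduleEquiv.toLinearMap) := Sigma.ι_desc _ _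
  exact ConcreteCategory.congr_hom ι_desc (ULift.up c)

lemma comparisonInv_single (σ : C(TopSimplex n, X)) (c : R) :
    comparisonInv R (Finsupp.single σ c) = ιSimplex R (simplexEquiv.symm σ) ⟨c⟩ :=
  finsuppDesc_single ..

variable (X n) in
/-- The degree `n` part of the comparison isomorphism. -/
noncomputable def comparisonIso :
    (categoricalSingularComplex R X).X n ≅ (singularComplex R X).X n where
  hom := comparisonHom R
  inv := comparisonInv R
  hom_inv_id := SSet.chainComplex_hom_ext fun x => coeffModule_hom_ext <| by
    change comparisonInv R (comparisonHom R (ιSimplex R x ⟨1⟩)) = ιSimplex R x ⟨1⟩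
    rw [comparisonHom_ιSimplex, comparisonInv_single, Equiv.symm_apply_apply]
  inv_hom_id := ModuleCat.hom_ext <| Finsupp.lhom_ext' fun σ => LinearMap.ext_ring <| by
    change comparisonHom R (comparisonInv R (Finsupp.single σ 1)) = Finsupp.single σ 1
    rw [comparisonInv_single, comparisonHom_ιSimplex, Equiv.apply_symm_apply]

lemma d_ιSimplex (x : (TopCat.toSSet.obj (TopCat.of X)) _⦋n + 1⦌) (c : ULift.{u} R) :
    (categoricalSingularComplex R X).d (n + 1) n (ιSimplex R x c) =
      ∑ i : Fin (n + 2), (-1 : ℤ) ^ (i : ℕ) •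
        ιSimplex R ((TopCat.toSSet.obj (TopCat.of X)).δ i x) c := by
  refine (ConcreteCategory.congr_hom (SSet.ιChainComplex_d _ (coeffModule.{u} R) x) c).trans ?_
  simp only [ModuleCat.hom_sum, ModuleCat.hom_zsmul, LinearMap.sum_apply, LinearMap.smul_apply]

variable (X) in
/-- The concrete singular chain complex is isomorphic to the categorical one. -/
noncomputable def singularComplexIso : categoricalSingularComplex R X ≅ singularComplex R X :=
  HomologicalComplex.Hom.isoOfComponents (comparisonIso R X) <| by
    rintro _ n rfl
    have sign_smul (k : ℕ) (y : SingularChain R X n) : (-1 : R) ^ k • y = (-1 : ℤ) ^ k • y := by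
      rw [← Int.cast_smul_eq_zsmul R, Int.cast_pow, Int.cast_neg, Int.cast_one]
    refine SSet.chainComplex_hom_ext fun x => coeffModule_hom_ext ?_
    change (singularComplex R X).d (n + 1) n (comparisonHom R (ιSimplex R x ⟨1⟩)) =
      comparisonHom R ((categoricalSingularComplex R X).d (n + 1) n (ιSimplex R x ⟨1⟩))
    rw [comparisonHom_ιSimplex, singularComplex_d, d_ιSimplex, map_sum]
    refine (SingularChain.boundary_single _).trans (Finset.sum_congr rfl fun i _ => ?_)
    rw [map_zsmul, comparisonHom_ιSimplex, simplexEquiv_δ]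
    exact sign_smul i _

lemma nonempty_singularHomology_equiv (F : Type v) [Field F] (n : ℕ) :
    Nonempty (singularHomologyOver.{u, v} F n X ≃ₗ[F] (singularComplex F X).homology n) :=
  ⟨((HomologicalComplex.homologyFunctor _ _ n).mapIso (singularComplexIso F X)).toLinearEquiv⟩

end Comparison

section SpaceHomology

open CategoryTheory Limits AlgebraicTopology HomologicalComplex

variable {X Y Z : Type u} [TopologicalSpace X] [TopologicalSpace Y] [TopologicalSpace Z]

namespace SingularChain

variable {R : Type v} [Ring R] {n : ℕ}

/-- The map of singular chains induced by a continuous map. -/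
noncomputable def map (f : C(X, Y)) : SingularChain R X n →ₗ[R] SingularChain R Y n :=
  Finsupp.lmapDomain R R f.comp

lemma map_single (f : C(X, Y)) (σ : C(TopSimplex n, X)) (c : R) :
    map f (Finsupp.single σ c) = Finsupp.single (f.comp σ) c :=
  Finsupp.mapDomain_single

lemma boundary_map (f : C(X, Y)) (x : SingularChain R X (n + 1)) :
    boundary (map f x) = map f (boundary x) := by
  refine LinearMap.congr_fun (f := boundary ∘ₗ map f) (g := map f ∘ₗ boundary)
    (hom_ext fun σ => ?_) x
  simp only [LinearMap.comp_apply, ofTuple_vertex, map_single, boundary_single, _root_.map_sum,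
    map_smul, ContinuousMap.comp_assoc]

lemma map_injective {f : C(X, Y)} (hf : Function.Injective f) :
    Function.Injective (map f : SingularChain R X n →ₗ[R] SingularChain R Y n) :=
  Finsupp.mapDomain_injective fun _ _ h =>
    ContinuousMap.ext fun t => hf (DFunLike.congr_fun h t)

lemma map_surjective {f : C(X, Y)} (hf : ∀ τ : C(TopSimplex n, Y), ∃ σ, f.comp σ = τ) :
    Function.Surjective (map f : SingularChain R X n →ₗ[R] SingularChain R Y n) :=
  Finsupp.mapDomain_surjective hf

lemma range_map {f : C(X, Y)} (hf : Topology.IsEmbedding f) :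
    LinearMap.range (map f : SingularChain R X n →ₗ[R] _) = supportedIn R (Set.range f) n := by
  have range_comp : Set.range (f.comp : C(TopSimplex n, X) → C(TopSimplex n, Y)) =
      {τ | ∀ t, τ t ∈ Set.range f} := by
    refine Set.Subset.antisymm ?_ fun τ hτ => ?_
    · rintro _ ⟨σ, rfl⟩ t
      exact ⟨σ t, rfl⟩
    · choose σ hσ using hτ
      have hσ' : f ∘ σ = τ := funext hσ
      exact ⟨⟨σ, hf.continuous_iff.2 (hσ' ▸ τ.continuous)⟩, ContinuousMap.ext hσ⟩
  rw [supportedIn, map, Finsupp.range_lmapDomain, Finsupp.supported_eq_span_single, ← range_comp,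
    ← Set.range_comp]
  rfl

end SingularChain

section Ring

variable (R : Type v) [Ring R]

/-- The chain map induced by a continuous map. -/
noncomputable def singularComplexMap (f : C(X, Y)) : singularComplex R X ⟶ singularComplex R Y :=
  ChainComplex.ofHom (fun _ => ModuleCat.ofHom (SingularChain.map f)) fun n => by
    rw [singularComplex_d, singularComplex_d]
    exact ModuleCat.hom_ext (LinearMap.ext (SingularChain.boundary_map f))

lemma range_singularComplexMap {f : C(X, Y)} (hf : Topology.IsEmbedding f) :
    ModuleSubcomplex.range (singularComplexMap R f) = chainsIn R (Set.range f) :=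
  ModuleSubcomplex.ext (funext fun _ => SingularChain.range_map hf)

lemma chainsIn_inf (U V : Set X) : chainsIn R U ⊓ chainsIn R V = chainsIn R (U ∩ V) := by
  refine ModuleSubcomplex.ext (funext fun n => (Finsupp.supported_inter _ _).symm.trans ?_)
  exact congrArg (Finsupp.supported R R) (Set.ext fun σ => forall_and.symm)

end Ring

section Field

variable {F : Type v} [Field F]

lemma nonempty_homology_chainsIn_equiv (U : Set X) (n : ℕ) :
    Nonempty ((chainsIn F U).toComplex.homology n ≃ₗ[F] singularHomologyOver.{u, v} F n U) := by
  let φ := singularComplexMap F (⟨Subtype.val, continuous_subtype_val⟩ : C(U, X))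
  have hφ (n) : Function.Injective (φ.f n) := SingularChain.map_injective Subtype.val_injective
  have range_φ : ModuleSubcomplex.range φ = chainsIn F U :=
    (range_singularComplexMap F Topology.IsEmbedding.subtypeVal).trans
      (congrArg (chainsIn F) Subtype.range_val)
  have e := ((HomologicalComplex.homologyFunctor _ _ n).mapIso (ModuleSubcomplex.isoRange φ (𝟙 _)
    (fun _ => Function.surjective_id) fun n x =>
      (map_eq_zero_iff (φ.f n).hom (hφ n)).symm)).toLinearEquiv
  rw [range_φ] at e
  exact ⟨e.symm.trans (nonempty_singularHomology_equiv F n).some.symm⟩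

lemma nonempty_homology_chainsIn_sup_equiv {U V : Set X} (hU : IsOpen U) (hV : IsOpen V)
    (hUV : U ∪ V = Set.univ) (n : ℕ) :
    Nonempty ((chainsIn F U ⊔ chainsIn F V).toComplex.homology n ≃ₗ[F]
      singularHomologyOver.{u, v} F n X) := by
  have := isIso_homologyMap_incl_chainsIn_sup (R := F) hU hV hUV n
  exact ⟨(asIso (homologyMap (chainsIn F U ⊔ chainsIn F V).incl n)).toLinearEquiv.trans
    (nonempty_singularHomology_equiv F n).some.symm⟩

/-- The singular homology of `X` is finite-dimensional, vanishes in degrees `≥ N`, and has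
alternating sum of dimensions `c`. -/
def HasSingularEulerChar (F : Type v) [Field F] (X : Type u) [TopologicalSpace X] (N : ℕ)
    (c : ℤ) : Prop :=
  HasEulerChar F (fun n => singularHomologyOver.{u, v} F n X) N c

lemma HasSingularEulerChar.of_union {U V : Set X} (hU : IsOpen U) (hV : IsOpen V)
    (hUV : U ∪ V = Set.univ) {N : ℕ} {a b c : ℤ} (ha : HasSingularEulerChar F U (N + 1) a)
    (hb : HasSingularEulerChar F V (N + 1) b) (hc : HasSingularEulerChar F ↥(U ∩ V) N c) :
    HasSingularEulerChar F X (N + 1) (a + b - c) := by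
  have e (U : Set X) (n : ℕ) := (nonempty_homology_chainsIn_equiv (F := F) U n).map (·.symm)
  have hc := hc.congr (e (U ∩ V))
  rw [← chainsIn_inf] at hc
  exact (ModuleSubcomplex.hasEulerChar_sup (ha.congr (e U)) (hb.congr (e V)) hc).congr
    (nonempty_homology_chainsIn_sup_equiv hU hV hUV)

lemma exists_injective_homology_of_union {U V : Set X} (hU : IsOpen U) (hV : IsOpen V)
    (hUV : U ∪ V = Set.univ) (n : ℕ) [Subsingleton (singularHomologyOver.{u, v} F n ↥(U ∩ V))] :
    ∃ φ : (singularHomologyOver.{u, v} F n U × singularHomologyOver.{u, v} F n V) →ₗ[F]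
      singularHomologyOver.{u, v} F n X, Function.Injective φ := by
  have e (U : Set X) := (nonempty_homology_chainsIn_equiv (F := F) U n).some
  have e_sup := (nonempty_homology_chainsIn_sup_equiv (F := F) hU hV hUV n).some
  have : Subsingleton ((chainsIn F U ⊓ chainsIn F V).toComplex.homology n) := by
    rw [chainsIn_inf]
    exact (e (U ∩ V)).toEquiv.subsingleton
  obtain ⟨φ, hφ⟩ := ModuleSubcomplex.exists_injective_homology_sup (S := chainsIn F U)
    (T := chainsIn F V) n
  exact ⟨e_sup.toLinearMap ∘ₗ φ ∘ₗ ((e U).symm.prodCongr (e V).symm).toLinearMap,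
    e_sup.injective.comp (hφ.comp ((e U).symm.prodCongr (e V).symm).injective)⟩

lemma finite_and_bettiNumber_add_le {U V : Set X} (hU : IsOpen U) (hV : IsOpen V)
    (hUV : U ∪ V = Set.univ) (n : ℕ) [Subsingleton (singularHomologyOver.{u, v} F n ↥(U ∩ V))]
    [Module.Finite F (singularHomologyOver.{u, v} F n X)] :
    Module.Finite F (singularHomologyOver.{u, v} F n U) ∧
      bettiNumber.{u, v} F n U + bettiNumber.{u, v} F n V ≤ bettiNumber.{u, v} F n X := by
  obtain ⟨φ, hφ⟩ := exists_injective_homology_of_union (F := F) hU hV hUV n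
  have finite_U := Module.Finite.of_injective (φ ∘ₗ LinearMap.inl F _ _)
    (hφ.comp LinearMap.inl_injective)
  have finite_V := Module.Finite.of_injective (φ ∘ₗ LinearMap.inr F _ _)
    (hφ.comp LinearMap.inr_injective)
  refine ⟨finite_U, ?_⟩
  rw [bettiNumber, bettiNumber, ← Module.finrank_prod]
  exact LinearMap.finrank_le_finrank_of_injective hφ

lemma nonempty_obj_iso_of_homotopyEquiv {C : Type*} [Category C] (Φ : TopCat.{u} ⥤ C)
    (map_eq : ∀ {Z W : TopCat.{u}} {f g : Z ⟶ W}, f.hom.Homotopic g.hom → Φ.map f = Φ.map g)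
    (e : ContinuousMap.HomotopyEquiv X Y) :
    Nonempty (Φ.obj (TopCat.of X) ≅ Φ.obj (TopCat.of Y)) := by
  refine ⟨⟨Φ.map (TopCat.ofHom e.toFun), Φ.map (TopCat.ofHom e.invFun), ?_, ?_⟩⟩
  · rw [← Φ.map_comp, ← Φ.map_id]
    exact map_eq e.left_inv
  · rw [← Φ.map_comp, ← Φ.map_id]
    exact map_eq e.right_inv

lemma nonempty_homology_equiv_of_homotopyEquiv (e : ContinuousMap.HomotopyEquiv X Y) (n : ℕ) :
    Nonempty (singularHomologyOver.{u, v} F n X ≃ₗ[F] singularHomologyOver.{u, v} F n Y) :=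
  ⟨(nonempty_obj_iso_of_homotopyEquiv _ (fun h =>
    TopCat.Homotopy.congr_homologyMap_singularChainComplexFunctor h.some _ n) e).some.toLinearEquiv⟩

lemma HasSingularEulerChar.of_homotopyEquiv (e : ContinuousMap.HomotopyEquiv X Y) {N : ℕ} {c : ℤ}
    (h : HasSingularEulerChar F X N c) : HasSingularEulerChar F Y N c :=
  HasEulerChar.congr h (nonempty_homology_equiv_of_homotopyEquiv e)

variable (F) in
lemma bettiNumber_eq_of_homotopyEquiv (e : ContinuousMap.HomotopyEquiv X Y) (n : ℕ) :
    bettiNumber.{u, v} F n X = bettiNumber.{u, v} F n Y :=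
  (nonempty_homology_equiv_of_homotopyEquiv e n).some.finrank_eq

lemma nonempty_homology_zero_equiv [PathConnectedSpace X] :
    Nonempty (singularHomologyOver.{u, v} F 0 X ≃ₗ[F] F) := by
  have : PathConnectedSpace (TopCat.of X) := ‹_›
  let ε := (TopCat.of X).singularHomology₀ε (ModuleCat.of F (ULift.{u} F))
  exact ⟨(asIso ε).toLinearEquiv.trans ULift.moduleEquiv⟩

lemma subsingleton_homology_of_isEmpty [IsEmpty X] (n : ℕ) :
    Subsingleton (singularHomologyOver.{u, v} F n X) := by
  have : IsEmpty C(TopSimplex n, X) := ⟨fun σ => isEmptyElim (σ (stdSimplex.vertex 0))⟩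
  have : Subsingleton ((singularComplex F X).X n) :=
    inferInstanceAs (Subsingleton (SingularChain F X n))
  have : Subsingleton ((singularComplex F X).homology n) := ModuleCat.subsingleton_of_isZero
    (ShortComplex.isZero_homology_of_isZero_X₂ ((singularComplex F X).sc n)
      (ModuleCat.isZero_of_subsingleton ((singularComplex F X).X n)))
  exact (nonempty_singularHomology_equiv F n).some.toEquiv.subsingleton

lemma hasSingularEulerChar_of_isEmpty [IsEmpty X] (N : ℕ) : HasSingularEulerChar F X N 0 := by
  have subsingleton (n : ℕ) := subsingleton_homology_of_isEmpty (F := F) (X := X) n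
  exact ⟨fun n => inferInstance, fun n _ => subsingleton n, Finset.sum_eq_zero fun n _ => by
    rw [Module.finrank_zero_of_subsingleton, Nat.cast_zero, mul_zero]⟩

lemma subsingleton_homology_of_totallyDisconnectedSpace [TotallyDisconnectedSpace X] {n : ℕ}
    (hn : n ≠ 0) : Subsingleton (singularHomologyOver.{u, v} F n X) := by
  have : TotallyDisconnectedSpace (TopCat.of X) := ‹_›
  exact ModuleCat.subsingleton_of_isZero
    (isZero_singularHomologyFunctor_of_totallyDisconnectedSpace _ _ _ (TopCat.of X) hn)

lemma hasSingularEulerChar_of_contractible [ContractibleSpace X] :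
    HasSingularEulerChar F X 1 1 := by
  have e_point (n) := (nonempty_homology_equiv_of_homotopyEquiv (F := F)
    (ContractibleSpace.hequiv X PUnit.{u + 1}).some n).some
  have e_zero := (nonempty_homology_zero_equiv (F := F) (X := X)).some
  have subsingleton_succ (n : ℕ) : Subsingleton (singularHomologyOver.{u, v} F (n + 1) X) :=
    have := subsingleton_homology_of_totallyDisconnectedSpace (F := F) (X := PUnit.{u + 1})
      n.succ_ne_zero
    (e_point _).toEquiv.subsingleton
  refine ⟨?_, ?_, by simp [e_zero.finrank_eq]⟩
  · rintro (_ | n)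
    · exact Module.Finite.equiv e_zero.symm
    · infer_instance
  · rintro (_ | n) hn
    · omega
    · infer_instance

end Field

end SpaceHomology

section PermutationModule

variable {R : Type*} {G α β : Type*} [Group G] [MulAction G α]

variable (R G α) in
/-- The permutation representation of `G` on the finitely supported functions on a `G`-set. -/
noncomputable def permutationRepresentation [CommRing R] : Representation R G (α →₀ R) where
  toFun g := Finsupp.lmapDomain R R (g • ·)
  map_one' := by
    ext a : 2
    simp
  map_mul' g h := by
    ext a : 2
    simp [mul_smul]

variable [CommRing R]

lemma permutationRepresentation_smul_apply (g : G) (x : α →₀ R) (a : α) :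
    permutationRepresentation R G α g x (g • a) = x a :=
  Finsupp.mapDomain_apply (MulAction.injective g) x a

variable [Fintype G] {π : α → β}

lemma norm_permutationRepresentation_apply [IsCancelSMul G α]
    (hπ : ∀ a b, π a = π b ↔ a ∈ MulAction.orbit G b) (x : α →₀ R) (a : α) :
    (permutationRepresentation R G α).norm x a = Finsupp.mapDomain π x (π a) := by
  classical
  induction x using Finsupp.induction_linear with
  | zero => simp only [map_zero, Finsupp.mapDomain_zero, Finsupp.zero_apply]
  | add x y hx hy => rw [map_add, Finsupp.mapDomain_add, Finsupp.add_apply, hx, hy,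
      Finsupp.add_apply]
  | single b c =>
    have norm_single : (permutationRepresentation R G α).norm (Finsupp.single b c) a =
        ∑ g : G, if g • b = a then c else 0 := by
      simp only [Representation.norm, LinearMap.sum_apply, Finsupp.finsetSum_apply]
      exact Finset.sum_congr rfl fun g _ => by
        rw [← Finsupp.single_apply]
        exact DFunLike.congr_fun (Finsupp.mapDomain_single (f := (g • ·)) (a := b)) a
    rw [norm_single, Finsupp.mapDomain_single, Finsupp.single_apply]
    split_ifs with hab
    · obtain ⟨g, rfl⟩ := (hπ a b).1 hab.symm
      have smul_eq_iff (h : G) : h • b = g • b ↔ h = g :=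
        ⟨IsCancelSMul.right_cancel _ _ _, congrArg (· • b)⟩
      simp only [smul_eq_iff, Finset.sum_ite_eq', Finset.mem_univ, if_true]
    · exact Finset.sum_eq_zero fun g _ => if_neg fun h => hab ((hπ a b).2 ⟨g, h⟩).symm

lemma norm_permutationRepresentation_eq_zero_iff [IsCancelSMul G α] (hπ : Function.Surjective π)
    (hπ' : ∀ a b, π a = π b ↔ a ∈ MulAction.orbit G b) (x : α →₀ R) :
    (permutationRepresentation R G α).norm x = 0 ↔ Finsupp.mapDomain π x = 0 := by
  simp only [Finsupp.ext_iff, norm_permutationRepresentation_apply hπ', hπ.forall,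
    Finsupp.zero_apply]

lemma exists_norm_permutationRepresentation_eq [IsCancelSMul G α] {x : α →₀ R}
    (hx : ∀ g, permutationRepresentation R G α g x = x) :
    ∃ y, (permutationRepresentation R G α).norm y = x := by
  let s : MulAction.orbitRel.Quotient G α → α := Quotient.out
  have mk_s (b) : (Quotient.mk'' (s b) : MulAction.orbitRel.Quotient G α) = b := Quotient.out_eq' b
  have s_injective : Function.Injective s := Function.LeftInverse.injective mk_s
  refine ⟨Finsupp.mapDomain s (Finsupp.comapDomain s x s_injective.injOn), Finsupp.ext fun a => ?_⟩
  rw [norm_permutationRepresentation_apply (π := Quotient.mk'')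
    (fun _ _ => Quotient.eq''.trans MulAction.orbitRel_apply), ← Finsupp.mapDomain_comp]
  obtain ⟨g, hg⟩ : s (Quotient.mk'' a) ∈ MulAction.orbit G a :=
    MulAction.orbitRel_apply.1 (Quotient.eq''.1 (mk_s _))
  rw [(funext mk_s : Quotient.mk'' ∘ s = id), Finsupp.mapDomain_id, Finsupp.comapDomain_apply, ← hg]
  nth_rw 1 [← hx g]
  exact permutationRepresentation_smul_apply g x a

lemma permutationRepresentation_apply_eq_iff [IsCancelSMul G α] {t : G}
    (ht : ∀ g, g ∈ Subgroup.zpowers t) (x : α →₀ R) :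
    permutationRepresentation R G α t x = x ↔
      ∃ y, (permutationRepresentation R G α).norm y = x := by
  refine ⟨fun hx => exists_norm_permutationRepresentation_eq fun g => ?_, ?_⟩
  · obtain ⟨k, rfl⟩ := mem_powers_iff_mem_zpowers.2 (ht g)
    change permutationRepresentation R G α (t ^ k) x = x
    rw [map_pow, Module.End.pow_apply]
    exact Function.IsFixedPt.iterate hx k
  · rintro ⟨y, rfl⟩
    exact Representation.self_norm_apply _ t y

end PermutationModule

section CharP

variable {F : Type*} [Field F] {p : ℕ} [Fact p.Prime] [CharP F p]

variable (F p) in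
lemma geom_sum_eq_sub_one_pow {A : Type*} [Ring A] [Algebra F A] (t : A) :
    ∑ i ∈ Finset.range p, t ^ i = (t - 1) ^ (p - 1) := by
  have : ∑ i ∈ Finset.range p, (Polynomial.X : Polynomial F) ^ i =
      (Polynomial.X - 1) ^ (p - 1) := by
    apply mul_right_cancel₀ (Polynomial.X_sub_C_ne_zero (1 : F))
    rw [map_one, geom_sum_mul, ← pow_succ, Nat.sub_add_cancel (Fact.out : p.Prime).one_le,
      sub_pow_char, one_pow]
  simpa using congrArg (Polynomial.aeval t) this

lemma norm_eq_sub_one_pow {G V : Type*} [Group G] [Fintype G] [AddCommGroup V] [Module F V]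
    (ρ : Representation F G V) {t : G} (ht : ∀ g, g ∈ Subgroup.zpowers t) (htp : orderOf t = p) :
    ρ.norm = (ρ t - 1) ^ (p - 1) := by
  classical
  rw [← geom_sum_eq_sub_one_pow F p (ρ t), Representation.norm, ← IsCyclic.image_range_orderOf ht,
    htp, Finset.sum_image fun i hi j hj hij => pow_injOn_Iio_orderOf
      (by simpa [htp] using hi) (by simpa [htp] using hj) hij]
  exact Finset.sum_congr rfl fun i _ => map_pow ρ t i

lemma sub_one_pow_char_eq_zero {G V : Type*} [Group G] [AddCommGroup V] [Module F V]
    (ρ : Representation F G V) {t : G} (htp : orderOf t = p) : (ρ t - 1) ^ p = 0 := by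
  have frobenius : (Polynomial.X - 1 : Polynomial F) ^ p = Polynomial.X ^ p - 1 := by
    rw [sub_pow_char, one_pow]
  have ρ_pow : ρ t ^ p = 1 := by rw [← map_pow, ← htp, pow_orderOf_eq_one, map_one]
  simpa [ρ_pow] using congrArg (Polynomial.aeval (ρ t)) frobenius

end CharP

section CyclicCovering

open CategoryTheory

variable {E B : Type u} [TopologicalSpace E] [TopologicalSpace B] {G : Type w} [Group G]
  [MulAction G E] {q : E → B}

section Lift

variable {A : Type*} [TopologicalSpace A]

lemma exists_continuousMap_lift (hq : IsCoveringMap q) (q_surjective : Function.Surjective q)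
    [SimplyConnectedSpace A] [LocallyPathConnectedSpace A] (f : C(A, B)) :
    ∃ g : C(A, E), q ∘ g = f := by
  have a : A := Classical.arbitrary A
  obtain ⟨e, he⟩ := q_surjective (f a)
  obtain ⟨g, ⟨-, hg⟩, -⟩ := hq.existsUnique_continuousMap_lifts f a e he
  exact ⟨g, hg⟩

lemma comp_eq_comp_iff_mem_orbit [ContinuousConstSMul G E] (hq : IsQuotientCoveringMap q G)
    [ConnectedSpace A] (f f' : C(A, E)) : q ∘ f = q ∘ f' ↔ f ∈ MulAction.orbit G f' := by
  constructor
  · intro h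
    have a : A := Classical.arbitrary A
    obtain ⟨g, hg⟩ := hq.apply_eq_iff_mem_orbit.1 (congrFun h a)
    refine ⟨g, DFunLike.coe_injective ?_⟩
    refine hq.isCoveringMap.eq_of_comp_eq (g • f').continuous f.continuous ?_ a hg
    rw [h]
    exact funext fun x => hq.map_smul g
  · rintro ⟨g, rfl⟩
    exact funext fun x => hq.map_smul g

end Lift

instance (n : ℕ) : ContractibleSpace (TopSimplex n) :=
  (convex_stdSimplex ℝ _).contractibleSpace ⟨_, (stdSimplex.vertex 0).2⟩

instance (n : ℕ) : LocallyPathConnectedSpace (TopSimplex n) :=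
  (convex_stdSimplex ℝ _).locallyPathConnectedSpace

lemma isCancelSMul_continuousMap [ContinuousConstSMul G E] [IsCancelSMul G E] {A : Type*}
    [TopologicalSpace A] [Nonempty A] : IsCancelSMul G C(A, E) where
  right_cancel' _ _ f h := IsCancelSMul.right_cancel _ _ (f (Classical.arbitrary A))
    (DFunLike.congr_fun h _)

variable [ContinuousConstSMul G E]

variable (E G) in
/-- The sum of the translations by the elements of `G`, as an endomorphism of the singular chains.
For a covering with group `G` its image is a copy of the singular chains of the base. -/
noncomputable def normComplexMap (R : Type v) [CommRing R] [Fintype G] :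
    singularComplex R E ⟶ singularComplex R E :=
  ∑ g : G, singularComplexMap R (g • ContinuousMap.id E)

lemma normComplexMap_f_apply {R : Type v} [CommRing R] [Fintype G] (n : ℕ)
    (x : SingularChain R E n) :
    (normComplexMap E G R).f n x = (permutationRepresentation R G C(TopSimplex n, E)).norm x := by
  have f_sum := (HomologicalComplex.eval _ _ n).map_sum
    (fun g : G => singularComplexMap R (g • ContinuousMap.id E)) Finset.univ
  refine (congrArg (fun φ => φ.hom x) f_sum).trans ?_
  rw [ModuleCat.hom_sum]
  exact (LinearMap.sum_apply _ _ _).trans (LinearMap.sum_apply _ _ x).symm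

lemma ker_singularComplexMap_smul_sub_id {R : Type v} [CommRing R] [Fintype G] [IsCancelSMul G E]
    {t : G} (ht : ∀ g, g ∈ Subgroup.zpowers t) :
    ModuleSubcomplex.ker (singularComplexMap R (t • ContinuousMap.id E) - 𝟙 _) =
      ModuleSubcomplex.range (normComplexMap E G R) := by
  refine ModuleSubcomplex.ext (funext fun n => Submodule.ext fun x => ?_)
  have := isCancelSMul_continuousMap (G := G) (E := E) (A := TopSimplex n)
  exact (sub_eq_zero.trans (permutationRepresentation_apply_eq_iff ht x)).trans
    (exists_congr fun y => Eq.congr_left (normComplexMap_f_apply n y).symm)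

lemma nonempty_homology_equiv_homology_range_normComplexMap [Fintype G] (F : Type v) [Field F]
    (hq : IsQuotientCoveringMap q G) (n : ℕ) :
    Nonempty (singularHomologyOver.{u, v} F n B ≃ₗ[F]
      (ModuleSubcomplex.range (normComplexMap E G F)).toComplex.homology n) := by
  have := hq.isCancelSMul
  let q' : C(E, B) := ⟨q, hq.continuous⟩
  have exists_lift (k) (σ : C(TopSimplex k, B)) : ∃ τ : C(_, E), q'.comp τ = σ := by
    obtain ⟨τ, hτ⟩ := exists_continuousMap_lift hq.isCoveringMap hq.surjective σ
    exact ⟨τ, DFunLike.coe_injective hτ⟩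
  have map_eq_zero_iff (k) (x : SingularChain F E k) :
      SingularChain.map q' x = 0 ↔ (normComplexMap E G F).f k x = 0 := by
    have := isCancelSMul_continuousMap (G := G) (E := E) (A := TopSimplex k)
    refine (norm_permutationRepresentation_eq_zero_iff (exists_lift k) (fun σ τ => ?_) x).symm.trans
      (Eq.congr_left (normComplexMap_f_apply k x).symm)
    rw [← comp_eq_comp_iff_mem_orbit hq, ← DFunLike.coe_injective.eq_iff]
    rfl
  obtain ⟨e⟩ := nonempty_singularHomology_equiv (X := B) F n
  exact ⟨e ≪≫ₗ ((HomologicalComplex.homologyFunctor _ _ n).mapIso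
    (ModuleSubcomplex.isoRange (normComplexMap E G F) (singularComplexMap F q')
      (fun k => SingularChain.map_surjective (exists_lift k)) map_eq_zero_iff)).toLinearEquiv⟩

omit [ContinuousConstSMul G E] in
theorem bettiNumber_le_of_card_eq_prime (F : Type v) [Field F] (hq : IsQuotientCoveringMap q G)
    (p : ℕ) [Fact p.Prime] [CharP F p] (hG : Nat.card G = p) (n : ℕ)
    [Module.Finite F (singularHomologyOver.{u, v} F n B)] :
    Module.Finite F (singularHomologyOver.{u, v} F n E) ∧
      bettiNumber.{u, v} F n E ≤ p * bettiNumber.{u, v} F n B := by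
  have p_prime : p.Prime := Fact.out
  have := hq.toContinuousConstSMul
  have := hq.isCancelSMul
  have : Finite G := Nat.finite_of_card_ne_zero (hG ▸ p_prime.ne_zero)
  have : Fintype G := Fintype.ofFinite G
  have : IsCyclic G := isCyclic_of_prime_card hG
  obtain ⟨t, ht⟩ := IsCyclic.exists_generator (α := G)
  have orderOf_t : orderOf t = p := hG ▸ orderOf_eq_card_of_forall_mem_zpowers ht
  let ρ (k : ℕ) := permutationRepresentation F G C(TopSimplex k, E)
  let T : singularComplex F E ⟶ singularComplex F E :=
    singularComplexMap F (t • ContinuousMap.id E) - 𝟙 _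
  have iterate_T (m k : ℕ) (x : SingularChain F E k) :
      (T.f k)^[m] x = ((ρ k t - 1 : Module.End F _) ^ m) x := by
    rw [Module.End.pow_apply]
    rfl
  have iterate_T_eq_norm (k : ℕ) (x : SingularChain F E k) :
      (T.f k)^[p - 1] x = (ρ k).norm x := by
    rw [iterate_T, norm_eq_sub_one_pow (ρ k) ht orderOf_t]
  have ker_T : ModuleSubcomplex.ker T = ModuleSubcomplex.range (normComplexMap E G F) :=
    ker_singularComplexMap_smul_sub_id ht
  obtain ⟨eB⟩ := nonempty_homology_equiv_homology_range_normComplexMap F hq n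
  obtain ⟨eE⟩ := nonempty_singularHomology_equiv (X := E) F n
  rw [← ker_T] at eB
  have := Module.Finite.equiv eB
  have exists_iterate_eq (k : ℕ) (x : SingularChain F E k) (hx : T.f k x = 0) :
      ∃ y, (T.f k)^[p - 1] y = x := by
    obtain ⟨y, hy⟩ : x ∈ (ModuleSubcomplex.range (normComplexMap E G F)).submodule k := ker_T ▸ hx
    exact ⟨y, (iterate_T_eq_norm k y).trans ((normComplexMap_f_apply k y).symm.trans hy)⟩
  have iterate_eq_zero (k : ℕ) (x : SingularChain F E k) : (T.f k)^[p - 1 + 1] x = 0 := by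
    rw [Nat.sub_add_cancel p_prime.one_le]
    exact (iterate_T p k x).trans
      (LinearMap.congr_fun (sub_one_pow_char_eq_zero (ρ k) orderOf_t) x)
  obtain ⟨finite_E, finrank_E⟩ := ModuleSubcomplex.finite_and_finrank_homology_le_of_nilpotent
    T (p - 1) exists_iterate_eq iterate_eq_zero n
  refine ⟨Module.Finite.equiv eE.symm, ?_⟩
  rwa [Nat.sub_add_cancel p_prime.one_le, ← eE.finrank_eq, ← eB.finrank_eq] at finrank_E

end CyclicCovering

section PGroupCovering

section QuotientByNormal

variable {E : Type u} {G : Type w} [Group G] [MulAction G E]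

instance orbitQuotientMulAction (N : Subgroup G) [N.Normal] :
    MulAction (G ⧸ N) (MulAction.orbitRel.Quotient N E) where
  smul a x := Quotient.liftOn₂ a x (fun g e => Quotient.mk'' (g • e)) fun g e g' e' hg he => by
    obtain ⟨n, rfl⟩ := he
    have mem_N : g * n * g'⁻¹ ∈ N := by
      have : g⁻¹ * g' ∈ N := QuotientGroup.leftRel_apply.1 hg
      convert Subgroup.Normal.conj_mem inferInstance _ (N.mul_mem n.2 (N.inv_mem this)) g using 1
      group
    refine Quotient.sound ⟨⟨_, mem_N⟩, ?_⟩
    change (g * n * g'⁻¹) • g' • e' = g • (n : G) • e'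
    rw [mul_smul, mul_smul, inv_smul_smul]
  one_smul x := by
    induction x using Quotient.inductionOn with | _ e
    exact congrArg (Quotient.mk _) (one_smul G e)
  mul_smul a b x := by
    induction x using Quotient.inductionOn with | _ e
    induction a using QuotientGroup.induction_on with | _ g
    induction b using QuotientGroup.induction_on with | _ h
    exact congrArg (Quotient.mk _) (mul_smul g h e)

lemma mk_smul_orbitQuotient_eq_iff {N : Subgroup G} [N.Normal] {g : G} {e e' : E} :
    (g : G ⧸ N) • (Quotient.mk'' e : MulAction.orbitRel.Quotient N E) = Quotient.mk'' e' ↔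
      ∃ n : N, ((n : G) * g) • e = e' := by
  refine Quotient.eq''.trans (MulAction.mem_orbit_symm.trans (exists_congr fun n => ?_))
  rw [mul_smul]
  rfl

variable [TopologicalSpace E] {B : Type*} [TopologicalSpace B] {q : E → B}

lemma isQuotientCoveringMap_orbitQuotient_mk (hq : IsQuotientCoveringMap q G) (N : Subgroup G) :
    IsQuotientCoveringMap (Quotient.mk'' : E → MulAction.orbitRel.Quotient N E) N where
  __ := isQuotientMap_quotient_mk'
  continuous_const_smul n := hq.continuous_const_smul (n : G)
  apply_eq_iff_mem_orbit := Quotient.eq''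
  disjoint e := by
    obtain ⟨U, hU, h⟩ := hq.disjoint e
    exact ⟨U, hU, fun n hn => Subtype.ext (h n hn)⟩

lemma isQuotientCoveringMap_of_comp_orbitQuotient_mk (hq : IsQuotientCoveringMap q G)
    (N : Subgroup G) [N.Normal] {r : MulAction.orbitRel.Quotient N E → B}
    (hr : ∀ e, r (Quotient.mk'' e) = q e) : IsQuotientCoveringMap r (G ⧸ N) where
  toIsQuotientMap := by
    have r_comp_mk : r ∘ Quotient.mk'' = q := funext hr
    refine Topology.IsQuotientMap.of_comp (f := Quotient.mk'') continuous_quot_mk ?_ ?_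
    · rw [isQuotientMap_quotient_mk'.continuous_iff]
      exact r_comp_mk ▸ hq.continuous
    · exact r_comp_mk ▸ hq.toIsQuotientMap
  continuous_const_smul a := by
    induction a using QuotientGroup.induction_on with | _ g
    have := hq.toContinuousConstSMul
    exact continuous_quot_lift _ (continuous_quot_mk.comp (continuous_const_smul g))
  apply_eq_iff_mem_orbit {x y} := by
    induction x using Quotient.inductionOn with | _ e
    induction y using Quotient.inductionOn with | _ e'
    rw [hr, hr, hq.apply_eq_iff_mem_orbit]
    constructor
    · rintro ⟨g, rfl⟩
      exact ⟨g, rfl⟩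
    · rintro ⟨a, h⟩
      induction a using QuotientGroup.induction_on with | _ g
      obtain ⟨n, hn⟩ := mk_smul_orbitQuotient_eq_iff.1 h
      exact ⟨n * g, hn⟩
  disjoint x := by
    induction x using Quotient.inductionOn with | _ e
    obtain ⟨U, hU, h⟩ := hq.disjoint e
    have isOpenMap_mk := (isQuotientCoveringMap_orbitQuotient_mk hq N).isOpenQuotientMap.isOpenMap
    refine ⟨_, isOpenMap_mk.image_mem_nhds hU, fun a => ?_⟩
    induction a using QuotientGroup.induction_on with | _ g
    rintro ⟨_, ⟨_, ⟨x, hx, rfl⟩, rfl⟩, y, hy, hxy⟩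
    obtain ⟨n, hn⟩ := mk_smul_orbitQuotient_eq_iff.1 hxy.symm
    have n_mul_g : (n : G) * g = 1 := h _ ⟨y, ⟨x, hx, hn⟩, hy⟩
    rw [QuotientGroup.eq_one_iff, eq_inv_of_mul_eq_one_right n_mul_g]
    exact N.inv_mem n.2

end QuotientByNormal

lemma nonempty_homeomorph_of_subsingleton_group {E B : Type*} [TopologicalSpace E]
    [TopologicalSpace B] {G : Type*} [Group G] [Subsingleton G] [MulAction G E] {q : E → B}
    (hq : IsQuotientCoveringMap q G) : Nonempty (E ≃ₜ B) := by
  have q_injective : Function.Injective q := fun x y h => by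
    obtain ⟨g, rfl⟩ := hq.apply_eq_iff_mem_orbit.1 h
    rw [Subsingleton.elim g 1]
    exact one_smul G y
  exact ⟨(Equiv.ofBijective q ⟨q_injective, hq.surjective⟩).toHomeomorphOfContinuousOpen
    hq.continuous hq.isOpenQuotientMap.isOpenMap⟩

lemma exists_normal_subgroup_card_eq_prime {G : Type*} [Group G] {p m : ℕ} [Fact p.Prime]
    (hG : Nat.card G = p ^ (m + 1)) :
    ∃ N : Subgroup G, N.Normal ∧ Nat.card N = p ∧ Nat.card (G ⧸ N) = p ^ m := by
  have p_prime : p.Prime := Fact.out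
  have : Finite G := Nat.finite_of_card_ne_zero (hG ▸ pow_ne_zero _ p_prime.ne_zero)
  have isPGroup : IsPGroup p G := IsPGroup.of_card hG
  have : Nontrivial G := Finite.one_lt_card_iff_nontrivial.1
    (hG ▸ Nat.one_lt_pow (Nat.succ_ne_zero m) p_prime.one_lt)
  have dvd_card_center : p ∣ Nat.card (Subgroup.center G) := by
    obtain ⟨k, hk, h⟩ :=
      (isPGroup.to_subgroup (Subgroup.center G)).nontrivial_iff_card.1 isPGroup.center_nontrivial
    exact h ▸ dvd_pow_self p hk.ne'
  obtain ⟨z, orderOf_z⟩ := exists_prime_orderOf_dvd_card' p dvd_card_center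
  have card_zpowers : Nat.card (Subgroup.zpowers (z : G)) = p := by
    rw [Nat.card_zpowers, Subgroup.orderOf_coe, orderOf_z]
  have zpowers_normal : (Subgroup.zpowers (z : G)).Normal := ⟨fun a ha g => by
    rwa [Subgroup.mem_center_iff.1 (Subgroup.zpowers_le.2 z.2 ha) g, mul_inv_cancel_right]⟩
  refine ⟨Subgroup.zpowers (z : G), zpowers_normal, card_zpowers,
    Nat.eq_of_mul_eq_mul_right p_prime.pos ?_⟩
  have := Subgroup.card_eq_card_quotient_mul_card_subgroup (Subgroup.zpowers (z : G))
  rwa [hG, card_zpowers, pow_succ, eq_comm] at this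

theorem bettiNumber_le_of_card_eq_prime_pow (F : Type v) [Field F] {E B : Type u}
    [TopologicalSpace E] [TopologicalSpace B] {G : Type w} [Group G] [MulAction G E] {q : E → B}
    (hq : IsQuotientCoveringMap q G) (p : ℕ) [Fact p.Prime] [CharP F p] {m : ℕ}
    (hG : Nat.card G = p ^ m) (n : ℕ) [Module.Finite F (singularHomologyOver.{u, v} F n B)] :
    Module.Finite F (singularHomologyOver.{u, v} F n E) ∧
      bettiNumber.{u, v} F n E ≤ p ^ m * bettiNumber.{u, v} F n B := by
  induction m generalizing E G with
  | zero =>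
    have : Subsingleton G := (Nat.card_eq_one_iff_unique.1 (by simpa using hG)).1
    obtain ⟨e⟩ := nonempty_homeomorph_of_subsingleton_group hq
    obtain ⟨e'⟩ := nonempty_homology_equiv_of_homotopyEquiv (F := F) e.toHomotopyEquiv n
    exact ⟨Module.Finite.equiv e'.symm, by simp [bettiNumber, e'.finrank_eq]⟩
  | succ m ih =>
    obtain ⟨N, _, card_N, card_quotient⟩ := exists_normal_subgroup_card_eq_prime hG
    let r : MulAction.orbitRel.Quotient N E → B := Quotient.lift q fun _ _ h => by
      obtain ⟨n, rfl⟩ := h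
      exact hq.map_smul (n : G)
    obtain ⟨_, betti_quotient_le⟩ := ih (isQuotientCoveringMap_of_comp_orbitQuotient_mk hq N
      (r := r) fun _ => rfl) card_quotient
    have hN := isQuotientCoveringMap_orbitQuotient_mk hq N
    obtain ⟨finite_E, betti_E_le⟩ := bettiNumber_le_of_card_eq_prime F hN p card_N n
    refine ⟨finite_E, betti_E_le.trans ?_⟩
    rw [pow_succ', mul_assoc]
    exact Nat.mul_le_mul_left _ betti_quotient_le

end PGroupCovering

section PuncturedSpace

open Module ContinuousMap

variable {V : Type u} [NormedAddCommGroup V]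

variable (V) in
/-- The complement of the ray `{0} × s(-∞, 0]` in the punctured product `(V × ℝ) ∖ 0`. -/
def puncturedProdComplRay (s : ℝ) : Set {w : V × ℝ // w ≠ 0} :=
  {w | 0 < s * w.1.2 ∨ w.1.1 ≠ 0}

lemma isOpen_puncturedProdComplRay (s : ℝ) : IsOpen (puncturedProdComplRay V s) :=
  (isOpen_lt (f := fun _ => (0 : ℝ)) (g := fun w : {w : V × ℝ // w ≠ 0} => s * w.1.2)
    continuous_const (by fun_prop)).union
    (isOpen_ne_fun (f := fun w : {w : V × ℝ // w ≠ 0} => w.1.1) (g := fun _ => 0)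
      (by fun_prop) continuous_const)

lemma mem_puncturedProdComplRay_inter {w : {w : V × ℝ // w ≠ 0}} :
    w ∈ puncturedProdComplRay V 1 ∩ puncturedProdComplRay V (-1) ↔ w.1.1 ≠ 0 := by
  simp only [puncturedProdComplRay, Set.mem_inter_iff, Set.mem_ofPred_eq]
  grind

lemma puncturedProdComplRay_union :
    puncturedProdComplRay V 1 ∪ puncturedProdComplRay V (-1) = Set.univ := by
  refine Set.eq_univ_of_forall fun w => ?_
  have hw : ¬(w.1.1 = 0 ∧ w.1.2 = 0) := fun h => w.2 (Prod.ext h.1 h.2)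
  simp only [puncturedProdComplRay, Set.mem_union, Set.mem_ofPred_eq]
  grind

variable (V) in
/-- The two ray complements meet in `(V ∖ 0) × ℝ`. -/
def puncturedProdComplRayInterHomeomorph :
    ↥(puncturedProdComplRay V 1 ∩ puncturedProdComplRay V (-1)) ≃ₜ {v : V // v ≠ 0} × ℝ where
  toFun w := (⟨w.1.1.1, mem_puncturedProdComplRay_inter.1 w.2⟩, w.1.1.2)
  invFun w := ⟨⟨(w.1.1, w.2), fun h => w.1.2 (congrArg Prod.fst h)⟩,
    mem_puncturedProdComplRay_inter.2 w.1.2⟩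
  continuous_toFun := by fun_prop
  continuous_invFun := by fun_prop

variable [NormedSpace ℝ V]

lemma starConvex_compl_ray {s : ℝ} (hs : s ≠ 0) :
    StarConvex ℝ ((0 : V), s) {w | 0 < s * w.2 ∨ w.1 ≠ 0} := by
  have hss : 0 < s * s := mul_self_pos.2 hs
  rintro ⟨v, t⟩ hw a b ha hb hab
  rcases hb.eq_or_lt with rfl | hb
  · obtain rfl : a = 1 := by linarith
    left
    simpa using hss
  rcases hw with hw | hw
  · left
    change 0 < s * (a * s + b * t)
    have : s * (a * s + b * t) = a * (s * s) + b * (s * t) := by ring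
    rw [this]
    exact add_pos_of_nonneg_of_pos (mul_nonneg ha hss.le) (mul_pos hb hw)
  · right
    change a • (0 : V) + b • v ≠ 0
    rw [smul_zero, zero_add]
    exact smul_ne_zero hb.ne' hw

lemma contractibleSpace_puncturedProdComplRay {s : ℝ} (hs : s ≠ 0) :
    ContractibleSpace (puncturedProdComplRay V s) := by
  have image_eq : Subtype.val '' puncturedProdComplRay V s = {w | 0 < s * w.2 ∨ w.1 ≠ 0} := by
    ext w
    refine ⟨?_, fun hw => ⟨⟨w, ?_⟩, hw, rfl⟩⟩
    · rintro ⟨w, hw, rfl⟩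
      exact hw
    · rintro rfl
      simp at hw
  have : ContractibleSpace (Subtype.val '' puncturedProdComplRay V s) := by
    rw [image_eq]
    exact (starConvex_compl_ray hs).contractibleSpace ⟨(0, s), Or.inl (mul_self_pos.2 hs)⟩
  exact (Topology.IsEmbedding.subtypeVal.homeomorphImage _).contractibleSpace

variable {F : Type v} [Field F]

lemma HasSingularEulerChar.punctured_prod_real {N : ℕ} {c : ℤ}
    (h : HasSingularEulerChar F {v : V // v ≠ 0} N c) :
    HasSingularEulerChar F {w : V × ℝ // w ≠ 0} (N + 1) (2 - c) := by
  have contractible (s : ℝ) (hs : s ≠ 0) :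
      HasSingularEulerChar F (puncturedProdComplRay V s) (N + 1) 1 :=
    have := contractibleSpace_puncturedProdComplRay (V := V) hs
    HasEulerChar.mono hasSingularEulerChar_of_contractible (Nat.le_add_left 1 N)
  have e : ↥(puncturedProdComplRay V 1 ∩ puncturedProdComplRay V (-1)) ≃ₕ {v : V // v ≠ 0} :=
    (puncturedProdComplRayInterHomeomorph V).toHomotopyEquiv.trans
      ((ContinuousMap.HomotopyEquiv.prodCongr (.refl _)
        (ContractibleSpace.hequiv_unit ℝ).some).trans (Homeomorph.prodPUnit _).toHomotopyEquiv)
  have := HasSingularEulerChar.of_union (isOpen_puncturedProdComplRay 1)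
    (isOpen_puncturedProdComplRay (-1)) puncturedProdComplRay_union (contractible 1 one_ne_zero)
    (contractible (-1) (neg_ne_zero.2 one_ne_zero)) (HasSingularEulerChar.of_homotopyEquiv e.symm h)
  rwa [one_add_one_eq_two] at this

lemma hasSingularEulerChar_punctured [FiniteDimensional ℝ V] :
    HasSingularEulerChar F {v : V // v ≠ 0} (finrank ℝ V) (1 - (-1) ^ finrank ℝ V) := by
  generalize hk : finrank ℝ V = k
  induction k generalizing V with
  | zero =>
    have := finrank_zero_iff.1 hk
    have : IsEmpty {v : V // v ≠ 0} := ⟨fun v => v.2 (Subsingleton.elim _ _)⟩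
    simpa using hasSingularEulerChar_of_isEmpty (F := F) (X := {v : V // v ≠ 0}) 0
  | succ k ih =>
    let W := ULift.{u} (Fin k) → ℝ
    have finrank_W : finrank ℝ W = k := by simp [W]
    let e : V ≃L[ℝ] W × ℝ := ContinuousLinearEquiv.ofFinrankEq (by simp [hk, finrank_W])
    let e' : {v : V // v ≠ 0} ≃ₜ {w : W × ℝ // w ≠ 0} :=
      e.toHomeomorph.subtype fun v => (e.map_eq_zero_iff (x := v)).not.symm
    refine HasSingularEulerChar.of_homotopyEquiv e'.symm.toHomotopyEquiv ?_
    convert (ih finrank_W).punctured_prod_real using 1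
    ring

end PuncturedSpace

section Disks

/-- The closed unit ball of `Fin k → ℝ`, for the sup norm: the domain of the characteristic map of
a `k`-cell. -/
abbrev Disk (k : ℕ) := Metric.closedBall (0 : Fin k → ℝ) 1

instance (k : ℕ) : ContractibleSpace (Disk k) :=
  (convex_closedBall _ _).contractibleSpace ⟨0, by simp⟩

instance (k : ℕ) : LocallyPathConnectedSpace (Disk k) :=
  (convex_closedBall _ _).locallyPathConnectedSpace

instance (k : ℕ) : CompactSpace (Disk k) := isCompact_iff_compactSpace.1 (isCompact_closedBall _ _)

lemma unitBall_apply_eq_zero_iff {E : Type*} [NormedAddCommGroup E] [NormedSpace ℝ E]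
    {x : E} : (Homeomorph.unitBall x : E) = 0 ↔ x = 0 := by
  rw [← Homeomorph.unitBall.injective.eq_iff (a := x), ← Subtype.coe_inj,
    Homeomorph.coe_unitBall_apply_zero]

lemma nonempty_puncturedBall_homeomorph (k : ℕ) :
    Nonempty ({x : Disk k // ‖x.1‖ < 1 ∧ x.1 ≠ 0} ≃ₜ {x : Fin k → ℝ // x ≠ 0}) := by
  let b := Homeomorph.unitBall (E := Fin k → ℝ)
  let e : {x : Disk k // ‖x.1‖ < 1 ∧ x.1 ≠ 0} ≃ₜ {y : Metric.ball (0 : Fin k → ℝ) 1 // y.1 ≠ 0} :=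
    { toFun := fun x => ⟨⟨x.1.1, mem_ball_zero_iff.2 x.2.1⟩, x.2.2⟩
      invFun := fun y => ⟨⟨y.1.1, Metric.ball_subset_closedBall y.1.2⟩,
        mem_ball_zero_iff.1 y.1.2, y.2⟩
      continuous_toFun := by fun_prop
      continuous_invFun := by fun_prop }
  exact ⟨e.trans (b.subtype fun _ => unitBall_apply_eq_zero_iff.not.symm).symm⟩

variable {F : Type v} [Field F] {X : Type u} [TopologicalSpace X]

lemma hasSingularEulerChar_of_homotopyEquiv_punctured {k : ℕ}
    (e : ContinuousMap.HomotopyEquiv X {x : Fin k → ℝ // x ≠ 0}) :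
    HasSingularEulerChar F X k (1 - (-1) ^ k) := by
  let W := ULift.{u} (Fin k) → ℝ
  have finrank_W : Module.finrank ℝ W = k := by simp [W]
  let l : W ≃L[ℝ] (Fin k → ℝ) := ContinuousLinearEquiv.ofFinrankEq (by simp [finrank_W])
  let l' : {w : W // w ≠ 0} ≃ₜ {x : Fin k → ℝ // x ≠ 0} :=
    l.toHomeomorph.subtype fun w => (l.map_eq_zero_iff (x := w)).not.symm
  have := hasSingularEulerChar_punctured (F := F) (V := W)
  rw [finrank_W] at this
  exact this.of_homotopyEquiv (l'.toHomotopyEquiv.trans e.symm)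

end Disks

section CellAttachment

open scoped unitInterval

lemma isProperMap_sumElim {X Y Z : Type*} [TopologicalSpace X] [TopologicalSpace Y]
    [TopologicalSpace Z] {f : X → Z} {g : Y → Z} (hf : IsProperMap f) (hg : IsProperMap g) :
    IsProperMap (Sum.elim f g) := by
  refine isProperMap_iff_isClosedMap_and_compact_fibers.2
    ⟨hf.continuous.sumElim hg.continuous, hf.isClosedMap.sumElim hg.isClosedMap, fun z => ?_⟩
  have fiber_eq : Sum.elim f g ⁻¹' {z} = Sum.inl '' (f ⁻¹' {z}) ∪ Sum.inr '' (g ⁻¹' {z}) := by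
    ext (x | y) <;> simp
  rw [fiber_eq]
  exact ((hf.isCompact_preimage isCompact_singleton).image continuous_inl).union
    ((hg.isCompact_preimage isCompact_singleton).image continuous_inr)

lemma Disk.norm_le {k : ℕ} (x : Disk k) : ‖x.1‖ ≤ 1 := mem_closedBall_zero_iff.1 x.2

/-- `Disk k` without its centre. -/
abbrev PuncturedDisk (k : ℕ) := {x : Disk k // x.1 ≠ 0}

/-- The radial deformation `(s, x) ↦ (1 - s + s / ‖x‖) x` of the punctured disk to its boundary. -/
noncomputable def radialDeformation (k : ℕ) : C(I × PuncturedDisk k, PuncturedDisk k) :=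
  have norm_pos : ∀ p : I × PuncturedDisk k, 0 < ‖p.2.1.1‖ := fun p => norm_pos_iff.2 p.2.2
  have scale_pos : ∀ p : I × PuncturedDisk k, 0 < (1 - (p.1 : ℝ)) + p.1 * ‖p.2.1.1‖⁻¹ := fun p => by
    have : 1 ≤ ‖p.2.1.1‖⁻¹ := (one_le_inv₀ (norm_pos p)).2 (Disk.norm_le p.2.1)
    nlinarith [p.1.2.1, p.1.2.2]
  { toFun := fun p => ⟨⟨((1 - (p.1 : ℝ)) + p.1 * ‖p.2.1.1‖⁻¹) • p.2.1.1, by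
        rw [mem_closedBall_zero_iff, norm_smul, Real.norm_of_nonneg (scale_pos p).le, add_mul,
          mul_assoc, inv_mul_cancel₀ (norm_pos p).ne']
        have := mul_le_mul_of_nonneg_left (Disk.norm_le p.2.1) (sub_nonneg.2 p.1.2.2)
        linarith⟩, smul_ne_zero (scale_pos p).ne' p.2.2⟩
    continuous_toFun := by
      have : Continuous fun p : I × PuncturedDisk k => ‖p.2.1.1‖⁻¹ :=
        Continuous.inv₀ (by fun_prop) fun p => (norm_pos p).ne'
      exact Continuous.subtype_mk (Continuous.subtype_mk (by fun_prop) _) _ }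

lemma radialDeformation_zero {k : ℕ} (x : PuncturedDisk k) : radialDeformation k (0, x) = x := by
  apply Subtype.ext; apply Subtype.ext
  simp [radialDeformation]

lemma radialDeformation_of_norm_eq {k : ℕ} (s : I) {x : PuncturedDisk k} (hx : ‖x.1.1‖ = 1) :
    radialDeformation k (s, x) = x := by
  apply Subtype.ext; apply Subtype.ext
  simp [radialDeformation, hx]

lemma norm_radialDeformation_one {k : ℕ} (x : PuncturedDisk k) :
    ‖(radialDeformation k (1, x)).1.1‖ = 1 := by
  simp [radialDeformation, norm_smul, x.2]

/-- `Φ` exhibits `X` as obtained from the closed subspace `A` by attaching a `k`-cell. -/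
structure IsCellAttachment {X : Type u} [TopologicalSpace X] (A : Set X) {k : ℕ}
    (Φ : C(Disk k, X)) : Prop where
  isClosed : IsClosed A
  mem_iff : ∀ x, Φ x ∈ A ↔ ‖x.1‖ = 1
  injOn : ∀ x y, ‖x.1‖ < 1 → ‖y.1‖ < 1 → Φ x = Φ y → x = y
  cover : ∀ z, z ∉ A → ∃ x, Φ x = z

namespace IsCellAttachment

variable {X : Type u} [TopologicalSpace X] {A : Set X} {k : ℕ} {Φ : C(Disk k, X)}

lemma notMem_iff (h : IsCellAttachment A Φ) {x : Disk k} : Φ x ∉ A ↔ ‖x.1‖ < 1 := by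
  rw [h.mem_iff, (Disk.norm_le x).lt_iff_ne]

variable (Φ) in
/-- The complement of the centre of the cell. -/
def punctured : Set X := {Φ ⟨0, by simp⟩}ᶜ

lemma subset_punctured (h : IsCellAttachment A Φ) : A ⊆ punctured Φ := by
  rintro _ hx rfl
  exact h.notMem_iff.2 (by simp) hx

lemma mem_punctured (h : IsCellAttachment A Φ) {x : Disk k} : Φ x ∈ punctured Φ ↔ x.1 ≠ 0 := by
  refine not_congr ⟨fun hx => ?_, fun hx => congrArg Φ (Subtype.ext hx)⟩
  have norm_lt : ‖x.1‖ < 1 := h.notMem_iff.1 (by rw [hx]; exact h.notMem_iff.2 (by simp))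
  exact congrArg Subtype.val (h.injOn x _ norm_lt (by simp) hx)

lemma punctured_union_compl (h : IsCellAttachment A Φ) : punctured Φ ∪ Aᶜ = Set.univ :=
  Set.eq_univ_of_forall fun _ => (em _).imp (fun hz => h.subset_punctured hz) id

/-- `A` and the punctured disk together cover `punctured Φ`. -/
def puncturedCover (h : IsCellAttachment A Φ) : C(A ⊕ PuncturedDisk k, punctured Φ) where
  toFun := Sum.elim (fun z => ⟨z.1, h.subset_punctured z.2⟩)
    fun x => ⟨Φ x.1, h.mem_punctured.2 x.2⟩
  continuous_toFun := by fun_prop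

variable (A k) in
/-- The deformation of `A ⊕ PuncturedDisk k` which is stationary on `A` and radial on the disk. -/
noncomputable def coverDeformation :
    C(I × (A ⊕ PuncturedDisk k), A ⊕ PuncturedDisk k) where
  toFun := Sum.map Prod.snd (radialDeformation k) ∘ Homeomorph.prodSumDistrib
  continuous_toFun := by fun_prop

lemma surjective_puncturedCover (h : IsCellAttachment A Φ) :
    Function.Surjective h.puncturedCover := fun z => by
  by_cases hz : z.1 ∈ A
  · exact ⟨.inl ⟨z.1, hz⟩, rfl⟩
  · obtain ⟨x, hx⟩ := h.cover z.1 hz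
    exact ⟨.inr ⟨x, h.mem_punctured.1 (by rw [hx]; exact z.2)⟩, Subtype.ext hx⟩

lemma puncturedCover_coverDeformation_congr (h : IsCellAttachment A Φ) (s : I)
    {y z : A ⊕ PuncturedDisk k} (hyz : h.puncturedCover y = h.puncturedCover z) :
    h.puncturedCover (coverDeformation A k (s, y)) =
      h.puncturedCover (coverDeformation A k (s, z)) := by
  have stationary {y : A ⊕ PuncturedDisk k} (hy : (h.puncturedCover y).1 ∈ A) :
      coverDeformation A k (s, y) = y := by
    obtain a | x := y
    · rfl
    · exact congrArg Sum.inr (radialDeformation_of_norm_eq s ((h.mem_iff _).1 hy))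
  by_cases hy : (h.puncturedCover y).1 ∈ A
  · rw [stationary hy, stationary (hyz ▸ hy), hyz]
  · have hz : (h.puncturedCover z).1 ∉ A := hyz ▸ hy
    obtain a | x := y
    · exact absurd a.2 hy
    obtain a | x' := z
    · exact absurd a.2 hz
    obtain rfl : x = x' := Subtype.ext
      (h.injOn _ _ (h.notMem_iff.1 hy) (h.notMem_iff.1 hz) (congrArg Subtype.val hyz))
    rfl

variable [T2Space X]

lemma isOpen_punctured : IsOpen (punctured Φ) := isClosed_singleton.isOpen_compl

lemma nonempty_homeomorph_of_subset_compl (h : IsCellAttachment A Φ) {S : Set X} (hS : S ⊆ Aᶜ) :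
    Nonempty ({x : Disk k // Φ x ∈ S} ≃ₜ S) := by
  have bijective : Function.Bijective (S.restrictPreimage Φ) := by
    refine ⟨fun x y hxy => Subtype.ext (h.injOn _ _ (h.notMem_iff.1 (hS x.2))
      (h.notMem_iff.1 (hS y.2)) (congrArg Subtype.val hxy)), fun z => ?_⟩
    obtain ⟨x, hx⟩ := h.cover z.1 (hS z.2)
    exact ⟨⟨x, by rw [Set.mem_preimage, hx]; exact z.2⟩, Subtype.ext hx⟩
  exact ⟨(Equiv.ofBijective _ bijective).toHomeomorphOfContinuousClosed
    (Φ.continuous.restrictPreimage) (Φ.continuous.isClosedMap.restrictPreimage S)⟩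

lemma contractibleSpace_compl (h : IsCellAttachment A Φ) : ContractibleSpace ↥Aᶜ := by
  obtain ⟨e⟩ := h.nonempty_homeomorph_of_subset_compl subset_rfl
  let e' : {x : Disk k // Φ x ∈ Aᶜ} ≃ₜ Metric.ball (0 : Fin k → ℝ) 1 :=
    { toFun := fun x => ⟨x.1.1, mem_ball_zero_iff.2 (h.notMem_iff.1 x.2)⟩
      invFun := fun x => ⟨⟨x.1, Metric.ball_subset_closedBall x.2⟩,
        h.notMem_iff.2 (mem_ball_zero_iff.1 x.2)⟩
      continuous_toFun := by fun_prop
      continuous_invFun := by fun_prop }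
  have : ContractibleSpace (Metric.ball (0 : Fin k → ℝ) 1) :=
    (convex_ball _ _).contractibleSpace ⟨0, by simp⟩
  exact (e.symm.trans e').contractibleSpace

lemma isProperMap_puncturedCover (h : IsCellAttachment A Φ) : IsProperMap h.puncturedCover :=
  isProperMap_sumElim
    (isProperMap_of_comp_of_inj (by fun_prop) continuous_subtype_val
      h.isClosed.isProperMap_subtypeVal Subtype.val_injective)
    ((Φ.continuous.isProperMap.restrictPreimage (punctured Φ)).comp
      ((Homeomorph.refl _).subtype fun _ => h.mem_punctured.symm).isProperMap)

/-- The deformation on `A` and on the punctured disk descends along the proper, hence quotient,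
map `puncturedCover`; crossing with the unit interval preserves properness. -/
lemma exists_deformation (h : IsCellAttachment A Φ) :
    ∃ H : C(I × punctured Φ, punctured Φ), ∀ s y,
      H (s, h.puncturedCover y) = h.puncturedCover (coverDeformation A k (s, y)) := by
  let q : C(I × (A ⊕ PuncturedDisk k), I × punctured Φ) :=
    (ContinuousMap.id I).prodMap h.puncturedCover
  have isQuotientMap : Topology.IsQuotientMap q :=
    (isProperMap_id.prodMap h.isProperMap_puncturedCover).isClosedMap.isQuotientMap q.continuous
      (Function.surjective_id.prodMap h.surjective_puncturedCover)
  let H' := h.puncturedCover.comp (coverDeformation A k)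
  have factorsThrough : Function.FactorsThrough H' q := by
    rintro ⟨s, y⟩ ⟨s', z⟩ hyz
    obtain ⟨rfl, hyz⟩ := Prod.ext_iff.1 hyz
    exact h.puncturedCover_coverDeformation_congr s hyz
  exact ⟨isQuotientMap.lift H' factorsThrough, fun s y =>
    DFunLike.congr_fun (isQuotientMap.lift_comp H' factorsThrough) (s, y)⟩

lemma nonempty_homotopyEquiv_punctured (h : IsCellAttachment A Φ) :
    Nonempty (ContinuousMap.HomotopyEquiv A (punctured Φ)) := by
  obtain ⟨H, hH⟩ := h.exists_deformation
  have H_zero (z : punctured Φ) : H (0, z) = z := by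
    obtain ⟨a | x, rfl⟩ := h.surjective_puncturedCover z
    · exact hH 0 _
    · exact (hH 0 _).trans
        (congrArg (fun x => h.puncturedCover (.inr x)) (radialDeformation_zero x))
  have H_one_mem (z : punctured Φ) : (H (1, z)).1 ∈ A := by
    obtain ⟨a | x, rfl⟩ := h.surjective_puncturedCover z
    · rw [hH]
      exact a.2
    · rw [hH]
      exact (h.mem_iff _).2 (norm_radialDeformation_one x)
  let i : C(A, punctured Φ) := ⟨fun a => h.puncturedCover (.inl a), by fun_prop⟩
  let r : C(punctured Φ, A) := ⟨fun z => ⟨(H (1, z)).1, H_one_mem z⟩, by fun_prop⟩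
  have r_comp_i : r.comp i = ContinuousMap.id A :=
    ContinuousMap.ext fun a => Subtype.ext (congrArg (fun z => z.1) (hH 1 (.inl a)))
  exact ⟨⟨i, r, r_comp_i ▸ .refl _, .symm ⟨⟨H, H_zero, fun _ => rfl⟩⟩⟩⟩

variable {F : Type v} [Field F]

lemma hasSingularEulerChar_inter (h : IsCellAttachment A Φ) :
    HasSingularEulerChar F ↥(punctured Φ ∩ Aᶜ) k (1 - (-1) ^ k) := by
  obtain ⟨e⟩ := h.nonempty_homeomorph_of_subset_compl (S := punctured Φ ∩ Aᶜ) Set.inter_subset_right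
  let e' : {x : Disk k // Φ x ∈ punctured Φ ∩ Aᶜ} ≃ₜ {x : Disk k // ‖x.1‖ < 1 ∧ x.1 ≠ 0} :=
    (Homeomorph.refl _).subtype fun _ => (and_congr h.mem_punctured h.notMem_iff).trans and_comm
  exact hasSingularEulerChar_of_homotopyEquiv_punctured
    (e.symm.trans (e'.trans (nonempty_puncturedBall_homeomorph k).some)).toHomotopyEquiv

lemma hasSingularEulerChar (h : IsCellAttachment A Φ) {N : ℕ} {c : ℤ}
    (hA : HasSingularEulerChar F A N c) (hN : k + 1 ≤ N) :
    HasSingularEulerChar F X N (c + (-1) ^ k) := by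
  obtain ⟨M, rfl⟩ : ∃ M, N = M + 1 := ⟨N - 1, by omega⟩
  have := h.contractibleSpace_compl
  have hX := HasSingularEulerChar.of_union isOpen_punctured h.isClosed.isOpen_compl
    h.punctured_union_compl
    (HasSingularEulerChar.of_homotopyEquiv h.nonempty_homotopyEquiv_punctured.some hA)
    (HasEulerChar.mono hasSingularEulerChar_of_contractible (by omega))
    (HasEulerChar.mono (h.hasSingularEulerChar_inter (F := F)) (by omega : k ≤ M))
  convert hX using 1
  ring

lemma bettiNumber_le (h : IsCellAttachment A Φ) {N : ℕ} {c : ℤ}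
    (hA : HasSingularEulerChar F A N c) (hN : k + 1 ≤ N) {n : ℕ} (hn : k ≤ n) :
    bettiNumber.{u, v} F n A ≤ bettiNumber.{u, v} F n X := by
  have e := h.nonempty_homotopyEquiv_punctured.some
  have := (h.hasSingularEulerChar_inter (F := F)).subsingleton n hn
  have := (h.hasSingularEulerChar hA hN).finite n
  rw [bettiNumber_eq_of_homotopyEquiv F e]
  exact (Nat.le_add_right _ _).trans
    (finite_and_bettiNumber_add_le isOpen_punctured h.isClosed.isOpen_compl
      h.punctured_union_compl n).2

end IsCellAttachment

end CellAttachment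

section CellDecomposition

/-- A decomposition of a space into open cells, with characteristic maps sending the boundary of
each disk into the union of the open cells of smaller dimension. No topology is prescribed in terms
of the cells: this is used for finite sets of cells in Hausdorff spaces. -/
structure CellDecomposition (E : Type u) [TopologicalSpace E] (J : Type w) where
  dim : J → ℕ
  map : ∀ j, C(Disk (dim j), E)
  injOn : ∀ j x y, ‖x.1‖ < 1 → ‖y.1‖ < 1 → map j x = map j y → x = y
  eq_of_map_eq : ∀ i j x y, ‖x.1‖ < 1 → ‖y.1‖ < 1 → map i x = map j y → i = j
  cover : ∀ z, ∃ j x, ‖x.1‖ < 1 ∧ map j x = z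
  frontier : ∀ j x, ‖x.1‖ = 1 → ∃ i y, dim i < dim j ∧ ‖y.1‖ < 1 ∧ map i y = map j x

/-- A subset contained in another one, as a subspace of the latter. -/
def homeomorphSubsetOfSubset {E : Type*} [TopologicalSpace E] {S T : Set E} (h : S ⊆ T) :
    {z : T | z.1 ∈ S} ≃ₜ S where
  toFun z := ⟨z.1.1, z.2⟩
  invFun z := ⟨⟨z.1, h z.2⟩, z.2⟩
  continuous_toFun := by fun_prop
  continuous_invFun := by fun_prop

lemma t2Space_of_isSeparatedMap {Z E : Type*} [TopologicalSpace Z] [TopologicalSpace E] [T2Space E]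
    {q : Z → E} (hq : IsSeparatedMap q) (q_continuous : Continuous q) : T2Space Z := by
  refine ⟨fun x y hxy => ?_⟩
  by_cases h : q x = q y
  · exact hq x y h hxy
  · obtain ⟨U, V, hU, hV, hx, hy, hUV⟩ := t2_separation h
    exact ⟨q ⁻¹' U, q ⁻¹' V, hU.preimage q_continuous, hV.preimage q_continuous, hx, hy,
      hUV.preimage q⟩

namespace CellDecomposition

variable {E : Type u} [TopologicalSpace E] {J : Type w} (D : CellDecomposition E J)

/-- The open cell with index `j`. -/
def openCell (j : J) : Set E := {z | ∃ x, ‖x.1‖ < 1 ∧ D.map j x = z}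

/-- The union of a finite set of open cells. -/
def carrier (s : Finset J) : Set E := {z | ∃ j ∈ s, z ∈ D.openCell j}

/-- A finite set of cells is a subcomplex if its carrier contains the closures of its cells. -/
def IsSubcomplex (s : Finset J) : Prop := ∀ j ∈ s, ∀ x, D.map j x ∈ D.carrier s

lemma map_mem_openCell_iff {i j : J} {x} (hx : ‖x.1‖ < 1) :
    D.map j x ∈ D.openCell i ↔ j = i := by
  constructor
  · rintro ⟨y, hy, h⟩
    exact (D.eq_of_map_eq _ _ _ _ hy hx h).symm
  · rintro rfl
    exact ⟨x, hx, rfl⟩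

lemma map_mem_carrier_iff {s : Finset J} {j : J} {x} (hx : ‖x.1‖ < 1) :
    D.map j x ∈ D.carrier s ↔ j ∈ s := by
  simp only [carrier, Set.mem_ofPred_eq, D.map_mem_openCell_iff hx, exists_eq_right']

lemma carrier_mono {s t : Finset J} (h : s ⊆ t) : D.carrier s ⊆ D.carrier t :=
  fun _ ⟨j, hj, hz⟩ => ⟨j, h hj, hz⟩

lemma carrier_univ [Fintype J] : D.carrier Finset.univ = Set.univ :=
  Set.eq_univ_of_forall fun z =>
    let ⟨j, x, hx, h⟩ := D.cover z
    ⟨j, Finset.mem_univ j, x, hx, h⟩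

lemma isSubcomplex_empty : D.IsSubcomplex ∅ := fun _ hj => absurd hj (Finset.notMem_empty _)

lemma isSubcomplex_univ [Fintype J] : D.IsSubcomplex Finset.univ := fun _ _ _ => by
  rw [carrier_univ]
  exact Set.mem_univ _

/-- Carrier of the full set of cells. -/
def carrierUnivHomeomorph [Fintype J] : D.carrier Finset.univ ≃ₜ E :=
  (Homeomorph.setCongr D.carrier_univ).trans (Homeomorph.Set.univ E)

lemma map_mem_carrier_erase [DecidableEq J] {s : Finset J} (hs : D.IsSubcomplex s) {i j : J}
    (hi : i ∈ s) (hij : D.dim i ≤ D.dim j) {x} (hx : ‖x.1‖ = 1) :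
    D.map i x ∈ D.carrier (s.erase j) := by
  obtain ⟨k, y, hk, hy, hky⟩ := D.frontier i x hx
  have mem_carrier := hs i hi x
  rw [← hky, D.map_mem_carrier_iff hy] at mem_carrier ⊢
  refine Finset.mem_erase.2 ⟨?_, mem_carrier⟩
  rintro rfl
  exact hij.not_gt hk

variable {D} in
/-- Removing a cell of maximal dimension outside of a smaller subcomplex leaves a subcomplex. -/
lemma IsSubcomplex.exists_erase [DecidableEq J] {s t : Finset J} (hs : D.IsSubcomplex s)
    (ht : D.IsSubcomplex t) (hst : s ⊂ t) : ∃ j ∈ t \ s, D.IsSubcomplex (t.erase j) := by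
  obtain ⟨j, hj, dim_le⟩ := (t \ s).exists_max_image D.dim (Finset.sdiff_nonempty.2 hst.2)
  obtain ⟨-, hjs⟩ := Finset.mem_sdiff.1 hj
  refine ⟨j, hj, fun i hi x => ?_⟩
  obtain ⟨-, hit⟩ := Finset.mem_erase.1 hi
  by_cases his : i ∈ s
  · exact D.carrier_mono (Finset.subset_erase.2 ⟨hst.1, hjs⟩) (hs i his x)
  obtain hx | hx := (Disk.norm_le x).lt_or_eq
  · exact (D.map_mem_carrier_iff hx).2 hi
  · exact D.map_mem_carrier_erase ht hit (dim_le i (Finset.mem_sdiff.2 ⟨hit, his⟩)) hx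

variable {D} in
lemma IsSubcomplex.induction [DecidableEq J] {s : Finset J} (hs : D.IsSubcomplex s)
    {P : Finset J → Prop} (base : P s)
    (attach : ∀ t, D.IsSubcomplex t → ∀ j ∈ t, D.IsSubcomplex (t.erase j) → P (t.erase j) → P t)
    {t : Finset J} (hst : s ⊆ t) (ht : D.IsSubcomplex t) : P t := by
  induction t using Finset.strongInduction with
  | H t ih =>
    obtain rfl | hst := hst.eq_or_ssubset
    · exact base
    obtain ⟨j, hj, hj'⟩ := hs.exists_erase ht hst
    obtain ⟨hjt, hjs⟩ := Finset.mem_sdiff.1 hj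
    exact attach t ht j hjt hj'
      (ih _ (Finset.erase_ssubset hjt) (Finset.subset_erase.2 ⟨hst.1, hjs⟩) hj')

section Hausdorff

variable [T2Space E]

lemma isClosed_carrier {s : Finset J} (hs : D.IsSubcomplex s) : IsClosed (D.carrier s) := by
  have carrier_eq : D.carrier s = ⋃ j ∈ s, Set.range (D.map j) := by
    ext z
    simp only [Set.mem_iUnion, Set.mem_range]
    constructor
    · rintro ⟨j, hj, x, -, rfl⟩
      exact ⟨j, hj, x, rfl⟩
    · rintro ⟨j, hj, x, rfl⟩
      exact hs j hj x
  rw [carrier_eq]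
  exact s.finite_toSet.isClosed_biUnion fun j _ => (isCompact_range (D.map j).continuous).isClosed

lemma isCellAttachment [DecidableEq J] {t : Finset J} (ht : D.IsSubcomplex t) {j : J} (hj : j ∈ t)
    (ht' : D.IsSubcomplex (t.erase j)) :
    IsCellAttachment (X := D.carrier t) {z : D.carrier t | z.1 ∈ D.carrier (t.erase j)}
      ⟨fun x => ⟨D.map j x, ht j hj x⟩, by fun_prop⟩ where
  isClosed := (D.isClosed_carrier ht').preimage continuous_subtype_val
  mem_iff x := by
    refine ⟨fun h => (Disk.norm_le x).eq_of_not_lt fun hx => ?_,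
      D.map_mem_carrier_erase ht hj le_rfl⟩
    exact Finset.notMem_erase j t ((D.map_mem_carrier_iff hx).1 h)
  injOn x y hx hy h := D.injOn j x y hx hy (congrArg Subtype.val h)
  cover := by
    rintro ⟨z, i, hi, x, hx, rfl⟩ hz
    obtain rfl : i = j := by
      by_contra hij
      exact hz ((D.map_mem_carrier_iff hx).2 (Finset.mem_erase.2 ⟨hij, hi⟩))
    exact ⟨x, rfl⟩

variable {F : Type v} [Field F]

lemma hasSingularEulerChar_carrier {N : ℕ} (hN : ∀ j, D.dim j + 1 ≤ N) {s : Finset J}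
    (hs : D.IsSubcomplex s) :
    HasSingularEulerChar F (D.carrier s) N (∑ j ∈ s, (-1) ^ D.dim j) := by
  classical
  refine D.isSubcomplex_empty.induction
    (P := fun s => HasSingularEulerChar F (D.carrier s) N (∑ j ∈ s, (-1) ^ D.dim j))
    ?_ (fun t ht j hj ht' h => ?_) s.empty_subset hs
  · have : IsEmpty (D.carrier ∅) := ⟨fun ⟨_, j, hj, _⟩ => Finset.notMem_empty j hj⟩
    rw [Finset.sum_empty]
    exact hasSingularEulerChar_of_isEmpty N
  · rw [← Finset.sum_erase_add _ _ hj]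
    exact (D.isCellAttachment ht hj ht').hasSingularEulerChar (h.of_homotopyEquiv
      (homeomorphSubsetOfSubset (D.carrier_mono (t.erase_subset j))).symm.toHomotopyEquiv) (hN j)

lemma hasSingularEulerChar [Fintype J] {N : ℕ} (hN : ∀ j, D.dim j + 1 ≤ N) :
    HasSingularEulerChar F E N (∑ j, (-1) ^ D.dim j) :=
  (D.hasSingularEulerChar_carrier hN D.isSubcomplex_univ).of_homotopyEquiv
    D.carrierUnivHomeomorph.toHomotopyEquiv

lemma bettiNumber_carrier_le [Finite J] {n : ℕ} (hn : ∀ j, D.dim j ≤ n) {s : Finset J}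
    (hs : D.IsSubcomplex s) :
    bettiNumber.{u, v} F n (D.carrier s) ≤ bettiNumber.{u, v} F n E := by
  classical
  have := Fintype.ofFinite J
  have hN (j) : D.dim j + 1 ≤ n + 1 := Nat.succ_le_succ (hn j)
  rw [← bettiNumber_eq_of_homotopyEquiv F D.carrierUnivHomeomorph.toHomotopyEquiv]
  refine hs.induction
    (P := fun t => bettiNumber.{u, v} F n (D.carrier s) ≤ bettiNumber.{u, v} F n (D.carrier t))
    le_rfl (fun t ht j hj ht' h => h.trans ?_) s.subset_univ D.isSubcomplex_univ
  have e := (homeomorphSubsetOfSubset (D.carrier_mono (t.erase_subset j))).toHomotopyEquiv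
  rw [← bettiNumber_eq_of_homotopyEquiv F e]
  exact (D.isCellAttachment ht hj ht').bettiNumber_le
    ((D.hasSingularEulerChar_carrier hN ht').of_homotopyEquiv e.symm) (hN j) (hn j)

end Hausdorff

lemma exists_carrier_eq_of_isClosed [Finite J] {A : Set E} (hA : IsClosed A)
    (h : ∀ j x y, ‖x.1‖ < 1 → ‖y.1‖ < 1 → D.map j x ∈ A → D.map j y ∈ A) :
    ∃ s, D.IsSubcomplex s ∧ D.carrier s = A := by
  classical
  have := Fintype.ofFinite J
  have norm_zero_lt (j : J) : ‖(⟨0, by simp⟩ : Disk (D.dim j)).1‖ < 1 := by simp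
  let s : Finset J := {j | D.map j ⟨0, by simp⟩ ∈ A}
  have mem_s_iff {j} : j ∈ s ↔ D.map j ⟨0, by simp⟩ ∈ A := by simp [s]
  have carrier_eq : D.carrier s = A := by
    ext z
    obtain ⟨j, x, hx, rfl⟩ := D.cover z
    rw [D.map_mem_carrier_iff hx, mem_s_iff]
    exact ⟨h j _ _ (norm_zero_lt j) hx, h j _ _ hx (norm_zero_lt j)⟩
  refine ⟨s, fun j hj x => ?_, carrier_eq⟩
  have preimage_closed : IsClosed (Subtype.val '' (D.map j ⁻¹' A)) :=
    Metric.isClosed_closedBall.isClosedEmbedding_subtypeVal.isClosedMap _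
      (hA.preimage (D.map j).continuous)
  have ball_subset : Metric.ball (0 : Fin (D.dim j) → ℝ) 1 ⊆ Subtype.val '' (D.map j ⁻¹' A) :=
    fun y hy => ⟨⟨y, Metric.ball_subset_closedBall hy⟩,
      h j _ _ (norm_zero_lt j) (mem_ball_zero_iff.1 hy) (mem_s_iff.1 hj), rfl⟩
  have closedBall_subset := closure_minimal ball_subset preimage_closed
  rw [closure_ball _ one_ne_zero] at closedBall_subset
  obtain ⟨y, hy, hyx⟩ := closedBall_subset x.2
  rwa [carrier_eq, ← Subtype.ext hyx]

lemma bettiNumber_le_of_isClosed {F : Type v} [Field F] [T2Space E] [Finite J] {n : ℕ}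
    (hn : ∀ j, D.dim j ≤ n) {A : Set E} (hA : IsClosed A)
    (h : ∀ j x y, ‖x.1‖ < 1 → ‖y.1‖ < 1 → D.map j x ∈ A → D.map j y ∈ A) :
    bettiNumber.{u, v} F n A ≤ bettiNumber.{u, v} F n E := by
  obtain ⟨s, hs, rfl⟩ := D.exists_carrier_eq_of_isClosed hA h
  exact D.bettiNumber_carrier_le hn hs

section Components

variable [Finite J]

include D in
lemma compactSpace : CompactSpace E := by
  refine ⟨?_⟩
  have : (Set.univ : Set E) = ⋃ j, Set.range (D.map j) := by
    refine (Set.eq_univ_of_forall fun z => ?_).symm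
    obtain ⟨j, x, -, rfl⟩ := D.cover z
    exact Set.mem_iUnion.2 ⟨j, x, rfl⟩
  rw [this]
  exact isCompact_iUnion fun j => isCompact_range (D.map j).continuous

variable [T2Space E]

include D in
lemma isClosed_of_forall_joined {A : Set E} (hA : ∀ x ∈ A, ∀ y, Joined x y → y ∈ A) :
    IsClosed A := by
  have eq_biUnion : A = ⋃ j ∈ {j : J | ∃ y, D.map j y ∈ A}, Set.range (D.map j) := by
    ext x
    simp only [Set.mem_ofPred_eq, Set.mem_iUnion, Set.mem_range, exists_prop]
    constructor
    · intro hx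
      obtain ⟨j, y, -, rfl⟩ := D.cover x
      exact ⟨j, ⟨y, hx⟩, y, rfl⟩
    · rintro ⟨j, ⟨y, hy⟩, y', rfl⟩
      exact hA _ hy _ ((PathConnectedSpace.joined y y').map (D.map j).continuous)
  rw [eq_biUnion]
  exact (Set.toFinite _).isClosed_biUnion fun j _ =>
    (isCompact_range (D.map j).continuous).isClosed

include D in
lemma isClopen_pathComponent (z : E) : IsClopen (pathComponent z) :=
  ⟨D.isClosed_of_forall_joined fun _ hx _ hxy => hx.trans hxy, isClosed_compl_iff.1
    (D.isClosed_of_forall_joined fun _ hx _ hxy hy => hx (hy.trans hxy.symm))⟩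

include D in
lemma pathConnectedSpace [ConnectedSpace E] : PathConnectedSpace E := by
  have z : E := Classical.arbitrary E
  have := (D.isClopen_pathComponent z).eq_univ ⟨z, mem_pathComponent_self z⟩
  exact pathConnectedSpace_iff_eq.2 ⟨z, this⟩

end Components

section Lift

variable {G : Type*} [Group G] {Z : Type u} [TopologicalSpace Z] [MulAction G Z] {q : Z → E}

lemma exists_lift_map (hq : IsQuotientCoveringMap q G) (j : J) :
    ∃ τ : C(Disk (D.dim j), Z), ∀ x, q (τ x) = D.map j x :=
  (exists_continuousMap_lift hq.isCoveringMap hq.surjective (D.map j)).imp fun _ => congrFun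

/-- The cell decomposition of the total space of a regular covering: the cells over `j` are the
translates of one chosen lift of the characteristic map of `j`. -/
noncomputable def lift (hq : IsQuotientCoveringMap q G) : CellDecomposition Z (J × G) :=
  have := hq.toContinuousConstSMul
  have q_lift := fun j => (D.exists_lift_map hq j).choose_spec
  have q_smul_lift : ∀ (p : J × G) x, q (p.2 • (D.exists_lift_map hq p.1).choose x) = D.map p.1 x :=
    fun p x => (hq.map_smul _).trans (q_lift _ _)
  { dim := fun p => D.dim p.1
    map := fun p => ⟨fun x => p.2 • (D.exists_lift_map hq p.1).choose x, by fun_prop⟩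
    injOn := fun p x y hx hy h => D.injOn p.1 x y hx hy (by
      rw [← q_smul_lift p x, ← q_smul_lift p y]
      exact congrArg q h)
    eq_of_map_eq := by
      rintro ⟨i, g⟩ ⟨j, g'⟩ x y hx hy h
      have map_eq : D.map i x = D.map j y :=
        (q_smul_lift (i, g) x).symm.trans ((congrArg q h).trans (q_smul_lift (j, g') y))
      obtain rfl := D.eq_of_map_eq i j x y hx hy map_eq
      obtain rfl := D.injOn i x y hx hy map_eq
      have := hq.isCancelSMul
      exact Prod.ext rfl (IsCancelSMul.right_cancel _ _ _ h)
    cover := fun z => by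
      obtain ⟨j, x, hx, h⟩ := D.cover (q z)
      rw [← q_lift j x] at h
      obtain ⟨g, hg⟩ := hq.apply_eq_iff_mem_orbit.1 h.symm
      exact ⟨(j, g), x, hx, hg⟩
    frontier := by
      rintro ⟨j, g⟩ x hx
      obtain ⟨i, y, hi, hy, h⟩ := D.frontier j x hx
      rw [← q_lift i y, ← q_smul_lift (j, g) x] at h
      obtain ⟨g', hg'⟩ := hq.apply_eq_iff_mem_orbit.1 h.symm
      exact ⟨(i, g'), y, hi, hy, hg'⟩ }

lemma map_lift (hq : IsQuotientCoveringMap q G) (p : J × G) (x : Disk (D.dim p.1)) :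
    q ((D.lift hq).map p x) = D.map p.1 x :=
  (hq.map_smul _).trans ((D.exists_lift_map hq p.1).choose_spec x)

end Lift

end CellDecomposition

namespace CWSpace

open Topology

/-- The cell decomposition underlying a CW-structure. -/
noncomputable def cellDecomposition (X : CWSpace.{u}) :
    CellDecomposition X (Σ n, X.Cell n) where
  dim e := e.1
  map e := ⟨fun x => RelCWComplex.map (C := (Set.univ : Set X)) e.1 e.2 x.1,
    (RelCWComplex.continuousOn (C := (Set.univ : Set X)) e.1 e.2).domRestrict⟩
  injOn e x y hx hy h := by
    have injOn_ball := (RelCWComplex.map (C := (Set.univ : Set X)) e.1 e.2).injOn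
    rw [RelCWComplex.source_eq (C := (Set.univ : Set X)) e.1 e.2] at injOn_ball
    exact Subtype.ext (injOn_ball (mem_ball_zero_iff.2 hx) (mem_ball_zero_iff.2 hy) h)
  eq_of_map_eq e e' x y hx hy h := by
    by_contra hne
    have := RelCWComplex.disjoint_openCell_of_ne (C := (Set.univ : Set X)) hne
    exact Set.disjoint_left.1 this ⟨x.1, mem_ball_zero_iff.2 hx, rfl⟩
      ⟨y.1, mem_ball_zero_iff.2 hy, h.symm⟩
  cover z := by
    have hz := (CWComplex.iUnion_openCell_eq_complex (C := (Set.univ : Set X))).ge (Set.mem_univ z)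
    simp only [Set.mem_iUnion] at hz
    obtain ⟨n, j, x, hx, rfl⟩ := hz
    exact ⟨⟨n, j⟩, ⟨x, Metric.ball_subset_closedBall hx⟩, mem_ball_zero_iff.1 hx, rfl⟩
  frontier e x hx := by
    obtain ⟨I, hI⟩ :=
      CWComplex.cellFrontier_subset_finite_openCell (C := (Set.univ : Set X)) e.1 e.2
    have := hI ⟨x.1, mem_sphere_zero_iff_norm.2 hx, rfl⟩
    simp only [Set.mem_iUnion] at this
    obtain ⟨m, hm, j, -, y, hy, h⟩ := this
    exact ⟨⟨m, j⟩, ⟨y, Metric.ball_subset_closedBall hy⟩, hm, mem_ball_zero_iff.1 hy, h⟩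

lemma cellDecomposition_openCell (X : CWSpace.{u}) (e : Σ n, X.Cell n) :
    X.cellDecomposition.openCell e = X.openCell e.2 := by
  ext z
  constructor
  · rintro ⟨x, hx, rfl⟩
    exact ⟨x.1, mem_ball_zero_iff.2 hx, rfl⟩
  · rintro ⟨x, hx, rfl⟩
    exact ⟨⟨x, Metric.ball_subset_closedBall hx⟩, mem_ball_zero_iff.1 hx, rfl⟩

lemma IsFinite.finite {X : CWSpace.{u}} (h : X.IsFinite) : Finite (Σ n, X.Cell n) :=
  have : RelCWComplex.Finite (Set.univ : Set X) := h
  RelCWComplex.finite_cells_of_finite (C := (Set.univ : Set X))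

end CWSpace

end CellDecomposition

section Pullback

open Function.Pullback

variable {E B X : Type*} [TopologicalSpace E] [TopologicalSpace B] [TopologicalSpace X] {f : X → B}
  {q : E → B}

lemma isOpenMap_pullback_fst (hf : Continuous f) (hq : IsOpenMap q) :
    IsOpenMap (fst : f.Pullback q → X) := by
  refine IsOpenMap.of_nhds_le fun ⟨⟨x, e⟩, hxe⟩ S hS => ?_
  rw [Filter.mem_map, nhds_subtype_eq_comap, nhds_prod_eq] at hS
  obtain ⟨T, hT, hTS⟩ := hS
  obtain ⟨U, hU, V, hV, hUV⟩ := Filter.mem_prod_iff.1 hT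
  have image_mem_nhds : q '' V ∈ nhds (f x) := by
    rw [show f x = q e from hxe]
    exact hq.image_mem_nhds hV
  filter_upwards [hU, hf.continuousAt.preimage_mem_nhds image_mem_nhds] with y hy ⟨e', he', h⟩
  exact hTS (a := ⟨(y, e'), h.symm⟩) (hUV (a := (y, e')) ⟨hy, he'⟩)

variable {G : Type*} [Group G] [MulAction G E]

lemma exists_isQuotientCoveringMap_pullback_fst (hq : IsQuotientCoveringMap q G)
    (hf : Continuous f) :
    ∃ _ : MulAction G (f.Pullback q), IsQuotientCoveringMap (fst : f.Pullback q → X) G := by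
  have := hq.toContinuousConstSMul
  let action : MulAction G (f.Pullback q) :=
    { smul := fun g p => ⟨(p.fst, g • p.snd), p.2.trans (hq.map_smul g).symm⟩
      one_smul := fun p => Subtype.ext (Prod.ext rfl (one_smul G p.snd))
      mul_smul := fun g h p => Subtype.ext (Prod.ext rfl (mul_smul g h p.snd)) }
  have continuous_fst : Continuous (fst : f.Pullback q → X) := by unfold fst; fun_prop
  have continuous_snd : Continuous (snd : f.Pullback q → E) := by unfold snd; fun_prop
  have fst_surjective : Function.Surjective (fst : f.Pullback q → X) := fun x => by
    obtain ⟨e, he⟩ := hq.surjective (f x)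
    exact ⟨⟨(x, e), he.symm⟩, rfl⟩
  refine ⟨action, ⟨(isOpenMap_pullback_fst hf hq.isOpenQuotientMap.isOpenMap).isQuotientMap
    continuous_fst fst_surjective,
    ⟨fun g => (continuous_fst.prodMk (continuous_snd.const_smul g)).subtype_mk _⟩,
    fun {x y} => ⟨fun h => ?_, ?_⟩, fun p => ?_⟩⟩
  · obtain ⟨g, hg⟩ := hq.apply_eq_iff_mem_orbit.1 (x.2.symm.trans ((congrArg f h).trans y.2))
    exact ⟨g, Subtype.ext (Prod.ext h.symm hg)⟩
  · rintro ⟨g, rfl⟩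
    rfl
  · obtain ⟨U, hU, h⟩ := hq.disjoint p.snd
    refine ⟨snd ⁻¹' U, continuous_snd.continuousAt.preimage_mem_nhds hU, fun g => ?_⟩
    rintro ⟨_, ⟨y, hy, rfl⟩, hy'⟩
    exact h g ⟨g • y.snd, ⟨y.snd, hy, rfl⟩, hy'⟩

end Pullback

section ResiduallyP

lemma isPGroup_quotient_iff {p : ℕ} {G : Type*} [Group G] {N : Subgroup G} [N.Normal] :
    IsPGroup p (G ⧸ N) ↔ ∀ g : G, ∃ k : ℕ, g ^ p ^ k ∈ N := by
  rw [isPGroup_iff_pow_pow_eq_one, (QuotientGroup.mk'_surjective N).forall]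
  exact forall_congr' fun g => exists_congr fun k => QuotientGroup.eq_one_iff (g ^ p ^ k)

lemma isPGroup_quotient_inf {p : ℕ} {G : Type*} [Group G] {M N : Subgroup G} [M.Normal]
    [N.Normal] (hM : IsPGroup p (G ⧸ M)) (hN : IsPGroup p (G ⧸ N)) :
    IsPGroup p (G ⧸ (M ⊓ N)) := by
  rw [isPGroup_quotient_iff] at hM hN ⊢
  intro g
  obtain ⟨k, hk⟩ := hM g
  obtain ⟨l, hl⟩ := hN g
  refine ⟨k + l, ?_, ?_⟩
  · rw [pow_add, pow_mul]
    exact M.pow_mem hk _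
  · rw [pow_add, mul_comm, pow_mul]
    exact N.pow_mem hl _

variable {p : ℕ} {G : Type u} [Group G]

lemma ResiduallyFiniteP.exists_normal_forall_mem_imp_eq_one (hG : ResiduallyFiniteP p G)
    {S : Set G} (hS : S.Finite) : ∃ (N : Subgroup G) (_ : N.Normal), Finite (G ⧸ N) ∧
      IsPGroup p (G ⧸ N) ∧ ∀ g ∈ S, g ∈ N → g = 1 := by
  induction S, hS using Set.Finite.induction_on with
  | empty =>
    have := QuotientGroup.subsingleton_quotient_top (G := G)
    exact ⟨⊤, inferInstance, inferInstance, IsPGroup.of_subsingleton p _, by simp⟩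
  | @insert a S _ _ ih =>
    obtain ⟨N, N_normal, finite_N, hN, hSN⟩ := ih
    rcases eq_or_ne a 1 with rfl | ha
    · exact ⟨N, N_normal, finite_N, hN, fun g hg hgN => hg.elim id fun hg => hSN g hg hgN⟩
    · obtain ⟨M, M_normal, finite_M, hM, haM⟩ := hG a ha
      have := Subgroup.finiteIndex_of_finite_quotient (H := N)
      have := Subgroup.finiteIndex_of_finite_quotient (H := M)
      refine ⟨M ⊓ N, inferInstance, inferInstance, isPGroup_quotient_inf hM hN, ?_⟩
      rintro g (rfl | hg) hgMN
      · exact absurd hgMN.1 haM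
      · exact hSN g hg hgMN.2

lemma isLocallyConstant_of_smul_eq {Z Y : Type*} [TopologicalSpace Z] [MulAction G Z]
    {q : Z → Y} [TopologicalSpace Y] (hq : IsQuotientCoveringMap q G) {K : Type*}
    [TopologicalSpace K] {a b : K → Z} (ha : Continuous a) (hb : Continuous b) {γ : K → G}
    (hγ : ∀ k, γ k • b k = a k) : IsLocallyConstant γ := by
  have := hq.toContinuousConstSMul
  rw [IsLocallyConstant.iff_eventually_eq]
  intro k
  obtain ⟨U, hU, h⟩ := hq.disjoint (a k)
  have near_a : ∀ᶠ l in nhds k, a l ∈ U := ha.continuousAt.preimage_mem_nhds hU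
  have near_b : ∀ᶠ l in nhds k, γ k • b l ∈ U :=
    (hb.const_smul (γ k)).continuousAt.preimage_mem_nhds (by rwa [Pi.smul_apply, hγ])
  filter_upwards [near_a, near_b] with l hal hbl
  refine mul_inv_eq_one.1 (h (γ l * (γ k)⁻¹) ⟨a l, ⟨_, hbl, ?_⟩, hal⟩)
  simp only [mul_smul, inv_smul_smul, hγ]

lemma ResiduallyFiniteP.exists_injective_mk_comp (hG : ResiduallyFiniteP p G) {X Z Y : Type*}
    [TopologicalSpace X] [CompactSpace X] [TopologicalSpace Z] [TopologicalSpace Y] [T2Space Y]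
    [MulAction G Z] {q : Z → Y} (hq : IsQuotientCoveringMap q G) {i : X → Z} (hi : Continuous i)
    (i_injective : Function.Injective i) :
    ∃ (N : Subgroup G) (_ : N.Normal), Finite (G ⧸ N) ∧ IsPGroup p (G ⧸ N) ∧
      Function.Injective fun x => Quotient.mk (MulAction.orbitRel N Z) (i x) := by
  have := hq.isCancelSMul
  let K := {z : X × X // q (i z.1) = q (i z.2)}
  have : CompactSpace K := by
    have isClosed_K : IsClosed {z : X × X | q (i z.1) = q (i z.2)} := isClosed_eq
      ((hq.continuous.comp hi).comp continuous_fst) ((hq.continuous.comp hi).comp continuous_snd)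
    exact isCompact_iff_compactSpace.1 isClosed_K.isCompact
  have exists_smul_eq (z : K) : ∃ g : G, g • i z.1.2 = i z.1.1 :=
    hq.apply_eq_iff_mem_orbit.1 z.2
  choose γ hγ using exists_smul_eq
  have γ_range_finite : (Set.range γ).Finite :=
    (isLocallyConstant_of_smul_eq hq (a := fun z : K => i z.1.1) (by fun_prop) (by fun_prop)
      hγ).range_finite
  obtain ⟨N, N_normal, finite_N, hN, eq_one⟩ :=
    hG.exists_normal_forall_mem_imp_eq_one γ_range_finite
  refine ⟨N, N_normal, finite_N, hN, fun x y hxy => ?_⟩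
  obtain ⟨n, hn⟩ : ∃ n : N, (n : G) • i y = i x := Quotient.exact hxy
  have q_eq : q (i x) = q (i y) := by rw [← hn, hq.map_smul]
  have γ_eq : γ ⟨(x, y), q_eq⟩ = n :=
    IsCancelSMul.right_cancel _ _ (i y) ((hγ ⟨(x, y), q_eq⟩).trans hn.symm)
  rw [eq_one n ⟨_, γ_eq⟩ n.2, one_smul] at hn
  exact (i_injective hn).symm

end ResiduallyP

section Components

variable {F : Type v} [Field F] {X : Type u} [TopologicalSpace X] (n : ℕ)

lemma finite_and_bettiNumber_le_of_isClopen [Module.Finite F (singularHomologyOver.{u, v} F n X)]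
    {U : Set X} (hU : IsClopen U) :
    Module.Finite F (singularHomologyOver.{u, v} F n U) ∧
      bettiNumber.{u, v} F n U ≤ bettiNumber.{u, v} F n X := by
  have : IsEmpty ↥(U ∩ Uᶜ) := Set.isEmpty_coe_sort.2 (Set.inter_compl_self U)
  have : Subsingleton (singularHomologyOver.{u, v} F n ↥(U ∩ Uᶜ)) :=
    subsingleton_homology_of_isEmpty n
  obtain ⟨finite_U, add_le⟩ := finite_and_bettiNumber_add_le (F := F) hU.isOpen hU.compl.isOpen
    (Set.union_compl_self U) n
  exact ⟨finite_U, le_of_add_le_left add_le⟩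

lemma bettiNumber_add_le_of_disjoint {U V : Set X} (hU : IsOpen U) (hV : IsOpen V)
    (hUV : Disjoint U V) [Module.Finite F (singularHomologyOver.{u, v} F n ↥(U ∪ V))] :
    bettiNumber.{u, v} F n U + bettiNumber.{u, v} F n V ≤ bettiNumber.{u, v} F n ↥(U ∪ V) := by
  let U' : Set ↥(U ∪ V) := {z | z.1 ∈ U}
  let V' : Set ↥(U ∪ V) := {z | z.1 ∈ V}
  have : IsEmpty ↥(U' ∩ V') := ⟨fun z => Set.disjoint_left.1 hUV z.2.1 z.2.2⟩
  have : Subsingleton (singularHomologyOver.{u, v} F n ↥(U' ∩ V')) :=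
    subsingleton_homology_of_isEmpty n
  rw [← bettiNumber_eq_of_homotopyEquiv F
      (homeomorphSubsetOfSubset (Set.subset_union_left (s := U) (t := V))).toHomotopyEquiv,
    ← bettiNumber_eq_of_homotopyEquiv F
      (homeomorphSubsetOfSubset (Set.subset_union_right (s := U) (t := V))).toHomotopyEquiv]
  exact (finite_and_bettiNumber_add_le (F := F) (U := U') (V := V')
    (hU.preimage continuous_subtype_val) (hV.preimage continuous_subtype_val)
    (Set.eq_univ_of_forall fun z => z.2) n).2

lemma sum_bettiNumber_le_of_disjoint {ι : Type*} {U : ι → Set X} (hU : ∀ i, IsClopen (U i))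
    {s : Finset ι} (hs : (s : Set ι).PairwiseDisjoint U)
    [Module.Finite F (singularHomologyOver.{u, v} F n X)] :
    ∑ i ∈ s, bettiNumber.{u, v} F n (U i) ≤ bettiNumber.{u, v} F n X := by
  classical
  have isClopen_biUnion (t : Finset ι) : IsClopen (⋃ i ∈ t, U i) :=
    t.finite_toSet.isClopen_biUnion fun i _ => hU i
  suffices ∑ i ∈ s, bettiNumber.{u, v} F n (U i) ≤ bettiNumber.{u, v} F n ↥(⋃ i ∈ s, U i) from
    this.trans (finite_and_bettiNumber_le_of_isClopen n (isClopen_biUnion s)).2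
  induction s using Finset.induction_on with
  | empty => simp only [Finset.sum_empty, zero_le]
  | insert a s ha ih =>
    rw [Finset.coe_insert, Set.pairwiseDisjoint_insert_of_notMem (Finset.mem_coe.not.2 ha)] at hs
    have finite_union := (finite_and_bettiNumber_le_of_isClopen (F := F) n
      ((hU a).union (isClopen_biUnion s))).1
    rw [Finset.sum_insert ha, Finset.set_biUnion_insert]
    exact (Nat.add_le_add_left (ih hs.1) _).trans (bettiNumber_add_le_of_disjoint n (hU a).isOpen
      (isClopen_biUnion s).isOpen (Set.disjoint_iUnion₂_right.2 hs.2))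

section Block

open Pointwise MulAction

variable {G : Type w} [Group G] {E : Type u} [TopologicalSpace E] [MulAction G E]

lemma smul_pathComponent [ContinuousConstSMul G E] (g : G) (z : E) :
    g • pathComponent z = pathComponent (g • z) := by
  have smul_subset (g : G) (z : E) : g • pathComponent z ⊆ pathComponent (g • z) := by
    rintro _ ⟨x, hx, rfl⟩
    exact (hx : Joined z x).map (continuous_const_smul g)
  refine (smul_subset g z).antisymm (Set.subset_smul_set_iff.2 ?_)
  simpa only [inv_smul_smul] using smul_subset g⁻¹ (g • z)

lemma isBlock_pathComponent [ContinuousConstSMul G E] (z : E) : IsBlock G (pathComponent z) := by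
  refine isBlock_iff_smul_eq_or_disjoint.2 fun g => ?_
  rw [smul_pathComponent, or_iff_not_imp_right, Set.not_disjoint_iff]
  rintro ⟨x, hx, hx'⟩
  rw [← pathComponent_congr hx, pathComponent_congr hx']

lemma isQuotientCoveringMap_domRestrict_of_isBlock {q : E → X} (hq : IsQuotientCoveringMap q G)
    {C : Set E} (hC : IsBlock G C) (C_open : IsOpen C) (q_surjOn : C.SurjOn q Set.univ) :
    IsQuotientCoveringMap (C.domRestrict q) (stabilizer G C) where
  toIsQuotientMap := (hq.isOpenQuotientMap.isOpenMap.domRestrict C_open).isQuotientMap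
    (hq.continuous.comp continuous_subtype_val) (Set.surjOn_iff_surjective.1 q_surjOn)
  continuous_const_smul g :=
    ((hq.continuous_const_smul (g : G)).comp continuous_subtype_val).subtype_mk _
  apply_eq_iff_mem_orbit {x y} := by
    refine ⟨fun h => ?_, ?_⟩
    · obtain ⟨g, hg⟩ := hq.apply_eq_iff_mem_orbit.1 h
      have g_mem : g ∈ stabilizer G C := isBlock_iff_smul_eq_of_mem.1 hC y.2 (by simp_all)
      exact ⟨⟨g, g_mem⟩, Subtype.ext hg⟩
    · rintro ⟨g, rfl⟩
      exact hq.map_smul (g : G)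
  disjoint x := by
    obtain ⟨U, hU, h⟩ := hq.disjoint x.1
    refine ⟨Subtype.val ⁻¹' U, continuous_subtype_val.continuousAt.preimage_mem_nhds hU,
      fun g => ?_⟩
    rintro ⟨_, ⟨y, hy, rfl⟩, hy'⟩
    exact Subtype.ext (h g ⟨(g : G) • y.1, ⟨y.1, hy, rfl⟩, hy'⟩)

lemma index_stabilizer_mul_bettiNumber_le [Finite G] [ContinuousConstSMul G E] {C : Set E}
    (hC : IsBlock G C) (C_clopen : IsClopen C)
    [Module.Finite F (singularHomologyOver.{u, v} F n E)] :
    (stabilizer G C).index * bettiNumber.{u, v} F n C ≤ bettiNumber.{u, v} F n E := by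
  have bettiNumber_eq (U : orbit G C) : bettiNumber.{u, v} F n U.1 = bettiNumber.{u, v} F n C := by
    obtain ⟨_, g, rfl⟩ := U
    exact (bettiNumber_eq_of_homotopyEquiv F
      ((Homeomorph.smul g).image C).toHomotopyEquiv n).symm
  have isClopen_orbit (U : orbit G C) : IsClopen U.1 := by
    obtain ⟨_, g, rfl⟩ := U
    exact ⟨C_clopen.1.smul g, C_clopen.2.smul g⟩
  have orbit_disjoint : Set.univ.PairwiseDisjoint fun U : orbit G C => U.1 := by
    rintro ⟨_, g, rfl⟩ - ⟨_, h, rfl⟩ - hgh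
    exact hC fun h => hgh (Subtype.ext h)
  have := (Finite.finite_mulAction_orbit (M := G) C).fintype
  have sum_le := sum_bettiNumber_le_of_disjoint (F := F) n isClopen_orbit (s := Finset.univ)
    (by rwa [Finset.coe_univ])
  simp only [bettiNumber_eq, Finset.sum_const, smul_eq_mul, Finset.card_univ] at sum_le
  rwa [index_stabilizer, ← Nat.card_coe_set_eq, Nat.card_eq_fintype_card]

lemma surjOn_of_isClopen [T2Space X] [ConnectedSpace X] [CompactSpace E] {q : E → X}
    (hq : Continuous q) (q_open : IsOpenMap q) {C : Set E} (C_clopen : IsClopen C)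
    (hC : C.Nonempty) : C.SurjOn q Set.univ := by
  have image_clopen : IsClopen (q '' C) :=
    ⟨(C_clopen.1.isCompact.image hq).isClosed, q_open C C_clopen.2⟩
  exact (image_clopen.eq_univ (hC.image q)).ge

end Block

end Components

section Towers

namespace CellDecomposition

section OpenCell

variable {E : Type*} [TopologicalSpace E] {J : Type*} (D : CellDecomposition E J) (j : J)

instance preconnectedSpace_openCell : PreconnectedSpace (D.openCell j) := by
  have isPreconnected_openDisk : IsPreconnected {x : Disk (D.dim j) | ‖x.1‖ < 1} := by
    rw [← Topology.IsInducing.subtypeVal.isPreconnected_image]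
    convert (convex_ball (0 : Fin (D.dim j) → ℝ) 1).isPreconnected
    ext x
    simpa [Disk] using le_of_lt
  exact isPreconnected_iff_preconnectedSpace.1
    (isPreconnected_openDisk.image _ (D.map j).continuous.continuousOn)

lemma map_mem_openCell_iff_norm_lt {x : Disk (D.dim j)} : D.map j x ∈ D.openCell j ↔ ‖x.1‖ < 1 := by
  refine ⟨fun ⟨y, hy, h⟩ => (Disk.norm_le x).lt_of_ne fun hx => ?_, fun hx => ⟨x, hx, rfl⟩⟩
  obtain ⟨i, w, hi, hw, hwx⟩ := D.frontier j x hx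
  obtain rfl := D.eq_of_map_eq i j w y hw hy (hwx.trans h.symm)
  exact lt_irrefl _ hi

lemma exists_homeomorph_openCell [T2Space E] :
    ∃ κ : D.openCell j ≃ₜ {x : Disk (D.dim j) // ‖x.1‖ < 1}, ∀ z, D.map j (κ z).1 = z.1 := by
  let f := (D.openCell j).restrictPreimage (D.map j)
  have f_closed : IsClosedMap f := (D.map j).continuous.isClosedMap.restrictPreimage _
  have f_bijective : Function.Bijective f := by
    refine ⟨fun x y h => Subtype.ext (D.injOn j _ _ ((D.map_mem_openCell_iff_norm_lt j).1 x.2)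
      ((D.map_mem_openCell_iff_norm_lt j).1 y.2) (congrArg Subtype.val h)), ?_⟩
    rintro ⟨_, x, hx, rfl⟩
    exact ⟨⟨x, x, hx, rfl⟩, rfl⟩
  let e := (Equiv.ofBijective f f_bijective).toHomeomorphOfContinuousClosed
    (D.map j).continuous.restrictPreimage f_closed
  exact ⟨e.symm.trans ((Homeomorph.refl _).subtype fun _ => D.map_mem_openCell_iff_norm_lt j),
    fun z => congrArg Subtype.val (e.apply_symm_apply z)⟩

end OpenCell

-- The lift `Ψ` and the map `i`, read through the chart of the cell, are two lifts of the same
-- connected open cell of `Y`: they agree as soon as they agree at a point.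
lemma mem_range_of_mem_range {X Y Z I J : Type*} [TopologicalSpace X] [TopologicalSpace Y]
    [TopologicalSpace Z] [T2Space Y] (DX : CellDecomposition X I) (DY : CellDecomposition Y J)
    {q : Z → Y} (hq : IsCoveringMap q) {i : X → Z} (hi : Continuous i)
    (hcells : ∀ c, ∃ c', (q ∘ i) '' DX.openCell c = DY.openCell c') {k : J}
    {Ψ : Disk (DY.dim k) → Z} (Ψ_continuous : Continuous Ψ) (hΨ : ∀ x, q (Ψ x) = DY.map k x)
    {x y} (hx : ‖x.1‖ < 1) (hy : ‖y.1‖ < 1) (h : Ψ x ∈ Set.range i) : Ψ y ∈ Set.range i := by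
  obtain ⟨a, ha⟩ := h
  obtain ⟨c, y₀, hy₀, rfl⟩ := DX.cover a
  let a : DX.openCell c := ⟨DX.map c y₀, y₀, hy₀, rfl⟩
  have hqa : q (i a) = DY.map k x := (congrArg q ha).trans (hΨ x)
  have image_openCell : (q ∘ i) '' DX.openCell c = DY.openCell k := by
    obtain ⟨k', hk'⟩ := hcells c
    have : DY.map k x ∈ DY.openCell k' := hk' ▸ hqa ▸ ⟨a, a.2, rfl⟩
    rwa [(DY.map_mem_openCell_iff hx).1 this]
  obtain ⟨κ, hκ⟩ := DY.exists_homeomorph_openCell k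
  let φ (z : DX.openCell c) : Disk (DY.dim k) :=
    (κ ⟨q (i z), image_openCell ▸ ⟨z, z.2, rfl⟩⟩).1
  have φ_continuous : Continuous φ := continuous_subtype_val.comp (κ.continuous.comp
    ((hq.continuous.comp (hi.comp continuous_subtype_val)).subtype_mk _))
  have map_φ (z) : DY.map k (φ z) = q (i z) := hκ _
  have φ_eq {z w} (hw : ‖w.1‖ < 1) (h : q (i z.1) = DY.map k w) : φ z = w :=
    DY.injOn k _ _ (κ _).2 hw ((map_φ z).trans h)
  have lifts_eq : (fun z : DX.openCell c => i z) = Ψ ∘ φ := by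
    refine hq.eq_of_comp_eq (hi.comp continuous_subtype_val) (Ψ_continuous.comp φ_continuous)
      (funext fun z => ?_) a ?_
    · exact (map_φ z).symm.trans (hΨ _).symm
    · exact ha.trans (congrArg Ψ (φ_eq hx hqa)).symm
  obtain ⟨w, hw, hwy⟩ : DY.map k y ∈ (q ∘ i) '' DX.openCell c := image_openCell ▸ ⟨y, hy, rfl⟩
  exact ⟨w, (congrFun lifts_eq ⟨w, hw⟩).trans (congrArg Ψ (φ_eq hy hwy))⟩

end CellDecomposition

section PullbackEmbedding

open Function.Pullback

variable {X Y W E : Type*}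

/-- The map `X ×_Y E → E ×_Y W` induced by a map `i : X → W` of spaces over `Y`. -/
def pullbackSwap (i : X → W) (q : W → Y) (r : E → Y) (z : (q ∘ i).Pullback r) : r.Pullback q :=
  ⟨(z.snd, i z.fst), z.2.symm⟩

lemma pullbackSwap_injective {i : X → W} (hi : Function.Injective i) (q : W → Y) (r : E → Y) :
    Function.Injective (pullbackSwap i q r) := fun _ _ h =>
  Subtype.ext (Prod.ext (hi (congrArg snd h)) (congrArg fst h))

lemma continuous_pullbackSwap [TopologicalSpace X] [TopologicalSpace W] [TopologicalSpace E]
    {i : X → W} (hi : Continuous i) (q : W → Y) (r : E → Y) : Continuous (pullbackSwap i q r) :=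
  ((continuous_snd.comp continuous_subtype_val).prodMk
    (hi.comp (continuous_fst.comp continuous_subtype_val))).subtype_mk _

lemma mem_range_pullbackSwap_iff {i : X → W} {q : W → Y} {r : E → Y} {z : r.Pullback q} :
    z ∈ Set.range (pullbackSwap i q r) ↔ z.snd ∈ Set.range i := by
  constructor
  · rintro ⟨w, rfl⟩
    exact ⟨w.fst, rfl⟩
  · rintro ⟨a, ha⟩
    exact ⟨⟨(a, z.fst), (congrArg q ha).trans z.2.symm⟩, Subtype.ext (Prod.ext rfl ha)⟩

end PullbackEmbedding

lemma bettiNumber_pullback_le {X Y W E : Type u} [TopologicalSpace X] [TopologicalSpace Y]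
    [TopologicalSpace W] [TopologicalSpace E] [T2Space Y] {I J : Type*} [Finite I] [Finite J]
    (DX : CellDecomposition X I) (DY : CellDecomposition Y J) {d : ℕ} (hd : ∀ j, DY.dim j ≤ d)
    {F : Type v} [Field F] {p : ℕ} [Fact p.Prime] [CharP F p]
    {Q : Type w} [Group Q] [MulAction Q W] {q : W → Y} (hq : IsQuotientCoveringMap q Q) {k : ℕ}
    (hQ : Nat.card Q = p ^ k) {i : X → W} (hi : Continuous i) (i_injective : Function.Injective i)
    (hcells : ∀ c, ∃ c', (q ∘ i) '' DX.openCell c = DY.openCell c')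
    {H : Type*} [Group H] [Finite H] [MulAction H E] {r : E → Y} (hr : IsQuotientCoveringMap r H) :
    bettiNumber.{u, v} F d ((q ∘ i).Pullback r) ≤ p ^ k * bettiNumber.{u, v} F d E := by
  have : Finite Q := Nat.finite_of_card_ne_zero (hQ ▸ pow_ne_zero _ (Fact.out : p.Prime).ne_zero)
  obtain ⟨_, hX⟩ := exists_isQuotientCoveringMap_pullback_fst hr (hq.continuous.comp hi)
  obtain ⟨_, hE⟩ := exists_isQuotientCoveringMap_pullback_fst hq hr.continuous
  have : CompactSpace ((q ∘ i).Pullback r) := (DX.lift hX).compactSpace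
  have : T2Space E := t2Space_of_isSeparatedMap hr.isCoveringMap.isSeparatedMap hr.continuous
  have : T2Space (r.Pullback q) :=
    t2Space_of_isSeparatedMap hE.isCoveringMap.isSeparatedMap hE.continuous
  have := Fintype.ofFinite (J × H)
  have : Module.Finite F (singularHomologyOver.{u, v} F d E) :=
    ((DY.lift hr).hasSingularEulerChar (F := F) fun j => Nat.succ_le_succ (hd j.1)).finite d
  have embedding :=
    (continuous_pullbackSwap hi q r).isClosedEmbedding (pullbackSwap_injective i_injective q r)
  let D := (DY.lift hr).lift hE
  have map_mem_range {c x y} (hx : ‖x.1‖ < 1) (hy : ‖y.1‖ < 1)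
      (h : D.map c x ∈ Set.range (pullbackSwap i q r)) :
      D.map c y ∈ Set.range (pullbackSwap i q r) := by
    rw [mem_range_pullbackSwap_iff] at h ⊢
    refine DX.mem_range_of_mem_range DY hq.isCoveringMap hi hcells (k := c.1.1)
      (Ψ := fun x => (D.map c x).snd)
      (continuous_snd.comp (continuous_subtype_val.comp (D.map c).continuous)) (fun x => ?_) hx hy h
    exact (D.map c x).2.symm.trans
      ((congrArg r ((DY.lift hr).map_lift hE c x)).trans (DY.map_lift hr c.1 x))
  rw [bettiNumber_eq_of_homotopyEquiv F embedding.isEmbedding.toHomeomorph.toHomotopyEquiv]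
  exact (D.bettiNumber_le_of_isClosed (fun c => hd c.1.1) embedding.isClosed_range
    fun _ _ _ => map_mem_range).trans (bettiNumber_le_of_card_eq_prime_pow F hE p hQ d).2

/-- `Y` has regular coverings whose groups are finite `p`-groups and whose normalized `d`-th Betti
numbers are arbitrarily small. In contrast to `betaInfP`, the total space need not be connected,
so that such coverings can be pulled back. -/
def HasSmallCoverings (p : ℕ) (F : Type v) [Field F] (d : ℕ) (Y : Type u) [TopologicalSpace Y] :
    Prop :=
  ∀ ε : ℝ, 0 < ε → ∃ (E : Type u) (_ : TopologicalSpace E) (G : Type u) (_ : Group G)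
    (_ : MulAction G E) (q : E → Y) (m : ℕ), IsQuotientCoveringMap q G ∧ Nat.card G = p ^ m ∧
      (bettiNumber.{u, v} F d E : ℝ) / Nat.card G ≤ ε

lemma HasSmallCoverings.of_residuallyFiniteP {F : Type v} [Field F] {p : ℕ} [Fact p.Prime]
    [CharP F p] {d : ℕ} {X Y Z I J G : Type u} [TopologicalSpace X] [TopologicalSpace Y]
    [TopologicalSpace Z] [T2Space Y] [Group G] [MulAction G Z] [Finite I] [Finite J]
    (DX : CellDecomposition X I) (DY : CellDecomposition Y J) (hd : ∀ j, DY.dim j ≤ d) {q : Z → Y}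
    (hq : IsQuotientCoveringMap q G) (hG : ResiduallyFiniteP p G) {i : X → Z} (hi : Continuous i)
    (i_injective : Function.Injective i)
    (hcells : ∀ c, ∃ c', (q ∘ i) '' DX.openCell c = DY.openCell c')
    (hY : HasSmallCoverings.{u, v} p F d Y) : HasSmallCoverings.{u, v} p F d X := by
  have : CompactSpace X := DX.compactSpace
  obtain ⟨N, _, _, isPGroup, iN_injective⟩ := hG.exists_injective_mk_comp hq hi i_injective
  have p_prime : p.Prime := Fact.out
  obtain ⟨k, hk⟩ := (IsPGroup.iff_card (p := p)).1 isPGroup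
  let qN : MulAction.orbitRel.Quotient N Z → Y := Quotient.lift q fun _ _ h => by
    obtain ⟨n, rfl⟩ := h
    exact hq.map_smul (n : G)
  have hqN : IsQuotientCoveringMap qN (G ⧸ N) :=
    isQuotientCoveringMap_of_comp_orbitQuotient_mk hq N fun _ => rfl
  have pow_pos : (0 : ℝ) < p ^ k := pow_pos (Nat.cast_pos.2 p_prime.pos) k
  intro ε hε
  obtain ⟨E, _, H, _, _, r, m, hr, hH, hE⟩ := hY (ε / p ^ k) (div_pos hε pow_pos)
  have : Finite H := Nat.finite_of_card_ne_zero (hH ▸ pow_ne_zero _ p_prime.ne_zero)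
  obtain ⟨_, hX⟩ := exists_isQuotientCoveringMap_pullback_fst hr (hq.continuous.comp hi)
  refine ⟨_, inferInstance, H, inferInstance, inferInstance, _, m, hX, hH, ?_⟩
  have betti_le : (bettiNumber.{u, v} F d ((q ∘ i).Pullback r) : ℝ) ≤
      p ^ k * bettiNumber.{u, v} F d E := by
    exact_mod_cast bettiNumber_pullback_le DX DY hd hqN hk (continuous_quot_mk.comp hi)
      iN_injective hcells hr
  calc (bettiNumber.{u, v} F d ((q ∘ i).Pullback r) : ℝ) / Nat.card H
    _ ≤ p ^ k * bettiNumber.{u, v} F d E / Nat.card H := by gcongr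
    _ = p ^ k * (bettiNumber.{u, v} F d E / Nat.card H) := mul_div_assoc _ _ _
    _ ≤ p ^ k * (ε / p ^ k) := by gcongr
    _ = ε := mul_div_cancel₀ ε pow_pos.ne'

end Towers

section BetaInf

variable {p : ℕ} {F : Type v} [Field F] {d : ℕ}

lemma exists_isQuotientCoveringMap_id (Y : Type u) [TopologicalSpace Y] :
    ∃ _ : MulAction PUnit.{w + 1} Y, IsQuotientCoveringMap (id : Y → Y) PUnit.{w + 1} := by
  let _ : MulAction PUnit.{w + 1} Y :=
    { smul := fun _ y => y
      one_smul := fun _ => rfl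
      mul_smul := fun _ _ _ => rfl }
  exact ⟨inferInstance,
    { toIsQuotientMap := .id
      continuous_const_smul := fun _ => continuous_id
      apply_eq_iff_mem_orbit := ⟨fun h => ⟨PUnit.unit, h.symm⟩, fun ⟨_, h⟩ => h.symm⟩
      disjoint := fun _ => ⟨Set.univ, Filter.univ_mem, fun _ _ => rfl⟩ }⟩

lemma exists_connectedSpace_covering_of_betaInfP_lt {Y : Type u} [TopologicalSpace Y]
    [ConnectedSpace Y] {ε : ℝ} (h : betaInfP.{u, v} p F d Y < ε) :
    ∃ (E : Type u) (_ : TopologicalSpace E) (_ : ConnectedSpace E) (G : Type u) (_ : Group G)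
      (_ : MulAction G E) (q : E → Y) (m : ℕ), IsQuotientCoveringMap q G ∧ Nat.card G = p ^ m ∧
        (bettiNumber.{u, v} F d E : ℝ) / Nat.card G < ε := by
  obtain ⟨_, isQuotientCoveringMap_id⟩ := exists_isQuotientCoveringMap_id.{u, u} Y
  obtain ⟨_, ⟨E, _, _, G, _, _, q, m, hq, hG, rfl⟩, hE⟩ := exists_lt_of_csInf_lt
    (by exact ⟨_, Y, _, inferInstance, PUnit.{u + 1}, _, _, id, 0, isQuotientCoveringMap_id,
      by simp, rfl⟩) h
  exact ⟨E, _, inferInstance, G, _, _, q, m, hq, hG, hE⟩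

lemma HasSmallCoverings.of_betaInfP_eq_zero {Y : Type u} [TopologicalSpace Y] [ConnectedSpace Y]
    (h : betaInfP.{u, v} p F d Y = 0) : HasSmallCoverings.{u, v} p F d Y := fun ε hε => by
  obtain ⟨E, _, _, G, _, _, q, m, hq, hG, hE⟩ :=
    exists_connectedSpace_covering_of_betaInfP_lt (h.trans_lt hε)
  exact ⟨E, _, G, _, _, q, m, hq, hG, hE.le⟩

lemma betaInfP_nonneg (Y : Type u) [TopologicalSpace Y] : 0 ≤ betaInfP.{u, v} p F d Y := by
  refine Real.sInf_nonneg ?_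
  rintro _ ⟨E, _, _, G, _, _, _, _, -, -, rfl⟩
  positivity

lemma betaInfP_le {X E G : Type u} [TopologicalSpace X] [TopologicalSpace E] [ConnectedSpace E]
    [Group G] [MulAction G E] {q : E → X} (hq : IsQuotientCoveringMap q G) {m : ℕ}
    (hG : Nat.card G = p ^ m) :
    betaInfP.{u, v} p F d X ≤ (bettiNumber.{u, v} F d E : ℝ) / Nat.card G := by
  refine csInf_le ⟨0, ?_⟩ ⟨E, _, inferInstance, G, _, _, q, m, hq, hG, rfl⟩
  rintro _ ⟨E, _, _, G, _, _, _, _, -, -, rfl⟩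
  positivity

open MulAction Pointwise in
lemma CellDecomposition.exists_connectedSpace_covering_bettiNumber_div_le {X E : Type u}
    [TopologicalSpace X] [T2Space X] [ConnectedSpace X] {I : Type*} [Finite I]
    (D : CellDecomposition X I) (hd : ∀ j, D.dim j ≤ d) [TopologicalSpace E] {G : Type w}
    [Group G] [Finite G] [MulAction G E] {q : E → X} (hq : IsQuotientCoveringMap q G) :
    ∃ C : Set E, ConnectedSpace C ∧ IsQuotientCoveringMap (C.domRestrict q) (stabilizer G C) ∧
      (bettiNumber.{u, v} F d C : ℝ) / Nat.card (stabilizer G C) ≤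
        bettiNumber.{u, v} F d E / Nat.card G := by
  have := Fintype.ofFinite (I × G)
  have : T2Space E := t2Space_of_isSeparatedMap hq.isCoveringMap.isSeparatedMap hq.continuous
  have : CompactSpace E := (D.lift hq).compactSpace
  have : ContinuousConstSMul G E := hq.toContinuousConstSMul
  have : Module.Finite F (singularHomologyOver.{u, v} F d E) :=
    ((D.lift hq).hasSingularEulerChar (F := F) fun j => Nat.succ_le_succ (hd j.1)).finite d
  obtain ⟨z, -⟩ := hq.surjective (Classical.arbitrary X)
  let C := pathComponent z
  have C_block : IsBlock G C := isBlock_pathComponent z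
  have C_clopen : IsClopen C := (D.lift hq).isClopen_pathComponent z
  have q_surjOn : C.SurjOn q Set.univ :=
    surjOn_of_isClopen hq.continuous hq.isOpenQuotientMap.isOpenMap C_clopen ⟨z, .refl z⟩
  refine ⟨C, isConnected_iff_connectedSpace.1 isPathConnected_pathComponent.isConnected,
    isQuotientCoveringMap_domRestrict_of_isBlock hq C_block C_clopen.isOpen q_surjOn, ?_⟩
  have card_pos : (0 : ℝ) < Nat.card (stabilizer G C) := Nat.cast_pos.2 Nat.card_pos
  have index_pos : (0 : ℝ) < (stabilizer G C).index :=
    Nat.cast_pos.2 (Nat.pos_of_ne_zero (stabilizer G C).index_ne_zero_of_finite)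
  rw [← (stabilizer G C).index_mul_card, Nat.cast_mul,
    div_le_div_iff₀ card_pos (mul_pos index_pos card_pos), ← mul_assoc,
    mul_comm (bettiNumber F d C : ℝ)]
  exact mul_le_mul_of_nonneg_right
    (mod_cast index_stabilizer_mul_bettiNumber_le d C_block C_clopen) card_pos.le

open scoped Pointwise in
lemma HasSmallCoverings.betaInfP_eq_zero [Fact p.Prime] {X : Type u} [TopologicalSpace X]
    [T2Space X] [ConnectedSpace X] {I : Type*} [Finite I] (D : CellDecomposition X I)
    (hd : ∀ j, D.dim j ≤ d) (h : HasSmallCoverings.{u, v} p F d X) :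
    betaInfP.{u, v} p F d X = 0 := by
  refine le_antisymm (le_of_forall_pos_le_add fun ε hε => ?_) (betaInfP_nonneg X)
  obtain ⟨E, _, G, _, _, q, m, hq, hG, hE⟩ := h ε hε
  have : Finite G :=
    Nat.finite_of_card_ne_zero (hG ▸ pow_ne_zero _ (Fact.out : p.Prime).ne_zero)
  obtain ⟨C, _, hC, betti_le⟩ :=
    D.exists_connectedSpace_covering_bettiNumber_div_le (F := F) hd hq
  obtain ⟨k, hk⟩ :=
    IsPGroup.iff_card.1 ((IsPGroup.of_card hG).to_subgroup (MulAction.stabilizer G C))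
  rw [zero_add]
  exact (betaInfP_le hC hk).trans (betti_le.trans hE)

end BetaInf

namespace CWSpace

section Tower

variable {d : ℕ}

lemma IsElementaryTower.isEmpty_cell {𝓕 : (G : Type u) → [Group G] → Prop} {X Y : CWSpace.{u}}
    {f : X → Y} (h : IsElementaryTower 𝓕 X Y f) (n : ℕ) (hY : IsEmpty (Y.Cell n)) :
    IsEmpty (X.Cell n) := by
  obtain ⟨-, Z, G, _, _, i, q, -, hi, hq, -⟩ := h
  refine ⟨fun c => ?_⟩
  obtain ⟨c', -⟩ := hi.mapsCells n c
  obtain ⟨c'', -⟩ := hq.mapsCells n c'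
  exact hY.false c''

lemma cellDecomposition_dim_le {X : CWSpace.{u}} (hX : ∀ n, d < n → IsEmpty (X.Cell n))
    (c : Σ n, X.Cell n) : X.cellDecomposition.dim c ≤ d :=
  not_lt.1 fun h => (hX c.1 h).false c.2

variable {p : ℕ} [Fact p.Prime] {F : Type v} [Field F] [CharP F p]

lemma IsElementaryTower.hasSmallCoverings {X Y : CWSpace.{u}} {f : X → Y}
    (h : IsElementaryTower (fun G _ => ResiduallyFiniteP p G) X Y f)
    (hYfin : Y.IsFinite) (hYdim : ∀ n, d < n → IsEmpty (Y.Cell n))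
    (hY : HasSmallCoverings.{u, v} p F d Y) : HasSmallCoverings.{u, v} p F d X := by
  obtain ⟨hXfin, Z, G, _, _, i, q, hG, hi, hq, -⟩ := h
  have := hXfin.finite
  have := hYfin.finite
  refine .of_residuallyFiniteP X.cellDecomposition Y.cellDecomposition
    (cellDecomposition_dim_le hYdim) hq.isQuotientCoveringMap hG hi.isClosedEmbedding.continuous
    hi.isClosedEmbedding.injective (fun ⟨n, c⟩ => ?_) hY
  obtain ⟨c', hc'⟩ := hi.mapsCells n c
  obtain ⟨c'', hc''⟩ := hq.mapsCells n c'
  refine ⟨⟨n, c''⟩, ?_⟩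
  rw [cellDecomposition_openCell, cellDecomposition_openCell, Set.image_comp, hc'.image_eq,
    hc''.image_eq]

lemma IsTower.hasSmallCoverings {Y : CWSpace.{u}} (hYfin : Y.IsFinite)
    (hYdim : ∀ n, d < n → IsEmpty (Y.Cell n)) (hY : HasSmallCoverings.{u, v} p F d Y)
    {X : CWSpace.{u}} {f : X → Y} (h : IsTower (fun G _ => ResiduallyFiniteP p G) Y X f) :
    X.IsFinite ∧ (∀ n, d < n → IsEmpty (X.Cell n)) ∧ HasSmallCoverings.{u, v} p F d X := by
  induction h with
  | elementary X f hf =>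
    exact ⟨hf.1, fun n hn => hf.isEmpty_cell n (hYdim n hn), hf.hasSmallCoverings hYfin hYdim hY⟩
  | step X Y' f _ _ hf ih =>
    obtain ⟨Y'_finite, Y'_dim, hY'⟩ := ih
    exact ⟨hf.1, fun n hn => hf.isEmpty_cell n (Y'_dim n hn),
      hf.hasSmallCoverings Y'_finite Y'_dim hY'⟩

end Tower

section EulerCharacteristic

lemma sum_neg_one_pow_dim_cellDecomposition (X : CWSpace.{u}) [Fintype (Σ n, X.Cell n)] :
    ∑ c, (-1 : ℤ) ^ X.cellDecomposition.dim c = X.eulerCharacteristic := by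
  classical
  have card_fiber (n : ℕ) : Finset.card {c : Σ n, X.Cell n | c.1 = n} = Nat.card (X.Cell n) := by
    rw [← Nat.card_congr (Equiv.sigmaSubtype (β := X.Cell) n), Nat.card_eq_fintype_card,
      Fintype.card_subtype]
  rw [eulerCharacteristic, finsum_eq_sum_of_support_subset
    (s := Finset.univ.image (Sigma.fst : (Σ n, X.Cell n) → ℕ)),
    ← Finset.sum_fiberwise_of_maps_to fun c _ => Finset.mem_image_of_mem Sigma.fst
      (Finset.mem_univ c)]
  · refine Finset.sum_congr rfl fun n _ => ?_
    have dim_eq : ∀ c ∈ ({c | c.1 = n} : Finset (Σ n, X.Cell n)),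
        (-1 : ℤ) ^ X.cellDecomposition.dim c = (-1) ^ n := fun c hc =>
      congrArg _ (Finset.mem_filter.1 hc).2
    rw [Finset.sum_congr rfl dim_eq, Finset.sum_const, card_fiber, nsmul_eq_mul, mul_comm]
  · intro n hn
    rw [Finset.coe_image, Finset.coe_univ, Set.image_univ]
    by_contra h
    have : IsEmpty (X.Cell n) := ⟨fun c => h ⟨⟨n, c⟩, rfl⟩⟩
    simp at hn

variable {F : Type v} [Field F] {X : CWSpace.{u}} {E : Type u} [TopologicalSpace E]
  [ConnectedSpace E] {G : Type*} [Group G] [Finite G] [MulAction G E] {q : E → X}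

lemma one_sub_bettiNumber_one_add_bettiNumber_two (hXfin : X.IsFinite)
    (hXdim : ∀ n, 2 < n → IsEmpty (X.Cell n)) (hq : IsQuotientCoveringMap q G) :
    1 - (bettiNumber.{u, v} F 1 E : ℤ) + bettiNumber.{u, v} F 2 E =
      Nat.card G * X.eulerCharacteristic := by
  have := hXfin.finite
  have := Fintype.ofFinite (Σ n, X.Cell n)
  have := Fintype.ofFinite G
  have : T2Space E := t2Space_of_isSeparatedMap hq.isCoveringMap.isSeparatedMap hq.continuous
  let D := X.cellDecomposition.lift hq
  have : PathConnectedSpace E := D.pathConnectedSpace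
  have bettiNumber_zero : bettiNumber.{u, v} F 0 E = 1 := by
    rw [bettiNumber, (nonempty_homology_zero_equiv (F := F) (X := E)).some.finrank_eq,
      Module.finrank_self]
  have euler_eq := (D.hasSingularEulerChar (F := F) fun c =>
    Nat.succ_le_succ (cellDecomposition_dim_le hXdim c.1)).sum_eq
  calc 1 - (bettiNumber.{u, v} F 1 E : ℤ) + bettiNumber.{u, v} F 2 E
    _ = ∑ n ∈ Finset.range 3, (-1 : ℤ) ^ n * bettiNumber.{u, v} F n E := by
      simp only [Finset.sum_range_succ, Finset.sum_range_zero, bettiNumber_zero]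
      ring
    _ = ∑ c, (-1 : ℤ) ^ D.dim c := euler_eq
    _ = ∑ c, ∑ _g : G, (-1 : ℤ) ^ X.cellDecomposition.dim c := Fintype.sum_prod_type _
    _ = Nat.card G * X.eulerCharacteristic := by
      rw [← X.sum_neg_one_pow_dim_cellDecomposition, Finset.mul_sum]
      simp only [Finset.sum_const, nsmul_eq_mul, Finset.card_univ, Nat.card_eq_fintype_card]

-- Positivity of the Euler characteristic makes `1 + b₂(E)` at least `|G|`, so that
-- `b₂(E) < |G| / 2` leaves only the trivial covering.
lemma betti_eq_zero_of_two_mul_bettiNumber_lt (hXfin : X.IsFinite)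
    (hXdim : ∀ n, 2 < n → IsEmpty (X.Cell n)) (hχ : 0 < X.eulerCharacteristic)
    (hq : IsQuotientCoveringMap q G) (hE : 2 * bettiNumber.{u, v} F 2 E < Nat.card G) :
    bettiNumber.{u, v} F 1 X = 0 ∧ bettiNumber.{u, v} F 2 X = 0 ∧ X.eulerCharacteristic = 1 := by
  have euler_eq := one_sub_bettiNumber_one_add_bettiNumber_two (F := F) hXfin hXdim hq
  have card_le : (Nat.card G : ℤ) ≤ Nat.card G * X.eulerCharacteristic :=
    le_mul_of_one_le_right (Nat.cast_nonneg _) hχ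
  have card_eq_one : Nat.card G = 1 := by omega
  have := (Nat.card_eq_one_iff_unique.1 card_eq_one).1
  obtain ⟨e⟩ := nonempty_homeomorph_of_subsingleton_group hq
  rw [← bettiNumber_eq_of_homotopyEquiv F e.toHomotopyEquiv,
    ← bettiNumber_eq_of_homotopyEquiv F e.toHomotopyEquiv]
  rw [card_eq_one] at euler_eq hE
  omega

end EulerCharacteristic

lemma betti_eq_zero_of_betaInfP_eq_zero {p : ℕ} [Fact p.Prime] {F : Type v} [Field F]
    {X : CWSpace.{u}} [ConnectedSpace X] (hXfin : X.IsFinite)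
    (hXdim : ∀ n, 2 < n → IsEmpty (X.Cell n)) (h : betaInfP.{u, v} p F 2 X = 0)
    (hχ : 0 < X.eulerCharacteristic) :
    bettiNumber.{u, v} F 1 X = 0 ∧ bettiNumber.{u, v} F 2 X = 0 ∧ X.eulerCharacteristic = 1 := by
  obtain ⟨E, _, _, G, _, _, q, m, hq, hG, hE⟩ :=
    exists_connectedSpace_covering_of_betaInfP_lt (h.trans_lt one_half_pos)
  have card_ne_zero : Nat.card G ≠ 0 := hG ▸ pow_ne_zero _ (Fact.out : p.Prime).ne_zero
  have : Finite G := Nat.finite_of_card_ne_zero card_ne_zero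
  refine betti_eq_zero_of_two_mul_bettiNumber_lt hXfin hXdim hχ hq ?_
  rw [div_lt_div_iff₀ (Nat.cast_pos.2 (Nat.pos_of_ne_zero card_ne_zero)) two_pos, one_mul,
    mul_comm] at hE
  exact_mod_cast hE

end CWSpace

theorem mainTheorem2_general {p : ℕ} (hp : p.Prime) {d : ℕ} {F : Type v} [Field F] [CharP F p]
    {X Y : CWSpace.{u}} [ConnectedSpace X] [ConnectedSpace Y] (hYfin : Y.IsFinite)
    (hYdim : ∀ n, d < n → IsEmpty (Y.Cell n)) {f : X → Y}
    (hf : CWSpace.IsTower (fun G _ => ResiduallyFiniteP p G) Y X f)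
    (hY : betaInfP.{u, v} p F d Y = 0) :
    betaInfP.{u, v} p F d X = 0 ∧
      (d = 2 →
        X.eulerCharacteristic ≤ 0 ∨
          (bettiNumber.{u, v} F 1 X = 0 ∧ bettiNumber.{u, v} F 2 X = 0 ∧
            X.eulerCharacteristic = 1)) := by
  have : Fact p.Prime := ⟨hp⟩
  obtain ⟨hXfin, hXdim, hX⟩ := hf.hasSmallCoverings hYfin hYdim (.of_betaInfP_eq_zero hY)
  have := hXfin.finite
  have betaInfP_X : betaInfP.{u, v} p F d X = 0 :=
    hX.betaInfP_eq_zero X.cellDecomposition (CWSpace.cellDecomposition_dim_le hXdim)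
  refine ⟨betaInfP_X, ?_⟩
  rintro rfl
  exact (le_or_gt X.eulerCharacteristic 0).imp_right
    (CWSpace.betti_eq_zero_of_betaInfP_eq_zero hXfin hXdim betaInfP_X)

theorem mainTheorem2 (p : ℕ) (hp : p.Prime) (d : ℕ) (hd : 2 ≤ d)
    (F : Type v) [Field F] [CharP F p]
    (X Y : CWSpace.{u}) [ConnectedSpace X] [ConnectedSpace Y]
    (hXfin : X.IsFinite) (hYfin : Y.IsFinite)
    (hXdim : X.HasDimension d) (hYdim : Y.HasDimension d)
    (f : X → Y) (hf : CWSpace.IsTower (fun G _ => ResiduallyFiniteP p G) Y X f)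
    (hY : betaInfP.{u, v} p F d Y = 0) :
    betaInfP.{u, v} p F d X = 0 ∧
      (d = 2 →
        X.eulerCharacteristic ≤ 0 ∨
          (bettiNumber.{u, v} F 1 X = 0 ∧ bettiNumber.{u, v} F 2 X = 0 ∧
            X.eulerCharacteristic = 1)) :=
  mainTheorem2_general hp hYfin hYdim.2 hf hY
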